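/- Let $K$ be a field; $\otimes=\otimes_K$, and Sweedler notation is used throughout. **Couples.** A *couple* $(H,M)$ consists of a Hopf algebra $H$ over $K$ and an $H$-Hopf bimodule $M$, that is, an $H$-bimodule which is also an $H$-bicomodule, with coactions $\rho_l(m)=\sum m_{-1}\otimes m_0\in H\otimes M$ and $\rho_r(m)=\sum m_0\otimes m_1\in M\otimes H$, such that $$\rho_l(h.m.h')=\sum h_1m_{-1}h'_1\otimes h_2.m_0.h'_2,\qquad \rho_r(h.m.h')=\sum h_1.m_0.h'_1\otimes h_2m_1h'_2 .$$ We write $(\mathrm{Id}\otimes\rho_r)\rho_l(m)=\sum m_{-1}\otimes m_0\otimes m_1$. **Tensor Hopf algebra.** $T_H(M)=H\oplus M\oplus (M\otimes_H M)\oplus\cdots\oplus M^{\otimes_H n}\oplus\cdots$ is the tensor algebra of the $H$-bimodule $M$, with the unique comultiplication and counit that are algebra maps and that restrict to $\Delta_H$ and $\varepsilon_H$ on $H$ and to $\rho_l\oplus\rho_r$ and $0$ on $M$. It is a graded Hopf algebra. **Cotensor Hopf algebra.** For a couple $(B,N)$, $\mathrm{Cot}_B(N)=B\oplus N\oplus (N\square_B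 N)\oplus\cdots\oplus N^{\square_B n}\oplus\cdots$, where $N^{\square_B n}\subseteq N^{\otimes n}$ is the $n$-fold cotensor product. Its comultiplication is $\Delta_B$ on $B$ and $$\sum n^1\otimes\cdots\otimes n^k\mapsto \sum (n^1)_{-1}\otimes\bigl((n^1)_0\otimes\cdots\otimes n^k\bigr)+\sum_{i=1}^{k-1}\sum (n^1\otimes\cdots\otimes n^i)\otimes(n^{i+1}\otimes\cdots\otimes n^k)+\sum\bigl(n^1\otimes\cdots\otimes (n^k)_0\bigr)\otimes (n^k)_1$$ on $N^{\square_B k}$, $k\ge 1$; its counit is $\varepsilon_B$ on $B$ and $0$ on $N^{\square_B k}$, $k\geq 1$; its unit is $1_B$; its multiplication is the unique graded coalgebra map $\mathrm{Cot}_B(N)\otimes\mathrm{Cot}_B(N)\to\mathrm{Cot}_B(N)$ that is the multiplication of $B$ on $B\otimes B$ and is $b\otimes n+n'\otimes b'\mapsto b.n+n'.b'$ on $(B\otimes N)\oplus(N\otimes B)$. It is a graded Hopf algebra. **Pairings.** A *Hopf pairing* of Hopf algebras $H$, $B$ is a bilinear map $\varphi:H\times B\to K$ such that for all $h,g\in H$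 and $b,c\in B$ $$\varphi(1,b)=\varepsilon(b),\quad \varphi(h,1)=\varepsilon(h),\quad \varphi(h,bc)=\sum\varphi(h_1,b)\varphi(h_2,c),\quad \varphi(hg,b)=\sum\varphi(h,b_1)\varphi(g,b_2),\quad \varphi(S(h),b)=\varphi(h,S(b)).$$ If $H=\bigoplus_i H_i$ and $B=\bigoplus_j B_j$ are graded Hopf algebras, it is *graded* if $\varphi(H_i,B_j)=0$ for $i\neq j$. A *pairing of couples* $(\varphi_0,\varphi_1):(H,M)\times(B,N)\to K$ consists of a Hopf pairing $\varphi_0:H\times B\to K$ and a bilinear map $\varphi_1:M\times N\to K$ such that for all $h,g\in H$, $b,c\in B$, $m\in M$, $n\in N$ $$\varphi_1(h.m.g,n)=\sum\varphi_0(h,n_{-1})\varphi_1(m,n_0)\varphi_0(g,n_1),\qquad \varphi_1(m,b.n.c)=\sum\varphi_0(m_{-1},b)\varphi_1(m_0,n)\varphi_0(m_1,c).$$ A bilinear map $\varphi:X\times Y\to K$ is *left non-degenerate* if for every nonzero $y\in Y$ there is some $x\in X$ with $\varphi(x,y)\neq0$. **Proposition 3.4.** Let $(\varphi_0,\varphi_1):(H,M)\times(B,N)\to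 K$ be a pairing of couples. Then there exists a unique graded Hopf pairing $\varphi:T_H(M)\times\mathrm{Cot}_B(N)\to K$ that extends $\varphi_0$ and $\varphi_1$, i.e. whose restriction to $H\times B$ is $\varphi_0$ and whose restriction to $M\times N$ is $\varphi_1$. Moreover, if $\varphi_0$ and $\varphi_1$ are left non-degenerate, then so is $\varphi$. -/

import Mathlib

set_option linter.unusedSectionVars false
set_option linter.unusedSimpArgs false

noncomputable section

open TensorProduct Coalgebra

/- ### Hopf bimodules, and the ambient space of the cotensor Hopf algebra -/

section
section Actions
variable (K H M : Type*) [Field K] [Ring H] [HopfAlgebra K H] [AddCommGroup M] [Module K M]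
  [Module H M] [Module Hᵐᵒᵖ M] [IsScalarTower K H M] [IsScalarTower K Hᵐᵒᵖ M]

/-- The left action `h ⊗ m ↦ h.m` as a linear map. -/
def bimodActL : H ⊗[K] M →ₗ[K] M :=
  TensorProduct.lift (Algebra.lsmul K K M : H →ₐ[K] Module.End K M).toLinearMap

/-- The right action `m ⊗ h ↦ m.h` as a linear map. -/
def bimodActR : M ⊗[K] H →ₗ[K] M :=
  TensorProduct.lift (((Algebra.lsmul K K M : Hᵐᵒᵖ →ₐ[K] Module.End K M).toLinearMap ∘ₗ
    (MulOpposite.opLinearEquiv K : H ≃ₗ[K] Hᵐᵒᵖ).toLinearMap).flip)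

variable {H M}
@[simp] theorem bimodActL_tmul (h : H) (m : M) : bimodActL K H M (h ⊗ₜ m) = h • m := rfl
@[simp] theorem bimodActR_tmul (m : M) (h : H) :
    bimodActR K H M (m ⊗ₜ h) = MulOpposite.op h • m := rfl
end Actions

/-- An `H`-Hopf bimodule: an `H`-bimodule (the right action is the action of `Hᵐᵒᵖ`, so that `m.h` is
`MulOpposite.op h • m`), which is an `H`-bicomodule through `ρ_l = coactL : m ↦ ∑ m₋₁ ⊗ m₀` and
`ρ_r = coactR : m ↦ ∑ m₀ ⊗ m₁`, such that
`ρ_l(h.m) = ∑ h₁m₋₁ ⊗ h₂.m₀`, `ρ_l(m.h) = ∑ m₋₁h₁ ⊗ m₀.h₂`,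
`ρ_r(h.m) = ∑ h₁.m₀ ⊗ h₂m₁`, `ρ_r(m.h) = ∑ m₀.h₁ ⊗ m₁h₂`. -/
class HopfBimodule (K H M : Type*) [Field K] [Ring H] [HopfAlgebra K H]
    [AddCommGroup M] [Module K M] [Module H M] [Module Hᵐᵒᵖ M] [SMulCommClass H Hᵐᵒᵖ M]
    [IsScalarTower K H M] [IsScalarTower K Hᵐᵒᵖ M] where
  coactL : M →ₗ[K] H ⊗[K] M
  coactR : M →ₗ[K] M ⊗[K] H
  coactL_coassoc (m : M) : TensorProduct.assoc K H H M (comul.rTensor M (coactL m)) =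
    coactL.lTensor H (coactL m)
  coactL_counit (m : M) : (counit (R := K)).rTensor M (coactL m) = 1 ⊗ₜ m
  coactR_coassoc (m : M) : TensorProduct.assoc K M H H (coactR.rTensor H (coactR m)) =
    comul.lTensor M (coactR m)
  coactR_counit (m : M) : (counit (R := K)).lTensor M (coactR m) = m ⊗ₜ 1
  coact_comm (m : M) : TensorProduct.assoc K H M H (coactL.rTensor H (coactR m)) =
    coactR.lTensor H (coactL m)
  coactL_smul (h : H) (m : M) : coactL (h • m) =
    map (LinearMap.mul' K H) (bimodActL K H M)
      (tensorTensorTensorComm K H H H M (comul h ⊗ₜ coactL m))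
  coactL_op_smul (m : M) (h : H) : coactL (MulOpposite.op h • m) =
    map (LinearMap.mul' K H) (bimodActR K H M)
      (tensorTensorTensorComm K H M H H (coactL m ⊗ₜ comul h))
  coactR_smul (h : H) (m : M) : coactR (h • m) =
    map (bimodActL K H M) (LinearMap.mul' K H)
      (tensorTensorTensorComm K H H M H (comul h ⊗ₜ coactR m))
  coactR_op_smul (m : M) (h : H) : coactR (MulOpposite.op h • m) =
    map (bimodActR K H M) (LinearMap.mul' K H)
      (tensorTensorTensorComm K M H H H (coactR m ⊗ₜ comul h))

/-- The space `T(N) ⊗ B = ⨁ₙ N ⊗ ⋯ ⊗ N ⊗ B`. The cotensor Hopf algebra is built inside it: the right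
coaction identifies `N` with the cotensor product `N □_B B ⊆ N ⊗ B`, and hence `N^{□ n}` with
`N □_B (N □_B ⋯ (N □_B B)) ⊆ N ⊗ ⋯ ⊗ N ⊗ B`. -/
def CotAmb (K B N : Type*) [Field K] [AddCommGroup B] [Module K B] [AddCommGroup N] [Module K N] :
    Type _ := TensorAlgebra K N ⊗[K] B

namespace CotAmb

section Basic
variable (K B N : Type*) [Field K] [AddCommGroup B] [Module K B] [AddCommGroup N] [Module K N]

instance : AddCommGroup (CotAmb K B N) := inferInstanceAs (AddCommGroup (TensorAlgebra K N ⊗[K] B))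

instance : Module K (CotAmb K B N) := inferInstanceAs (Module K (TensorAlgebra K N ⊗[K] B))

/-- The degree zero part `b ↦ 1 ⊗ b`. -/
def in0 : B →ₗ[K] CotAmb K B N := TensorProduct.mk K (TensorAlgebra K N) B 1

/-- The map `n ⊗ a ↦ n ⊗ a`, which prepends a tensor factor `n` to `a ∈ T(N) ⊗ B`. -/
def sh : N →ₗ[K] CotAmb K B N →ₗ[K] CotAmb K B N :=
  LinearMap.rTensorHom B ∘ₗ LinearMap.mul K (TensorAlgebra K N) ∘ₗ TensorAlgebra.ι K

variable {K B N}
theorem ind {S : Submodule K (CotAmb K B N)} (h0 : ∀ b, in0 K B N b ∈ S)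
    (h1 : ∀ n a, a ∈ S → sh K B N n a ∈ S) (a : CotAmb K B N) : a ∈ S := by
  have key : ∀ t : TensorAlgebra K N, ∀ b : CotAmb K B N, b ∈ S →
      (LinearMap.rTensor B (LinearMap.mul K (TensorAlgebra K N) t) b : CotAmb K B N) ∈ S := by
    intro t
    induction t using TensorAlgebra.induction with
    | algebraMap r =>
      intro b hb
      have : LinearMap.mul K (TensorAlgebra K N) (algebraMap K _ r) = r • LinearMap.id := by
        ext; simp [Algebra.smul_def]
      rw [this, LinearMap.rTensor_smul, LinearMap.rTensor_id]
      exact S.smul_mem r hb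
    | ι x => intro b hb; exact h1 x b hb
    | mul s t hs ht =>
      intro b hb
      have : LinearMap.mul K (TensorAlgebra K N) (s * t) =
          LinearMap.mul K (TensorAlgebra K N) s ∘ₗ LinearMap.mul K (TensorAlgebra K N) t := by
        ext; simp [mul_assoc]
      rw [this, LinearMap.rTensor_comp]
      exact hs _ (ht _ hb)
    | add s t hs ht =>
      intro b hb
      rw [map_add, LinearMap.rTensor_add]
      exact S.add_mem (hs _ hb) (ht _ hb)
  induction a using TensorProduct.induction_on with
  | zero => exact S.zero_mem
  | tmul t b =>
    have h := key t _ (h0 b)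
    have e : (LinearMap.rTensor B (LinearMap.mul K (TensorAlgebra K N) t) (in0 K B N b) :
        CotAmb K B N) = (t * 1) ⊗ₜ[K] b := rfl
    rw [mul_one] at e
    exact e ▸ h
  | add x y hx hy => exact S.add_mem hx hy

variable {V : Type*} [AddCommGroup V] [Module K V]

/-- Auxiliary step of the recursor `para`. -/
def paraStep (α : N →ₗ[K] CotAmb K B N →ₗ[K] V) (β : N →ₗ[K] V →ₗ[K] V) :
    N →ₗ[K] Module.End K (CotAmb K B N × V) where
  toFun n := LinearMap.prod (sh K B N n ∘ₗ LinearMap.fst K _ _) (LinearMap.coprod (α n) (β n))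
  map_add' x y := by ext <;> simp
  map_smul' r x := by ext <;> simp

/-- The recursor `para` together with its argument. -/
def paraAux (g : B →ₗ[K] V) (α : N →ₗ[K] CotAmb K B N →ₗ[K] V) (β : N →ₗ[K] V →ₗ[K] V) :
    CotAmb K B N →ₗ[K] CotAmb K B N × V :=
  id <| TensorProduct.lift (M := TensorAlgebra K N) (N := B)
    ((LinearMap.lcomp K (CotAmb K B N × V) (LinearMap.prod (in0 K B N) g)) ∘ₗ
      (TensorAlgebra.lift K (paraStep α β)).toLinearMap)

theorem paraAux_sh (g : B →ₗ[K] V) (α : N →ₗ[K] CotAmb K B N →ₗ[K] V) (β : N →ₗ[K] V →ₗ[K] V)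
    (n : N) (a : CotAmb K B N) :
    paraAux g α β (sh K B N n a) = paraStep α β n (paraAux g α β a) := by
  have : (paraAux g α β ∘ₗ sh K B N n : TensorAlgebra K N ⊗[K] B →ₗ[K] _) =
      paraStep α β n ∘ₗ paraAux g α β := by
    refine TensorProduct.ext' fun t b => ?_
    change (TensorAlgebra.lift K (paraStep α β) (TensorAlgebra.ι K n * t)) (in0 K B N b, g b) =
      paraStep α β n (TensorAlgebra.lift K (paraStep α β) t (in0 K B N b, g b))
    simp
  exact LinearMap.congr_fun this a

theorem paraAux_in0 (g : B →ₗ[K] V) (α : N →ₗ[K] CotAmb K B N →ₗ[K] V) (β : N →ₗ[K] V →ₗ[K] V)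
    (b : B) : paraAux g α β (in0 K B N b) = (in0 K B N b, g b) := by
  change (TensorAlgebra.lift K (paraStep α β) 1) (in0 K B N b, g b) = _
  simp

/-- Recursion on `T(N) ⊗ B`: `F (1 ⊗ b) = g b` and `F (n ⊗ a) = α n a + β n (F a)`. -/
def para (g : B →ₗ[K] V) (α : N →ₗ[K] CotAmb K B N →ₗ[K] V) (β : N →ₗ[K] V →ₗ[K] V) :
    CotAmb K B N →ₗ[K] V :=
  LinearMap.snd K (CotAmb K B N) V ∘ₗ paraAux g α β

@[simp] theorem para_in0 (g : B →ₗ[K] V) (α : N →ₗ[K] CotAmb K B N →ₗ[K] V)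
    (β : N →ₗ[K] V →ₗ[K] V) (b : B) : para g α β (in0 K B N b) = g b := by
  change (paraAux g α β (in0 K B N b)).2 = g b
  rw [paraAux_in0]

@[simp] theorem para_sh (g : B →ₗ[K] V) (α : N →ₗ[K] CotAmb K B N →ₗ[K] V)
    (β : N →ₗ[K] V →ₗ[K] V) (n : N) (a : CotAmb K B N) :
    para g α β (sh K B N n a) = α n a + β n (para g α β a) := by
  have h1 : ∀ a : CotAmb K B N, (paraAux g α β a).1 = a := by
    let S : Submodule K (CotAmb K B N) := LinearMap.eqLocus
      (LinearMap.fst K (CotAmb K B N) V ∘ₗ paraAux g α β) LinearMap.id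
    intro a
    refine ind (S := S) ?_ ?_ a
    · intro b
      change (paraAux g α β (in0 K B N b)).1 = _
      rw [paraAux_in0]; rfl
    · intro n a ha
      change (paraAux g α β (sh K B N n a)).1 = sh K B N n a
      change (paraAux g α β a).1 = a at ha
      rw [paraAux_sh]
      simp [paraStep, ha]
  change (paraAux g α β (sh K B N n a)).2 = α n a + β n (paraAux g α β a).2
  rw [paraAux_sh]
  simp [paraStep, h1]

theorem hom_ext {f g : CotAmb K B N →ₗ[K] V} (h0 : ∀ b, f (in0 K B N b) = g (in0 K B N b))
    (h1 : ∀ n a, f a = g a → f (sh K B N n a) = g (sh K B N n a)) : f = g :=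
  LinearMap.ext fun a => ind (S := LinearMap.eqLocus f g) h0 h1 a

end Basic
end CotAmb
end

/- ### The structure maps of the ambient coalgebra -/

section
namespace CotAmb
section Coalg
variable (K B N : Type*) [Field K] [Ring B] [HopfAlgebra K B] [AddCommGroup N] [Module K N]
  [Module B N] [Module Bᵐᵒᵖ N] [SMulCommClass B Bᵐᵒᵖ N] [IsScalarTower K B N]
  [IsScalarTower K Bᵐᵒᵖ N] [HopfBimodule K B N]

/-- Splitting off the first factor: `κ (1 ⊗ b) = 0` and `κ (n ⊗ a) = n ⊗ a`. -/
def kap : CotAmb K B N →ₗ[K] N ⊗[K] CotAmb K B N :=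
  para 0 (TensorProduct.mk K N (CotAmb K B N)) 0

/-- The projection onto the degree zero part `B`. -/
def p0 : CotAmb K B N →ₗ[K] B := para LinearMap.id 0 0

variable {K B N} in
@[simp] theorem kap_in0 (b : B) : kap K B N (in0 K B N b) = 0 := by simp [kap]
variable {K B N} in
@[simp] theorem kap_sh (n : N) (a : CotAmb K B N) : kap K B N (sh K B N n a) = n ⊗ₜ a := by
  simp [kap]
variable {K B N} in
@[simp] theorem p0_in0 (b : B) : p0 K B N (in0 K B N b) = b := by simp [p0]
variable {K B N} in
@[simp] theorem p0_sh (n : N) (a : CotAmb K B N) : p0 K B N (sh K B N n a) = 0 := by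
  simp [p0]

/-- The linearisation of `sh`. -/
def shL : N ⊗[K] CotAmb K B N →ₗ[K] CotAmb K B N := TensorProduct.lift (sh K B N)

variable {K B N} in
@[simp] theorem shL_tmul (n : N) (a : CotAmb K B N) : shL K B N (n ⊗ₜ a) = sh K B N n a := rfl

variable {K B N} in
theorem kap_shL (x : N ⊗[K] CotAmb K B N) : kap K B N (shL K B N x) = x := by
  induction x with
  | zero => simp only [zero_tmul, tmul_zero, LinearEquiv.map_zero, LinearMap.map_zero, add_zero]
  | tmul n a => simp
  | add x y hx hy => rw [map_add, map_add, hx, hy]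

variable {K B N} in
theorem decomp (a : CotAmb K B N) : in0 K B N (p0 K B N a) + shL K B N (kap K B N a) = a := by
  have : in0 K B N ∘ₗ p0 K B N + shL K B N ∘ₗ kap K B N = LinearMap.id := by
    refine hom_ext (fun b => ?_) (fun n a ih => ?_) <;> simp
  exact LinearMap.congr_fun this a

/-- Auxiliary map `n, a ↦ ∑ n₋₁ ⊗ (n₀ ⊗ a)`. -/
def lamStep : N →ₗ[K] CotAmb K B N →ₗ[K] B ⊗[K] CotAmb K B N :=
  LinearMap.mk₂ K (fun n a => ((sh K B N).flip a).lTensor B (HopfBimodule.coactL (H := B) n))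
    (by simp) (by simp) (by simp [LinearMap.lTensor_add]) (by simp [LinearMap.lTensor_smul])

/-- The left coaction of `B`: `λ (1 ⊗ b) = ∑ b₁ ⊗ (1 ⊗ b₂)` and `λ (n ⊗ a) = ∑ n₋₁ ⊗ (n₀ ⊗ a)`. -/
def lam : CotAmb K B N →ₗ[K] B ⊗[K] CotAmb K B N :=
  para ((in0 K B N).lTensor B ∘ₗ comul) (lamStep K B N) 0

variable {K B N} in
@[simp] theorem lam_in0 (b : B) : lam K B N (in0 K B N b) = (in0 K B N).lTensor B (comul b) := by
  simp [lam]

variable {K B N} in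
@[simp] theorem lam_sh (n : N) (a : CotAmb K B N) : lam K B N (sh K B N n a) =
    ((sh K B N).flip a).lTensor B (HopfBimodule.coactL n) := by simp [lam, lamStep]

/-- The comultiplication of `T(N) ⊗ B`: `Δ (1 ⊗ b) = ∑ (1 ⊗ b₁) ⊗ (1 ⊗ b₂)` and
`Δ (n ⊗ a) = ∑ n₋₁ ⊗ (n₀ ⊗ a) + ∑ (n ⊗ a₁) ⊗ a₂`. On an element
`∑ n¹ ⊗ ⋯ ⊗ nᵏ₀ ⊗ nᵏ₁` coming from the cotensor power `N^{□ k}` it is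
`∑ n¹₋₁ ⊗ (n¹₀ ⊗ ⋯ ⊗ nᵏ) + ∑ᵢ (n¹ ⊗ ⋯ ⊗ nⁱ) ⊗ (nⁱ⁺¹ ⊗ ⋯ ⊗ nᵏ) + ∑ (n¹ ⊗ ⋯ ⊗ nᵏ₀) ⊗ nᵏ₁`. -/
def del : CotAmb K B N →ₗ[K] CotAmb K B N ⊗[K] CotAmb K B N :=
  para (map (in0 K B N) (in0 K B N) ∘ₗ comul)
    ((lamStep K B N).compr₂ ((in0 K B N).rTensor (CotAmb K B N)))
    (LinearMap.rTensorHom (CotAmb K B N) ∘ₗ sh K B N)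

variable {K B N} in
@[simp] theorem del_in0 (b : B) :
    del K B N (in0 K B N b) = map (in0 K B N) (in0 K B N) (comul b) := by
  simp [del]

variable {K B N} in
theorem del_sh (n : N) (a : CotAmb K B N) : del K B N (sh K B N n a) =
    (in0 K B N).rTensor (CotAmb K B N) (lam K B N (sh K B N n a)) +
      (sh K B N n).rTensor (CotAmb K B N) (del K B N a) := by simp [del, lamStep]

variable {K B N}

/-- The left coaction is coassociative. -/
theorem lam_coassoc (a : CotAmb K B N) :
    TensorProduct.assoc K B B (CotAmb K B N) (comul.rTensor _ (lam K B N a)) =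
      (lam K B N).lTensor B (lam K B N a) := by
  refine LinearMap.congr_fun (f := (TensorProduct.assoc K B B (CotAmb K B N)).toLinearMap ∘ₗ
    comul.rTensor _ ∘ₗ lam K B N) (g := (lam K B N).lTensor B ∘ₗ lam K B N) ?_ a
  refine hom_ext (fun b => ?_) (fun n a ih => ?_)
  · have h1 : ∀ t : B ⊗[K] B, TensorProduct.assoc K B B (CotAmb K B N) (comul.rTensor _
      ((in0 K B N).lTensor B t)) = ((in0 K B N).lTensor B).lTensor B
        (TensorProduct.assoc K B B B (comul.rTensor B t)) := by
      intro t
      induction t with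
      | zero => simp only [zero_tmul, tmul_zero, LinearEquiv.map_zero, LinearMap.map_zero, add_zero]
      | tmul x y =>
        simp only [LinearMap.lTensor_tmul, LinearMap.rTensor_tmul]
        generalize comul (R := K) x = z
        induction z with
        | zero => simp only [zero_tmul, tmul_zero, LinearEquiv.map_zero, LinearMap.map_zero, add_zero]
        | tmul => simp
        | add p q hp hq => simp only [add_tmul, LinearMap.map_add, LinearEquiv.map_add, hp, hq]
      | add p q hp hq => simp only [LinearMap.map_add, LinearEquiv.map_add, hp, hq]
    have h2 : ∀ t : B ⊗[K] B, (lam K B N).lTensor B ((in0 K B N).lTensor B t) =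
        ((in0 K B N).lTensor B).lTensor B (comul.lTensor B t) := by
      intro t
      induction t with
      | zero => simp only [zero_tmul, tmul_zero, LinearEquiv.map_zero, LinearMap.map_zero, add_zero]
      | tmul x y => simp
      | add p q hp hq => simp only [LinearMap.map_add, LinearEquiv.map_add, hp, hq]
    simp [h1, h2]
  · have h1 : ∀ t : B ⊗[K] N, TensorProduct.assoc K B B (CotAmb K B N) (comul.rTensor _
      (((sh K B N).flip a).lTensor B t)) = (((sh K B N).flip a).lTensor B).lTensor B
        (TensorProduct.assoc K B B N (comul.rTensor N t)) := by
      intro t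
      induction t with
      | zero => simp only [zero_tmul, tmul_zero, LinearEquiv.map_zero, LinearMap.map_zero, add_zero]
      | tmul x y =>
        simp only [LinearMap.lTensor_tmul, LinearMap.rTensor_tmul]
        generalize comul (R := K) x = z
        induction z with
        | zero => simp only [zero_tmul, tmul_zero, LinearEquiv.map_zero, LinearMap.map_zero, add_zero]
        | tmul => simp
        | add p q hp hq => simp only [add_tmul, LinearMap.map_add, LinearEquiv.map_add, hp, hq]
      | add p q hp hq => simp only [LinearMap.map_add, LinearEquiv.map_add, hp, hq]
    have h2 : ∀ t : B ⊗[K] N, (lam K B N).lTensor B (((sh K B N).flip a).lTensor B t) =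
        (((sh K B N).flip a).lTensor B).lTensor B ((HopfBimodule.coactL).lTensor B t) := by
      intro t
      induction t with
      | zero => simp only [zero_tmul, tmul_zero, LinearEquiv.map_zero, LinearMap.map_zero, add_zero]
      | tmul x y => simp
      | add p q hp hq => simp only [LinearMap.map_add, LinearEquiv.map_add, hp, hq]
    simp [h1, h2, HopfBimodule.coactL_coassoc]

/-- The recursion for the comultiplication, without arguments. -/
theorem del_eq (a : CotAmb K B N) : del K B N a =
    (in0 K B N).rTensor _ (lam K B N a) + (shL K B N).rTensor _
      ((TensorProduct.assoc K N _ _).symm ((del K B N).lTensor N (kap K B N a))) := by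
  refine LinearMap.congr_fun (f := del K B N) (g := (in0 K B N).rTensor _ ∘ₗ lam K B N +
    (shL K B N).rTensor _ ∘ₗ (TensorProduct.assoc K N _ _).symm.toLinearMap ∘ₗ
     (del K B N).lTensor N ∘ₗ kap K B N) ?_ a
  refine hom_ext (fun b => ?_) (fun n a ih => ?_)
  · simp [LinearMap.rTensor, LinearMap.lTensor, map_map]
  · rw [del_sh]
    simp only [LinearMap.add_apply, LinearMap.comp_apply, kap_sh, LinearMap.lTensor_tmul]
    congr 1
    generalize del K B N a = z
    induction z with
    | zero => simp only [zero_tmul, tmul_zero, LinearEquiv.map_zero, LinearMap.map_zero, add_zero]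
    | tmul => simp
    | add p q hp hq => simp only [tmul_add, LinearMap.map_add, LinearEquiv.map_add, hp, hq]

end Coalg
end CotAmb
end

/- ### The ambient space is a coalgebra -/

section
namespace CotAmb
section Coalg
variable {K B N : Type*} [Field K] [Ring B] [HopfAlgebra K B] [AddCommGroup N] [Module K N]
  [Module B N] [Module Bᵐᵒᵖ N] [SMulCommClass B Bᵐᵒᵖ N] [IsScalarTower K B N]
  [IsScalarTower K Bᵐᵒᵖ N] [HopfBimodule K B N]

theorem lam_counit (a : CotAmb K B N) : (counit (R := K)).rTensor _ (lam K B N a) = 1 ⊗ₜ a := by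
  refine LinearMap.congr_fun (f := (counit (R := K)).rTensor _ ∘ₗ lam K B N)
    (g := TensorProduct.mk K K _ 1) ?_ a
  refine hom_ext (fun b => ?_) (fun n a ih => ?_)
  · have h : ∀ t : B ⊗[K] B, (counit (R := K)).rTensor _ ((in0 K B N).lTensor B t) =
        (in0 K B N).lTensor K ((counit (R := K)).rTensor _ t) := fun t => by
      simp only [LinearMap.lTensor, LinearMap.rTensor, map_map]; rfl
    simp [h]
  · have h : ∀ t : B ⊗[K] N, (counit (R := K)).rTensor _ (((sh K B N).flip a).lTensor B t) =
        ((sh K B N).flip a).lTensor K ((counit (R := K)).rTensor _ t) := fun t => by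
      simp only [LinearMap.lTensor, LinearMap.rTensor, map_map]; rfl
    simp [h, HopfBimodule.coactL_counit]

theorem p0_del (a : CotAmb K B N) : (p0 K B N).rTensor _ (del K B N a) = lam K B N a := by
  have e1 : p0 K B N ∘ₗ in0 K B N = LinearMap.id := by ext; simp
  have e2 : p0 K B N ∘ₗ shL K B N = 0 := TensorProduct.ext' fun n a => by simp
  rw [del_eq, map_add, ← LinearMap.rTensor_comp_apply, ← LinearMap.rTensor_comp_apply, e1, e2]
  simp

theorem lam_del (a : CotAmb K B N) : TensorProduct.assoc K B _ _
    ((lam K B N).rTensor _ (del K B N a)) = (del K B N).lTensor B (lam K B N a) := by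
  refine LinearMap.congr_fun (f := (TensorProduct.assoc K B _ _).toLinearMap ∘ₗ
    (lam K B N).rTensor _ ∘ₗ del K B N) (g := (del K B N).lTensor B ∘ₗ lam K B N) ?_ a
  refine hom_ext (fun b => ?_) (fun n a ih => ?_)
  · have h1 : ∀ t : B ⊗[K] B, TensorProduct.assoc K B _ _ ((lam K B N).rTensor _
        (map (in0 K B N) (in0 K B N) t)) =
        (map (in0 K B N) (in0 K B N)).lTensor B (TensorProduct.assoc K B B B (comul.rTensor B t)) := by
      intro t
      induction t with
      | zero => simp only [zero_tmul, tmul_zero, LinearEquiv.map_zero, LinearMap.map_zero, add_zero]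
      | tmul x y =>
        simp only [map_tmul, LinearMap.rTensor_tmul, lam_in0]
        generalize comul (R := K) x = z
        induction z with
        | zero => simp only [zero_tmul, tmul_zero, LinearEquiv.map_zero, LinearMap.map_zero, add_zero]
        | tmul => simp
        | add p q hp hq => simp only [add_tmul, LinearMap.map_add, LinearEquiv.map_add, hp, hq]
      | add p q hp hq => simp only [LinearMap.map_add, LinearEquiv.map_add, hp, hq]
    have h2 : ∀ t : B ⊗[K] B, (del K B N).lTensor B ((in0 K B N).lTensor B t) =
        (map (in0 K B N) (in0 K B N)).lTensor B (comul.lTensor B t) := by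
      intro t
      induction t with
      | zero => simp only [zero_tmul, tmul_zero, LinearEquiv.map_zero, LinearMap.map_zero, add_zero]
      | tmul x y => simp
      | add p q hp hq => simp only [LinearMap.map_add, LinearEquiv.map_add, hp, hq]
    simp only [LinearMap.comp_apply, LinearEquiv.coe_coe, del_in0, lam_in0, h1, h2, coassoc_apply]
  · have h1 : ∀ t : B ⊗[K] CotAmb K B N, TensorProduct.assoc K B _ _ ((lam K B N).rTensor _
        ((in0 K B N).rTensor _ t)) =
        ((in0 K B N).rTensor _).lTensor B (TensorProduct.assoc K B B _ (comul.rTensor _ t)) := by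
      intro t
      induction t with
      | zero => simp only [zero_tmul, tmul_zero, LinearEquiv.map_zero, LinearMap.map_zero, add_zero]
      | tmul x y =>
        simp only [LinearMap.rTensor_tmul, lam_in0]
        generalize comul (R := K) x = z
        induction z with
        | zero => simp only [zero_tmul, tmul_zero, LinearEquiv.map_zero, LinearMap.map_zero, add_zero]
        | tmul => simp
        | add p q hp hq => simp only [add_tmul, LinearMap.map_add, LinearEquiv.map_add, hp, hq]
      | add p q hp hq => simp only [LinearMap.map_add, LinearEquiv.map_add, hp, hq]
    have h2 : ∀ z : CotAmb K B N ⊗[K] CotAmb K B N, TensorProduct.assoc K B _ _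
        ((lam K B N).rTensor _ ((sh K B N n).rTensor _ z)) =
        ((LinearMap.rTensorHom (CotAmb K B N) ∘ₗ sh K B N).flip z).lTensor B
          (HopfBimodule.coactL n) := by
      intro z
      induction z with
      | zero => simp
      | tmul x y =>
        simp only [LinearMap.rTensor_tmul, lam_sh]
        generalize HopfBimodule.coactL (K := K) (H := B) n = z
        induction z with
        | zero => simp only [zero_tmul, tmul_zero, LinearEquiv.map_zero, LinearMap.map_zero, add_zero]
        | tmul => simp
        | add p q hp hq => simp only [add_tmul, LinearMap.map_add, LinearEquiv.map_add, hp, hq]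
      | add p q hp hq => simp only [LinearMap.map_add, LinearEquiv.map_add, hp, hq, LinearMap.lTensor_add, LinearMap.add_apply]
    have h3 : ∀ t : B ⊗[K] N, (del K B N).lTensor B (((sh K B N).flip a).lTensor B t) =
        ((in0 K B N).rTensor _).lTensor B ((lam K B N).lTensor B (((sh K B N).flip a).lTensor B t)) +
        ((LinearMap.rTensorHom (CotAmb K B N) ∘ₗ sh K B N).flip (del K B N a)).lTensor B t := by
      intro t
      induction t with
      | zero => simp only [zero_tmul, tmul_zero, LinearEquiv.map_zero, LinearMap.map_zero, add_zero]
      | tmul x y => simp [del_sh, tmul_add]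
      | add p q hp hq => simp only [LinearMap.map_add, LinearEquiv.map_add, hp, hq]; abel
    simp only [LinearMap.comp_apply, LinearEquiv.coe_coe, del_sh, map_add, h1, h2, lam_coassoc]
    rw [lam_sh, h3]

theorem del_coassoc (a : CotAmb K B N) : TensorProduct.assoc K _ _ _
    ((del K B N).rTensor _ (del K B N a)) = (del K B N).lTensor _ (del K B N a) := by
  refine LinearMap.congr_fun (f := (TensorProduct.assoc K _ _ _).toLinearMap ∘ₗ
    (del K B N).rTensor _ ∘ₗ del K B N) (g := (del K B N).lTensor _ ∘ₗ del K B N) ?_ a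
  have h1 : ∀ t : B ⊗[K] CotAmb K B N, TensorProduct.assoc K _ _ _ ((del K B N).rTensor _
        ((in0 K B N).rTensor _ t)) = (in0 K B N).rTensor _
        (((in0 K B N).rTensor _).lTensor B (TensorProduct.assoc K B B _ (comul.rTensor _ t))) := by
      intro t
      induction t with
      | zero => simp only [zero_tmul, tmul_zero, LinearEquiv.map_zero, LinearMap.map_zero, add_zero]
      | tmul x y =>
        simp only [LinearMap.rTensor_tmul, del_in0]
        generalize comul (R := K) x = z
        induction z with
        | zero => simp only [zero_tmul, tmul_zero, LinearEquiv.map_zero, LinearMap.map_zero, add_zero]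
        | tmul => simp
        | add p q hp hq => simp only [add_tmul, LinearMap.map_add, LinearEquiv.map_add, hp, hq]
      | add p q hp hq => simp only [LinearMap.map_add, LinearEquiv.map_add, hp, hq]
  have h2 : ∀ n, ∀ z : CotAmb K B N ⊗[K] CotAmb K B N, TensorProduct.assoc K _ _ _
        ((del K B N).rTensor _ ((sh K B N n).rTensor _ z)) =
        (in0 K B N).rTensor _ (TensorProduct.assoc K B _ _
          ((lam K B N).rTensor _ ((sh K B N n).rTensor _ z))) +
        (sh K B N n).rTensor _ (TensorProduct.assoc K _ _ _ ((del K B N).rTensor _ z)) := by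
      intro n z
      induction z with
      | zero => simp only [zero_tmul, tmul_zero, LinearEquiv.map_zero, LinearMap.map_zero, add_zero]
      | tmul x y =>
        simp only [LinearMap.rTensor_tmul, del_sh, add_tmul, map_add]
        congr 1
        · generalize lam K B N (sh K B N n x) = z
          induction z with
          | zero => simp only [zero_tmul, tmul_zero, LinearEquiv.map_zero, LinearMap.map_zero, add_zero]
          | tmul => simp
          | add p q hp hq => simp only [add_tmul, LinearMap.map_add, LinearEquiv.map_add, hp, hq]
        · generalize del K B N x = z
          induction z with
          | zero => simp only [zero_tmul, tmul_zero, LinearEquiv.map_zero, LinearMap.map_zero, add_zero]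
          | tmul => simp
          | add p q hp hq => simp only [add_tmul, LinearMap.map_add, LinearEquiv.map_add, hp, hq]
      | add p q hp hq => simp only [LinearMap.map_add, LinearEquiv.map_add, hp, hq]; abel
  have h3 : ∀ {P : Type _} [AddCommGroup P] [Module K P] (f : P →ₗ[K] CotAmb K B N)
     (t : P ⊗[K] CotAmb K B N), (del K B N).lTensor _ (f.rTensor _ t) =
      f.rTensor _ ((del K B N).lTensor _ t) := fun f t => by
    simp only [LinearMap.lTensor, LinearMap.rTensor, map_map]; rfl
  have h3' : ∀ (t : B ⊗[K] CotAmb K B N), (del K B N).lTensor _ ((in0 K B N).rTensor _ t) =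
      (in0 K B N).rTensor _ ((del K B N).lTensor _ t) := fun t => by
    simp only [LinearMap.lTensor, LinearMap.rTensor, map_map]; rfl
  refine hom_ext (fun b => ?_) (fun n a ih => ?_)
  · have : del K B N (in0 K B N b) = (in0 K B N).rTensor _ (lam K B N (in0 K B N b)) := by
      rw [del_eq]; simp
    have e : (lam K B N).lTensor B (lam K B N (in0 K B N b)) =
       ((in0 K B N).lTensor B).lTensor B (comul.lTensor B (comul b)) := by
      rw [lam_in0]
      generalize comul (R := K) b = z
      induction z with
      | zero => simp only [zero_tmul, tmul_zero, LinearEquiv.map_zero, LinearMap.map_zero, add_zero]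
      | tmul => simp
      | add p q hp hq => simp only [LinearMap.map_add, LinearEquiv.map_add, hp, hq]
    simp only [LinearMap.comp_apply, LinearEquiv.coe_coe]
    rw [this, h1, h3', lam_coassoc, ← lam_del, this, e]
    congr 1
    rw [← e, ← lam_coassoc, lam_in0]
    generalize comul (R := K) b = z
    induction z with
    | zero => simp only [zero_tmul, tmul_zero, LinearEquiv.map_zero, LinearMap.map_zero, add_zero]
    | tmul x y =>
      simp only [LinearMap.lTensor_tmul, LinearMap.rTensor_tmul, lam_in0]
      generalize comul (R := K) x = z
      induction z with
      | zero => simp only [zero_tmul, tmul_zero, LinearEquiv.map_zero, LinearMap.map_zero, add_zero]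
      | tmul => simp
      | add p q hp hq => simp only [add_tmul, LinearMap.map_add, LinearEquiv.map_add, hp, hq]
    | add p q hp hq => simp only [LinearMap.map_add, LinearEquiv.map_add, hp, hq]
  · simp only [LinearMap.comp_apply, LinearEquiv.coe_coe] at ih ⊢
    have e := lam_del (sh K B N n a)
    conv_lhs at e => rw [del_sh, map_add, map_add]
    have e2 : ∀ t : B ⊗[K] CotAmb K B N, TensorProduct.assoc K B _ _ ((lam K B N).rTensor _
        ((in0 K B N).rTensor _ t)) =
        ((in0 K B N).rTensor _).lTensor B (TensorProduct.assoc K B B _ (comul.rTensor _ t)) := by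
      intro t
      induction t with
      | zero => simp only [zero_tmul, tmul_zero, LinearEquiv.map_zero, LinearMap.map_zero, add_zero]
      | tmul x y =>
        simp only [LinearMap.rTensor_tmul, lam_in0]
        generalize comul (R := K) x = z
        induction z with
        | zero => simp only [zero_tmul, tmul_zero, LinearEquiv.map_zero, LinearMap.map_zero, add_zero]
        | tmul => simp
        | add p q hp hq => simp only [add_tmul, LinearMap.map_add, LinearEquiv.map_add, hp, hq]
      | add p q hp hq => simp only [LinearMap.map_add, LinearEquiv.map_add, hp, hq]
    rw [del_sh, map_add, map_add, h1, h2, map_add, h3', h3, ← ih, ← e, e2, map_add, add_assoc]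

theorem del_counit_right (a : CotAmb K B N) :
    (counit ∘ₗ p0 K B N).lTensor _ (del K B N a) = a ⊗ₜ[K] (1 : K) := by
  refine LinearMap.congr_fun (f := (counit ∘ₗ p0 K B N).lTensor _ ∘ₗ del K B N)
    (g := (TensorProduct.mk K _ K).flip 1) ?_ a
  refine hom_ext (fun b => ?_) (fun n a ih => ?_)
  · have : ∀ t, (counit (R := K) ∘ₗ p0 K B N).lTensor _ (map (in0 K B N) (in0 K B N) t) =
       (in0 K B N).rTensor K (counit.lTensor B t) := by
      intro t
      induction t with
      | zero => simp only [zero_tmul, tmul_zero, LinearEquiv.map_zero, LinearMap.map_zero, add_zero]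
      | tmul => simp
      | add p q hp hq => simp only [LinearMap.map_add, LinearEquiv.map_add, hp, hq]
    simp [this]
  · have h1 : ∀ t, (counit (R := K) ∘ₗ p0 K B N).lTensor _ ((in0 K B N).rTensor _
        (((sh K B N).flip a).lTensor B t)) = 0 := by
      intro t
      induction t with
      | zero => simp only [zero_tmul, tmul_zero, LinearEquiv.map_zero, LinearMap.map_zero, add_zero]
      | tmul => simp
      | add p q hp hq => simp only [LinearMap.map_add, LinearEquiv.map_add, hp, hq, add_zero]
    have h2 : ∀ t, (counit (R := K) ∘ₗ p0 K B N).lTensor _ ((sh K B N n).rTensor _ t) =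
       (sh K B N n).rTensor _ ((counit (R := K) ∘ₗ p0 K B N).lTensor _ t) := by
      intro t
      induction t with
      | zero => simp only [zero_tmul, tmul_zero, LinearEquiv.map_zero, LinearMap.map_zero, add_zero]
      | tmul => simp
      | add p q hp hq => simp only [LinearMap.map_add, LinearEquiv.map_add, hp, hq]
    simp only [LinearMap.comp_apply] at ih ⊢
    rw [del_sh, map_add, lam_sh, h1, h2, ih]
    simp

instance : Coalgebra K (CotAmb K B N) where
  comul := del K B N
  counit := counit ∘ₗ p0 K B N
  coassoc := LinearMap.ext del_coassoc
  rTensor_counit_comp_comul := LinearMap.ext fun a => by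
    rw [LinearMap.rTensor_comp, LinearMap.comp_apply, LinearMap.comp_apply, p0_del, lam_counit]
    rfl
  lTensor_counit_comp_comul := LinearMap.ext del_counit_right

theorem comul_eq : (comul : CotAmb K B N →ₗ[K] _) = del K B N := rfl
theorem counit_eq : (counit : CotAmb K B N →ₗ[K] K) = counit ∘ₗ p0 K B N := rfl

end Coalg
end CotAmb
end

/- ### The universal property of the ambient coalgebra -/

section
theorem exists_fixpoint {K C V D : Type*} [Field K] [AddCommGroup C] [Module K C] [AddCommGroup V]
    [Module K V] [AddCommGroup D] [Module K D] (d : C →ₗ[K] D ⊗[K] C) (Fil : ℕ → Submodule K C)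
    (mono : Monotone Fil) (exh : ∀ c, ∃ k, c ∈ Fil k) (h0 : ∀ c ∈ Fil 0, d c = 0)
    (hS : ∀ k, ∀ c ∈ Fil (k + 1), d c ∈ LinearMap.range ((Fil k).subtype.lTensor D))
    (β : D ⊗[K] V →ₗ[K] V) (g : C →ₗ[K] V) :
    ∃! F : C →ₗ[K] V, ∀ c, F c = g c + β (F.lTensor D (d c)) := by
  obtain ⟨M, hM⟩ : ∃ M : ℕ → (C →ₗ[K] V),
      ∀ k c, M (k + 1) c = g c + β ((M k).lTensor D (d c)) :=
    ⟨fun k => Nat.rec 0 (fun _ m => g + β ∘ₗ m.lTensor D ∘ₗ d) k, fun _ _ => rfl⟩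
  have agree : ∀ (f f' : C →ₗ[K] V) k, (∀ c ∈ Fil k, f c = f' c) → ∀ c ∈ Fil (k + 1),
      f.lTensor D (d c) = f'.lTensor D (d c) := by
    intro f f' k hf c hc
    obtain ⟨w, hw⟩ := hS k c hc
    rw [← hw, ← LinearMap.lTensor_comp_apply, ← LinearMap.lTensor_comp_apply]
    congr 2
    ext x
    exact hf _ x.2
  have stab : ∀ k, ∀ j, ∀ c ∈ Fil k, M (k + 1 + j) c = M (k + 1) c := by
    intro k
    induction k with
    | zero =>
      intro j c hc
      rw [show 0 + 1 + j = j + 1 by omega, hM, hM, h0 c hc]; simp only [map_zero]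
    | succ k ih =>
      intro j c hc
      rw [show k + 1 + 1 + j = (k + 1 + j) + 1 by omega, hM, hM, agree _ _ k (ih j) c hc]
  have stab' : ∀ k j, k + 1 ≤ j → ∀ c ∈ Fil k, M j c = M (k + 1) c := by
    intro k j hj c hc
    obtain ⟨i, rfl⟩ := Nat.exists_eq_add_of_le hj
    exact stab k i c hc
  choose κ hκ using exh
  have val : ∀ k, ∀ c ∈ Fil k, M (κ c + 1) c = M (k + 1) c := by
    intro k c hc
    rw [← stab' (κ c) (max (κ c) k + 1) (by omega) c (hκ c),
      ← stab' k (max (κ c) k + 1) (by omega) c hc]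
  let F : C →ₗ[K] V :=
    { toFun := fun c => M (κ c + 1) c
      map_add' := fun x y => by
        have hx := mono (le_max_left (κ x) (κ y)) (hκ x)
        have hy := mono (le_max_right (κ x) (κ y)) (hκ y)
        change M (κ (x + y) + 1) (x + y) = M (κ x + 1) x + M (κ y + 1) y
        rw [val _ x hx, val _ y hy, val _ (x + y) (add_mem hx hy), map_add]
      map_smul' := fun r x => by
        change M (κ (r • x) + 1) (r • x) = r • M (κ x + 1) x
        rw [val _ (r • x) (Submodule.smul_mem _ r (hκ x)), map_smul] }
  have hF : ∀ k, ∀ c ∈ Fil k, F c = M (k + 1) c := val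
  refine ⟨F, fun c => ?_, fun F' hF' => ?_⟩
  · have hc := mono (Nat.le_succ _) (hκ c)
    rw [hF (κ c + 1) c hc, hM, agree _ F _ (fun x hx => (hF _ x hx).symm) c hc]
  · have : ∀ k, ∀ c ∈ Fil k, F' c = M (k + 1) c := by
      intro k
      induction k with
      | zero =>
        intro c hc
        rw [hF', hM, h0 c hc]; simp only [map_zero]
      | succ k ih =>
        intro c hc
        rw [hF', hM, agree _ _ k ih c hc]
    ext c
    exact (this _ c (hκ c)).trans (hF _ c (hκ c)).symm

namespace CotAmb
section Coalg
variable (K B N : Type*) [Field K] [Ring B] [HopfAlgebra K B] [AddCommGroup N] [Module K N]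
  [Module B N] [Module Bᵐᵒᵖ N] [SMulCommClass B Bᵐᵒᵖ N] [IsScalarTower K B N]
  [IsScalarTower K Bᵐᵒᵖ N] [HopfBimodule K B N]

/-- The projection `n ⊗ b ↦ ε(b) n` of the degree one part `N ⊗ B`, zero in other degrees. -/
def p1 : CotAmb K B N →ₗ[K] N :=
  para 0 ((LinearMap.lsmul K N).flip.compl₂ (counit (R := K) (A := CotAmb K B N))) 0

variable {K B N}
@[simp] theorem p1_in0 (b : B) : p1 K B N (in0 K B N b) = 0 := by simp [p1]
@[simp] theorem p1_sh (n : N) (a : CotAmb K B N) :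
    p1 K B N (sh K B N n a) = counit (R := K) a • n := by simp [p1]

theorem p1_del (a : CotAmb K B N) : (p1 K B N).rTensor _ (comul a) = kap K B N a := by
  refine LinearMap.congr_fun (f := (p1 K B N).rTensor _ ∘ₗ comul) (g := kap K B N) ?_ a
  have e1 : p1 K B N ∘ₗ in0 K B N = 0 := by ext; simp
  refine hom_ext (fun b => ?_) (fun n a ih => ?_)
  · simp only [LinearMap.comp_apply, comul_eq, del_eq, kap_in0, map_zero, add_zero,
      ← LinearMap.rTensor_comp_apply, e1]
    simp
  · have e2 : p1 K B N ∘ₗ sh K B N n = (LinearMap.toSpanSingleton K N n) ∘ₗ counit := by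
      ext a; simp
    simp only [LinearMap.comp_apply, comul_eq, del_sh, map_add, ← LinearMap.rTensor_comp_apply, e1, e2]
    rw [← comul_eq, LinearMap.rTensor_comp_apply, rTensor_counit_comul]
    simp

theorem p0_comul (a : CotAmb K B N) : map (p0 K B N) (p0 K B N) (comul a) = comul (p0 K B N a) := by
  refine LinearMap.congr_fun (f := map (p0 K B N) (p0 K B N) ∘ₗ comul) (g := comul ∘ₗ p0 K B N) ?_ a
  have e1 : p0 K B N ∘ₗ in0 K B N = LinearMap.id := by ext; simp
  have e : ∀ z, map (p0 K B N) (p0 K B N) z = (p0 K B N).lTensor B ((p0 K B N).rTensor _ z) :=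
    fun z => by simp [LinearMap.lTensor, LinearMap.rTensor, map_map]
  refine hom_ext (fun b => ?_) (fun n a ih => ?_)
  · simp only [LinearMap.comp_apply, comul_eq, e, p0_del, lam_in0, ← LinearMap.lTensor_comp_apply, e1]
    simp
  · have e2 : p0 K B N ∘ₗ (sh K B N).flip a = 0 := by ext; simp
    simp only [LinearMap.comp_apply, comul_eq, e, p0_del, lam_sh, ← LinearMap.lTensor_comp_apply, e2]
    simp

theorem p1_comul (a : CotAmb K B N) :
    map (p0 K B N) (p1 K B N) (comul a) = HopfBimodule.coactL (p1 K B N a) := by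
  refine LinearMap.congr_fun (f := map (p0 K B N) (p1 K B N) ∘ₗ comul)
    (g := HopfBimodule.coactL ∘ₗ p1 K B N) ?_ a
  have e1 : p1 K B N ∘ₗ in0 K B N = 0 := by ext; simp
  have e : ∀ z, map (p0 K B N) (p1 K B N) z = (p1 K B N).lTensor B ((p0 K B N).rTensor _ z) :=
    fun z => by simp [LinearMap.lTensor, LinearMap.rTensor, map_map]
  refine hom_ext (fun b => ?_) (fun n a ih => ?_)
  · simp only [LinearMap.comp_apply, comul_eq, e, p0_del, lam_in0, ← LinearMap.lTensor_comp_apply, e1]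
    simp
  · have e2 : p1 K B N ∘ₗ (sh K B N).flip a = counit (R := K) a • LinearMap.id := by ext; simp
    simp only [LinearMap.comp_apply, comul_eq, e, p0_del, lam_sh, ← LinearMap.lTensor_comp_apply, e2]
    simp [LinearMap.lTensor_smul]

theorem decomp' (a : CotAmb K B N) :
    in0 K B N (p0 K B N a) + shL K B N ((p1 K B N).rTensor _ (comul a)) = a := by
  rw [p1_del, decomp]

variable (K B N) in
/-- The projection onto the degrees less than `k`. -/
def trunc : ℕ → (CotAmb K B N →ₗ[K] CotAmb K B N)
  | 0 => 0
  | k + 1 => in0 K B N ∘ₗ p0 K B N + shL K B N ∘ₗ (trunc k).lTensor N ∘ₗ kap K B N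

theorem trunc_eventually (a : CotAmb K B N) : ∃ k, ∀ j ≥ k, trunc K B N j a = a := by
  let S : Submodule K (CotAmb K B N) :=
    { carrier := {a | ∃ k, ∀ j ≥ k, trunc K B N j a = a}
      add_mem' := by
        rintro x y ⟨k, hk⟩ ⟨l, hl⟩
        exact ⟨max k l, fun j hj => by rw [map_add, hk j (by omega), hl j (by omega)]⟩
      zero_mem' := ⟨0, fun j _ => map_zero _⟩
      smul_mem' := by
        rintro r x ⟨k, hk⟩
        exact ⟨k, fun j hj => by rw [map_smul, hk j hj]⟩ }
  refine ind (S := S) ?_ ?_ a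
  · intro b
    refine ⟨1, fun j hj => ?_⟩
    obtain ⟨j, rfl⟩ := Nat.exists_eq_add_of_le' hj
    simp [trunc]
  · rintro n a ⟨k, hk⟩
    refine ⟨k + 1, fun j hj => ?_⟩
    obtain ⟨j, rfl⟩ := Nat.exists_eq_add_of_le' (Nat.one_le_of_lt hj)
    simp [trunc, hk j (by omega)]

theorem trunc_rTensor_eventually {X : Type*} [AddCommGroup X] [Module K X]
    (z : CotAmb K B N ⊗[K] X) : ∃ k, ∀ j ≥ k, (trunc K B N j).rTensor X z = z := by
  induction z with
  | zero => exact ⟨0, fun j _ => map_zero _⟩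
  | tmul a x =>
    obtain ⟨k, hk⟩ := trunc_eventually a
    exact ⟨k, fun j hj => by rw [LinearMap.rTensor_tmul, hk j hj]⟩
  | add x y hx hy =>
    obtain ⟨k, hk⟩ := hx
    obtain ⟨l, hl⟩ := hy
    exact ⟨max k l, fun j hj => by rw [map_add, hk j (by omega), hl j (by omega)]⟩

variable {C : Type*} [AddCommGroup C] [Module K C] [Coalgebra K C]

theorem coalgHom_ext {F G : C →ₗc[K] CotAmb K B N} (h0 : ∀ c, p0 K B N (F c) = p0 K B N (G c))
    (h1 : ∀ c, p1 K B N (F c) = p1 K B N (G c)) : F = G := by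
  have key : ∀ (F : C →ₗc[K] CotAmb K B N) c, kap K B N (F c) =
      map (p1 K B N ∘ₗ F.toLinearMap) F.toLinearMap (comul c) := by
    intro F c
    rw [← p1_del, ← CoalgHomClass.map_comp_comul_apply F c]
    simp only [LinearMap.rTensor, map_map]
    rfl
  have e1 : p1 K B N ∘ₗ F.toLinearMap = p1 K B N ∘ₗ G.toLinearMap := LinearMap.ext h1
  have : ∀ k c, trunc K B N k (F c) = trunc K B N k (G c) := by
    intro k
    induction k with
    | zero => intro c; rfl
    | succ k ih =>
      intro c
      have e2 : trunc K B N k ∘ₗ F.toLinearMap = trunc K B N k ∘ₗ G.toLinearMap :=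
        LinearMap.ext ih
      simp only [trunc, LinearMap.add_apply, LinearMap.comp_apply, h0, key, LinearMap.lTensor,
        map_map, e1, e2]
  ext c
  obtain ⟨k, hk⟩ := trunc_eventually (F c)
  obtain ⟨l, hl⟩ := trunc_eventually (G c)
  have := this (max k l) c
  rwa [hk _ (by omega), hl _ (by omega)] at this

section Univ

theorem univ_p0
    (f0 : C →ₗ[K] B) (f1 : C →ₗ[K] N) (F : C →ₗ[K] CotAmb K B N)
    (hF : ∀ c, F c = in0 K B N (f0 c) + shL K B N (F.lTensor N (f1.rTensor C (comul c))))
    (c : C) : p0 K B N (F c) = f0 c := by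
  have e2 : ∀ z, p0 K B N (shL K B N z) = 0 := fun z => by
    induction z with
    | zero => simp only [zero_tmul, tmul_zero, LinearEquiv.map_zero, LinearMap.map_zero, add_zero]
    | tmul => simp
    | add p q hp hq => simp only [LinearMap.map_add, LinearEquiv.map_add, hp, hq, add_zero]
  rw [hF, map_add, p0_in0, e2, add_zero]

theorem univ_kap
    (f0 : C →ₗ[K] B) (f1 : C →ₗ[K] N) (F : C →ₗ[K] CotAmb K B N)
    (hF : ∀ c, F c = in0 K B N (f0 c) + shL K B N (F.lTensor N (f1.rTensor C (comul c))))
    (c : C) : kap K B N (F c) = F.lTensor N (f1.rTensor C (comul c)) := by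
  rw [hF, map_add, kap_in0, kap_shL, zero_add]

theorem univ_counit
    (f0 : C →ₗ[K] B) (f1 : C →ₗ[K] N) (F : C →ₗ[K] CotAmb K B N)
    (hε : ∀ c, counit (R := K) (f0 c) = counit (R := K) c)
    (hF : ∀ c, F c = in0 K B N (f0 c) + shL K B N (F.lTensor N (f1.rTensor C (comul c))))
    (c : C) : counit (R := K) (F c) = counit (R := K) c := by
  rw [counit_eq, LinearMap.comp_apply, univ_p0 f0 f1 F hF, hε]

theorem univ_p1
    (f0 : C →ₗ[K] B) (f1 : C →ₗ[K] N) (F : C →ₗ[K] CotAmb K B N)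
    (hε : ∀ c, counit (R := K) (f0 c) = counit (R := K) c)
    (hF : ∀ c, F c = in0 K B N (f0 c) + shL K B N (F.lTensor N (f1.rTensor C (comul c))))
    (c : C) : p1 K B N (F c) = f1 c := by
  have e2 : ∀ z, p1 K B N (shL K B N z) = TensorProduct.rid K N (counit.lTensor N z) := fun z => by
    induction z with
    | zero => simp only [zero_tmul, tmul_zero, LinearEquiv.map_zero, LinearMap.map_zero, add_zero]
    | tmul => simp
    | add p q hp hq => simp only [LinearMap.map_add, LinearEquiv.map_add, hp, hq]
  have e3 : (counit (R := K) ∘ₗ F) = counit := LinearMap.ext (univ_counit f0 f1 F hε hF)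
  have e4 : ∀ z : C ⊗[K] C, counit.lTensor N (f1.rTensor C z) =
      f1.rTensor K (counit.lTensor C z) := fun z => by
    simp only [LinearMap.lTensor, LinearMap.rTensor, map_map]; rfl
  rw [hF, map_add, p1_in0, e2, ← LinearMap.lTensor_comp_apply, e3, e4, lTensor_counit_comul]
  simp

theorem univ_lam
    (f0 : C →ₗ[K] B) (f1 : C →ₗ[K] N) (F : C →ₗ[K] CotAmb K B N)
    (hΔ : ∀ c, map f0 f0 (comul c) = comul (f0 c))
    (hρ : ∀ c, map f0 f1 (comul c) = HopfBimodule.coactL (f1 c))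
    (hF : ∀ c, F c = in0 K B N (f0 c) + shL K B N (F.lTensor N (f1.rTensor C (comul c))))
    (c : C) : lam K B N (F c) = map f0 F (comul c) := by
  have e1 : ∀ z : C ⊗[K] C, lam K B N (shL K B N (F.lTensor N (f1.rTensor C z))) =
      map f0 (shL K B N ∘ₗ F.lTensor N ∘ₗ f1.rTensor C)
        (TensorProduct.assoc K C C C (comul.rTensor C z)) := by
    intro z
    induction z with
    | zero => simp only [zero_tmul, tmul_zero, LinearEquiv.map_zero, LinearMap.map_zero, add_zero]
    | tmul x y =>
      simp only [LinearMap.lTensor_tmul, LinearMap.rTensor_tmul, shL_tmul, lam_sh, ← hρ]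
      generalize comul (R := K) x = z
      induction z with
      | zero => simp only [zero_tmul, tmul_zero, LinearEquiv.map_zero, LinearMap.map_zero, add_zero]
      | tmul => simp
      | add p q hp hq => simp only [add_tmul, LinearMap.map_add, LinearEquiv.map_add, hp, hq]
    | add p q hp hq => simp only [LinearMap.map_add, LinearEquiv.map_add, hp, hq]
  have e2 : F = in0 K B N ∘ₗ f0 + (shL K B N ∘ₗ F.lTensor N ∘ₗ f1.rTensor C) ∘ₗ comul :=
    LinearMap.ext hF
  rw [hF, map_add, lam_in0, e1, ← hΔ, coassoc_apply]
  conv_rhs => rw [e2, map_add_right]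
  simp [LinearMap.lTensor, map_map]

theorem univ_comul
    (f0 : C →ₗ[K] B) (f1 : C →ₗ[K] N) (F : C →ₗ[K] CotAmb K B N)
    (hΔ : ∀ c, map f0 f0 (comul c) = comul (f0 c))
    (hρ : ∀ c, map f0 f1 (comul c) = HopfBimodule.coactL (f1 c))
    (hF : ∀ c, F c = in0 K B N (f0 c) + shL K B N (F.lTensor N (f1.rTensor C (comul c))))
    (c : C) : map F F (comul c) = comul (F c) := by
  let X : (C →ₗ[K] CotAmb K B N ⊗[K] CotAmb K B N) → (C →ₗ[K] CotAmb K B N ⊗[K] CotAmb K B N) :=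
    fun W => (shL K B N).rTensor _ ∘ₗ (TensorProduct.assoc K N _ _).symm.toLinearMap ∘ₗ
      W.lTensor N ∘ₗ f1.rTensor C ∘ₗ comul
  have hY : ∀ c, del K B N (F c) = (in0 K B N).rTensor _ (map f0 F (comul c)) +
      X (del K B N ∘ₗ F) c := by
    intro c
    rw [del_eq, univ_lam f0 f1 F hΔ hρ hF, univ_kap f0 f1 F hF]
    simp [X, LinearMap.lTensor_comp]
  have e2 : F = in0 K B N ∘ₗ f0 + (shL K B N ∘ₗ F.lTensor N ∘ₗ f1.rTensor C) ∘ₗ comul :=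
    LinearMap.ext hF
  have hZ : ∀ c, map F F (comul c) = (in0 K B N).rTensor _ (map f0 F (comul c)) +
      X (map F F ∘ₗ comul) c := by
    intro c
    have e2' : map F F = map (in0 K B N ∘ₗ f0) F +
        map ((shL K B N ∘ₗ F.lTensor N ∘ₗ f1.rTensor C) ∘ₗ comul) F := by
      rw [← map_add_left, ← e2]
    rw [LinearMap.congr_fun e2' (comul c), LinearMap.add_apply]
    congr 1
    · simp [LinearMap.rTensor, map_map]
    · have e3 : ∀ w : C ⊗[K] C, map ((shL K B N ∘ₗ F.lTensor N ∘ₗ f1.rTensor C) ∘ₗ comul) F w =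
          (shL K B N).rTensor _ ((TensorProduct.assoc K N _ _).symm
            (map f1 (map F F) (TensorProduct.assoc K C C C (comul.rTensor C w)))) := by
        intro w
        induction w with
        | zero => simp only [zero_tmul, tmul_zero, LinearEquiv.map_zero, LinearMap.map_zero, add_zero]
        | tmul x y =>
          simp only [map_tmul, LinearMap.rTensor_tmul, LinearMap.comp_apply]
          generalize comul (R := K) x = z
          induction z with
          | zero => simp only [zero_tmul, tmul_zero, LinearEquiv.map_zero, LinearMap.map_zero, add_zero]
          | tmul => simp
          | add p q hp hq => simp only [add_tmul, LinearMap.map_add, LinearEquiv.map_add, hp, hq]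
        | add p q hp hq => simp only [LinearMap.map_add, LinearEquiv.map_add, hp, hq]
      rw [e3, coassoc_apply]
      simp [X, LinearMap.lTensor, LinearMap.rTensor, map_map]
  let D : C →ₗ[K] CotAmb K B N ⊗[K] CotAmb K B N := del K B N ∘ₗ F - map F F ∘ₗ comul
  have hD : ∀ c, D c = X D c := by
    intro c
    have : D c = del K B N (F c) - map F F (comul c) := rfl
    rw [this, hY, hZ]
    simp [X, D, LinearMap.lTensor_sub]
  have e4 : p0 K B N ∘ₗ shL K B N = 0 := TensorProduct.ext' fun n a => by simp
  have e5 : kap K B N ∘ₗ shL K B N = LinearMap.id := LinearMap.ext kap_shL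
  have hT : ∀ k, (trunc K B N k).rTensor _ ∘ₗ D = 0 := by
    intro k
    induction k with
    | zero => ext; simp [trunc]
    | succ k ih =>
      have e6 : trunc K B N (k + 1) ∘ₗ shL K B N = shL K B N ∘ₗ (trunc K B N k).lTensor N := by
        rw [trunc, LinearMap.add_comp, LinearMap.comp_assoc, e4, LinearMap.comp_assoc,
          LinearMap.comp_assoc, e5]
        simp
      have e7 : ∀ w : N ⊗[K] (CotAmb K B N ⊗[K] CotAmb K B N),
          ((trunc K B N k).lTensor N).rTensor _ ((TensorProduct.assoc K N _ _).symm w) =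
          (TensorProduct.assoc K N _ _).symm (((trunc K B N k).rTensor _).lTensor N w) := by
        intro w
        induction w with
        | zero => simp only [zero_tmul, tmul_zero, LinearEquiv.map_zero, LinearMap.map_zero, add_zero]
        | tmul x y =>
          induction y with
          | zero => simp only [zero_tmul, tmul_zero, LinearEquiv.map_zero, LinearMap.map_zero, add_zero]
          | tmul => simp
          | add p q hp hq => simp only [tmul_add, LinearMap.map_add, LinearEquiv.map_add, hp, hq]
        | add p q hp hq => simp only [LinearMap.map_add, LinearEquiv.map_add, hp, hq]
      refine LinearMap.ext fun c => ?_
      rw [LinearMap.comp_apply, hD]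
      simp only [X, LinearMap.comp_apply, LinearEquiv.coe_coe]
      rw [← LinearMap.rTensor_comp_apply, e6, LinearMap.rTensor_comp_apply, e7,
        ← LinearMap.lTensor_comp_apply, ih]
      simp
  obtain ⟨k, hk⟩ := trunc_rTensor_eventually (D c)
  have h1 : D c = 0 := by
    rw [← hk k le_rfl]
    exact LinearMap.congr_fun (hT k) c
  exact (sub_eq_zero.mp h1).symm

end Univ

end Coalg
end CotAmb
end

/- ### The ambient space is a bialgebra -/

section
namespace CotAmb
section Coalg
variable (K B N : Type*) [Field K] [Ring B] [HopfAlgebra K B] [AddCommGroup N] [Module K N]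
  [Module B N] [Module Bᵐᵒᵖ N] [SMulCommClass B Bᵐᵒᵖ N] [IsScalarTower K B N]
  [IsScalarTower K Bᵐᵒᵖ N] [HopfBimodule K B N]

/-- The part of degree at most `k`. -/
def lfil : ℕ → Submodule K (CotAmb K B N)
  | 0 => LinearMap.ker (kap K B N)
  | k + 1 => (LinearMap.range ((lfil k).subtype.lTensor N)).comap (kap K B N)

variable {K B N}

theorem range_lTensor_mono {X Y Z : Type*} [AddCommGroup X] [Module K X] [AddCommGroup Y]
    [Module K Y] [AddCommGroup Z] [Module K Z] (f : Y →ₗ[K] Z) (P : Submodule K Z)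
    (h : ∀ y, f y ∈ P) (t : X ⊗[K] Y) :
    f.lTensor X t ∈ LinearMap.range (P.subtype.lTensor X) := by
  refine ⟨(f.codRestrict P h).lTensor X t, ?_⟩
  rw [← LinearMap.lTensor_comp_apply, LinearMap.subtype_comp_codRestrict]

theorem lfil_mono : Monotone (lfil K B N) := by
  refine monotone_nat_of_le_succ fun k => ?_
  induction k with
  | zero =>
    intro a ha
    change kap K B N a ∈ LinearMap.range _
    rw [LinearMap.mem_ker.mp ha]
    exact zero_mem _
  | succ k ih =>
    rintro a ⟨w, hw⟩
    change kap K B N a ∈ LinearMap.range ((lfil K B N (k + 1)).subtype.lTensor N)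
    rw [← hw]
    exact range_lTensor_mono _ _ (fun y => ih y.2) w

theorem lfil_exh (a : CotAmb K B N) : ∃ k, a ∈ lfil K B N k := by
  let S : Submodule K (CotAmb K B N) :=
    { carrier := {a | ∃ k, a ∈ lfil K B N k}
      add_mem' := by
        rintro x y ⟨k, hk⟩ ⟨l, hl⟩
        exact ⟨max k l, add_mem (lfil_mono (le_max_left k l) hk) (lfil_mono (le_max_right k l) hl)⟩
      zero_mem' := ⟨0, zero_mem _⟩
      smul_mem' := by
        rintro r x ⟨k, hk⟩
        exact ⟨k, Submodule.smul_mem _ r hk⟩ }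
  refine ind (S := S) ?_ ?_ a
  · exact fun b => ⟨0, kap_in0 b⟩
  · rintro n a ⟨k, hk⟩
    refine ⟨k + 1, ⟨n ⊗ₜ ⟨a, hk⟩, by simp⟩⟩

theorem in0_mem_lfil (b : B) (k : ℕ) : in0 K B N b ∈ lfil K B N k :=
  lfil_mono (Nat.zero_le k) (kap_in0 b)

theorem lam_lfil (k : ℕ) (a : CotAmb K B N) (ha : a ∈ lfil K B N k) :
    lam K B N a ∈ LinearMap.range ((lfil K B N k).subtype.lTensor B) := by
  rw [← decomp a, map_add]
  refine add_mem ?_ ?_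
  · rw [lam_in0]
    exact range_lTensor_mono _ _ (fun b => in0_mem_lfil b k) _
  · cases k with
    | zero => rw [LinearMap.mem_ker.mp ha]; simp
    | succ k =>
      obtain ⟨w, hw⟩ := ha
      rw [← hw]
      clear hw
      induction w with
      | zero => simp
      | tmul n y =>
        simp only [LinearMap.lTensor_tmul, shL_tmul, lam_sh]
        refine range_lTensor_mono _ _ (fun m => ?_) _
        exact ⟨m ⊗ₜ y, by simp⟩
      | add p q hp hq => simp only [LinearMap.map_add, LinearEquiv.map_add]; exact add_mem hp hq

variable (K B N) in
/-- The degree one component `a ⊗ c ↦ a⁰.c¹ + a¹.c⁰` of the multiplication. -/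
def mulF1 : CotAmb K B N ⊗[K] CotAmb K B N →ₗ[K] N :=
  bimodActL K B N ∘ₗ map (p0 K B N) (p1 K B N) + bimodActR K B N ∘ₗ map (p1 K B N) (p0 K B N)

variable (K B N) in
/-- The degree zero component `a ⊗ c ↦ a⁰c⁰` of the multiplication. -/
def mulF0 : CotAmb K B N ⊗[K] CotAmb K B N →ₗ[K] B :=
  LinearMap.mul' K B ∘ₗ map (p0 K B N) (p0 K B N)

theorem mulF1_comul (a c : CotAmb K B N) :
    (mulF1 K B N).rTensor _ (comul (R := K) (a ⊗ₜ[K] c)) =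
      (bimodActL K B N).rTensor _ (tensorTensorTensorComm K B _ N _ (lam K B N a ⊗ₜ kap K B N c)) +
      (bimodActR K B N).rTensor _
        (tensorTensorTensorComm K N _ B _ (kap K B N a ⊗ₜ lam K B N c)) := by
  rw [← p1_del a, ← p1_del c, ← p0_del a, ← p0_del c, ← comul_eq, comul_tmul]
  generalize comul (R := K) a = x
  generalize comul (R := K) c = y
  induction x with
  | zero => simp only [zero_tmul, tmul_zero, LinearEquiv.map_zero, LinearMap.map_zero, add_zero]
  | tmul x1 x2 =>
    induction y with
    | zero => simp only [zero_tmul, tmul_zero, LinearEquiv.map_zero, LinearMap.map_zero, add_zero]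
    | tmul y1 y2 => simp [mulF1]
    | add p q hp hq => simp only [tmul_add, LinearMap.map_add, LinearEquiv.map_add, hp, hq]; abel
  | add p q hp hq => simp only [add_tmul, LinearMap.map_add, LinearEquiv.map_add, hp, hq]; abel

variable (K B N) in
/-- The part of total degree at most `k` of the tensor square. -/
def pfil (k : ℕ) : Submodule K (CotAmb K B N ⊗[K] CotAmb K B N) :=
  Submodule.span K {x | ∃ i j, i + j ≤ k ∧ ∃ a ∈ lfil K B N i, ∃ c ∈ lfil K B N j, x = a ⊗ₜ c}

theorem pfil_mono : Monotone (pfil K B N) := fun _ _ h =>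
  Submodule.span_mono fun _ ⟨i, j, hij, r⟩ => ⟨i, j, hij.trans h, r⟩

theorem pfil_exh (x : CotAmb K B N ⊗[K] CotAmb K B N) : ∃ k, x ∈ pfil K B N k := by
  induction x with
  | zero => exact ⟨0, zero_mem _⟩
  | tmul a c =>
    obtain ⟨i, hi⟩ := lfil_exh a
    obtain ⟨j, hj⟩ := lfil_exh c
    exact ⟨i + j, Submodule.subset_span ⟨i, j, le_rfl, a, hi, c, hj, rfl⟩⟩
  | add p q hp hq =>
    obtain ⟨k, hk⟩ := hp
    obtain ⟨l, hl⟩ := hq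
    exact ⟨max k l, add_mem (pfil_mono (le_max_left k l) hk) (pfil_mono (le_max_right k l) hl)⟩

theorem mem_aux1 {i j k : ℕ} (h : i + j ≤ k) (t : B ⊗[K] lfil K B N i) (u : N ⊗[K] lfil K B N j) :
    (bimodActL K B N).rTensor _ (tensorTensorTensorComm K B _ N _
      ((lfil K B N i).subtype.lTensor B t ⊗ₜ (lfil K B N j).subtype.lTensor N u)) ∈
      LinearMap.range ((pfil K B N k).subtype.lTensor N) := by
  induction t with
  | zero => simp
  | tmul b x =>
    induction u with
    | zero => simp
    | tmul n y =>
      exact ⟨(b • n) ⊗ₜ ⟨x.1 ⊗ₜ y.1, Submodule.subset_span ⟨i, j, h, _, x.2, _, y.2, rfl⟩⟩, by simp⟩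
    | add p q hp hq => simp only [tmul_add, LinearMap.map_add, LinearEquiv.map_add]; exact add_mem hp hq
  | add p q hp hq => simp only [add_tmul, LinearMap.map_add, LinearEquiv.map_add]; exact add_mem hp hq

theorem mem_aux2 {i j k : ℕ} (h : i + j ≤ k) (t : N ⊗[K] lfil K B N i) (u : B ⊗[K] lfil K B N j) :
    (bimodActR K B N).rTensor _ (tensorTensorTensorComm K N _ B _
      ((lfil K B N i).subtype.lTensor N t ⊗ₜ (lfil K B N j).subtype.lTensor B u)) ∈
      LinearMap.range ((pfil K B N k).subtype.lTensor N) := by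
  induction t with
  | zero => simp
  | tmul n x =>
    induction u with
    | zero => simp
    | tmul b y =>
      exact ⟨(MulOpposite.op b • n) ⊗ₜ
        ⟨x.1 ⊗ₜ y.1, Submodule.subset_span ⟨i, j, h, _, x.2, _, y.2, rfl⟩⟩, by simp⟩
    | add p q hp hq => simp only [tmul_add, LinearMap.map_add, LinearEquiv.map_add]; exact add_mem hp hq
  | add p q hp hq => simp only [add_tmul, LinearMap.map_add, LinearEquiv.map_add]; exact add_mem hp hq

variable (K B N) in
theorem exists_mul : ∃! F : CotAmb K B N ⊗[K] CotAmb K B N →ₗ[K] CotAmb K B N,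
    ∀ x, F x = in0 K B N (mulF0 K B N x) +
      shL K B N (F.lTensor N ((mulF1 K B N).rTensor _ (comul x))) := by
  refine exists_fixpoint ((mulF1 K B N).rTensor _ ∘ₗ comul) (pfil K B N) pfil_mono pfil_exh
    ?_ ?_ (shL K B N) (in0 K B N ∘ₗ mulF0 K B N)
  · intro x hx
    induction hx using Submodule.span_induction with
    | mem x hx =>
      obtain ⟨i, j, hij, a, ha, c, hc, rfl⟩ := hx
      obtain ⟨rfl, rfl⟩ : i = 0 ∧ j = 0 := by omega
      rw [LinearMap.comp_apply, mulF1_comul, LinearMap.mem_ker.mp ha, LinearMap.mem_ker.mp hc]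
      simp
    | zero => exact map_zero _
    | add x y _ _ hx hy => rw [map_add, hx, hy, add_zero]
    | smul r x _ hx => rw [map_smul, hx, smul_zero]
  · intro k x hx
    induction hx using Submodule.span_induction with
    | mem x hx =>
      obtain ⟨i, j, hij, a, ha, c, hc, rfl⟩ := hx
      rw [LinearMap.comp_apply, mulF1_comul]
      obtain ⟨t, ht⟩ := lam_lfil i a ha
      obtain ⟨u, hu⟩ := lam_lfil j c hc
      refine add_mem ?_ ?_
      · cases j with
        | zero => rw [LinearMap.mem_ker.mp hc]; simp
        | succ j =>
          obtain ⟨v, hv⟩ := hc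
          rw [← hv, ← ht]
          exact mem_aux1 (by omega) t v
      · cases i with
        | zero => rw [LinearMap.mem_ker.mp ha]; simp
        | succ i =>
          obtain ⟨v, hv⟩ := ha
          rw [← hv, ← hu]
          exact mem_aux2 (by omega) v u
    | zero => rw [map_zero]; exact zero_mem _
    | add x y _ _ hx hy => rw [map_add]; exact add_mem hx hy
    | smul r x _ hx => rw [map_smul]; exact Submodule.smul_mem _ r hx

variable (K B N) in
/-- The multiplication, as a linear map: the unique solution of the recursion
`F c = f₀ c + ∑ f₁(c₁) ⊗ F(c₂)`, i.e. the coalgebra map with components `f₀` and `f₁`. -/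
def mulL : CotAmb K B N ⊗[K] CotAmb K B N →ₗ[K] CotAmb K B N := (exists_mul K B N).choose

theorem mulL_spec (x : CotAmb K B N ⊗[K] CotAmb K B N) : mulL K B N x =
    in0 K B N (mulF0 K B N x) +
      shL K B N ((mulL K B N).lTensor N ((mulF1 K B N).rTensor _ (comul x))) :=
  (exists_mul K B N).choose_spec.1 x

theorem mulF0_counit (x : CotAmb K B N ⊗[K] CotAmb K B N) :
    counit (R := K) (mulF0 K B N x) = counit (R := K) x := by
  induction x with
  | zero => simp only [zero_tmul, tmul_zero, LinearEquiv.map_zero, LinearMap.map_zero, add_zero]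
  | tmul a c => simp [mulF0, counit_eq, mul_comm]
  | add p q hp hq => simp only [LinearMap.map_add, LinearEquiv.map_add, hp, hq]

theorem mulF0_comul (x : CotAmb K B N ⊗[K] CotAmb K B N) :
    map (mulF0 K B N) (mulF0 K B N) (comul x) = comul (mulF0 K B N x) := by
  induction x with
  | zero => simp only [zero_tmul, tmul_zero, LinearEquiv.map_zero, LinearMap.map_zero, add_zero]
  | tmul a c =>
    simp only [mulF0, LinearMap.comp_apply, map_tmul, LinearMap.mul'_apply, Bialgebra.comul_mul,
      ← p0_comul, comul_tmul]
    generalize comul (R := K) a = x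
    generalize comul (R := K) c = y
    induction x with
    | zero => simp
    | tmul x1 x2 =>
      induction y with
      | zero => simp
      | tmul y1 y2 => simp
      | add p q hp hq => simp only [tmul_add, mul_add, LinearMap.map_add, LinearEquiv.map_add, hp, hq]
    | add p q hp hq => simp only [add_tmul, add_mul, LinearMap.map_add, LinearEquiv.map_add, hp, hq]
  | add p q hp hq => simp only [LinearMap.map_add, LinearEquiv.map_add, hp, hq]

theorem mulF1_coact (x : CotAmb K B N ⊗[K] CotAmb K B N) :
    map (mulF0 K B N) (mulF1 K B N) (comul x) = HopfBimodule.coactL (mulF1 K B N x) := by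
  induction x with
  | zero => simp only [zero_tmul, tmul_zero, LinearEquiv.map_zero, LinearMap.map_zero, add_zero]
  | tmul a c =>
    have e : mulF1 K B N (a ⊗ₜ c) = p0 K B N a • p1 K B N c +
      MulOpposite.op (p0 K B N c) • p1 K B N a := by simp [mulF1]
    rw [e, map_add, HopfBimodule.coactL_smul, HopfBimodule.coactL_op_smul, ← p0_comul, ← p0_comul,
      ← p1_comul, ← p1_comul, comul_tmul]
    generalize comul (R := K) a = x
    generalize comul (R := K) c = y
    induction x with
    | zero => simp only [zero_tmul, tmul_zero, LinearEquiv.map_zero, LinearMap.map_zero, add_zero]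
    | tmul x1 x2 =>
      induction y with
      | zero => simp only [zero_tmul, tmul_zero, LinearEquiv.map_zero, LinearMap.map_zero, add_zero]
      | tmul y1 y2 => simp [mulF0, mulF1, tmul_add]
      | add p q hp hq => simp only [tmul_add, LinearMap.map_add, LinearEquiv.map_add, hp, hq]; abel
    | add p q hp hq => simp only [add_tmul, LinearMap.map_add, LinearEquiv.map_add, hp, hq]; abel
  | add p q hp hq => simp only [LinearMap.map_add, LinearEquiv.map_add, hp, hq]

variable (K B N) in
/-- The multiplication, as a coalgebra map. It is the unique coalgebra map whose projections to
`B` and `N` are `mulF0` and `mulF1`, see `coalgHom_ext`. -/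
def mulC : CotAmb K B N ⊗[K] CotAmb K B N →ₗc[K] CotAmb K B N where
  toLinearMap := mulL K B N
  counit_comp := LinearMap.ext
    (univ_counit (mulF0 K B N) (mulF1 K B N) (mulL K B N) mulF0_counit mulL_spec)
  map_comp_comul := LinearMap.ext
    (univ_comul (mulF0 K B N) (mulF1 K B N) (mulL K B N) mulF0_comul mulF1_coact mulL_spec)

theorem p0_mulC (a c : CotAmb K B N) :
    p0 K B N (mulC K B N (a ⊗ₜ c)) = p0 K B N a * p0 K B N c :=
  univ_p0 (mulF0 K B N) (mulF1 K B N) (mulL K B N) mulL_spec _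

theorem p1_mulC (a c : CotAmb K B N) :
    p1 K B N (mulC K B N (a ⊗ₜ c)) =
      p0 K B N a • p1 K B N c + MulOpposite.op (p0 K B N c) • p1 K B N a :=
  univ_p1 (mulF0 K B N) (mulF1 K B N) (mulL K B N) mulF0_counit mulL_spec _

variable (K B N) in
/-- The inclusion of `B` as a coalgebra map. -/
def in0C : B →ₗc[K] CotAmb K B N where
  toLinearMap := in0 K B N
  counit_comp := LinearMap.ext fun b => by simp [counit_eq]
  map_comp_comul := LinearMap.ext fun b => by simp [comul_eq]

instance : Mul (CotAmb K B N) := ⟨fun a c => mulC K B N (a ⊗ₜ c)⟩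
instance : One (CotAmb K B N) := ⟨in0 K B N 1⟩

theorem mul_def (a c : CotAmb K B N) : a * c = mulC K B N (a ⊗ₜ c) := rfl
theorem one_def : (1 : CotAmb K B N) = in0 K B N 1 := rfl

@[simp] theorem p0_mul (a c : CotAmb K B N) : p0 K B N (a * c) = p0 K B N a * p0 K B N c :=
  p0_mulC a c
@[simp] theorem p1_mul (a c : CotAmb K B N) : p1 K B N (a * c) =
    p0 K B N a • p1 K B N c + MulOpposite.op (p0 K B N c) • p1 K B N a :=
  p1_mulC a c

/-- The unit as a coalgebra map. -/
def oneC : K →ₗc[K] CotAmb K B N where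
  toLinearMap := LinearMap.toSpanSingleton K _ 1
  counit_comp := LinearMap.ext_ring (by simp [counit_eq, one_def])
  map_comp_comul := LinearMap.ext_ring (by
    simp [comul_eq, one_def, Algebra.TensorProduct.one_def])

theorem one_mul' (a : CotAmb K B N) : 1 * a = a := by
  have : ((mulC K B N).comp ((Coalgebra.TensorProduct.map oneC (CoalgHom.id K _)).comp
    (Coalgebra.TensorProduct.lid K (CotAmb K B N)).symm.toCoalgHom)) = CoalgHom.id K _ := by
    refine coalgHom_ext (fun c => ?_) (fun c => ?_)
    · change p0 K B N (((1 : K) • 1) * c) = p0 K B N c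
      simp [one_def]
    · change p1 K B N (((1 : K) • 1) * c) = p1 K B N c
      simp [one_def]
  have h := DFunLike.congr_fun this a
  change ((1 : K) • 1) * a = a at h
  rwa [one_smul] at h

theorem mul_one' (a : CotAmb K B N) : a * 1 = a := by
  have : ((mulC K B N).comp ((Coalgebra.TensorProduct.map (CoalgHom.id K _) oneC).comp
    (Coalgebra.TensorProduct.rid K K (CotAmb K B N)).symm.toCoalgHom)) = CoalgHom.id K _ := by
    refine coalgHom_ext (fun c => ?_) (fun c => ?_)
    · change p0 K B N (c * ((1 : K) • 1)) = p0 K B N c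
      simp [one_def]
    · change p1 K B N (c * ((1 : K) • 1)) = p1 K B N c
      simp [one_def]
  have h := DFunLike.congr_fun this a
  change a * ((1 : K) • 1) = a at h
  rwa [one_smul] at h

theorem mul_assoc' (a b c : CotAmb K B N) : a * b * c = a * (b * c) := by
  have : (mulC K B N).comp (Coalgebra.TensorProduct.map (mulC K B N) (CoalgHom.id K _)) =
    (mulC K B N).comp ((Coalgebra.TensorProduct.map (CoalgHom.id K _) (mulC K B N)).comp
    (Coalgebra.TensorProduct.assoc K K (CotAmb K B N) (CotAmb K B N) (CotAmb K B N)).toCoalgHom) := by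
    refine coalgHom_ext (fun c => ?_) (fun c => ?_)
    · induction c with
      | zero => simp only [map_zero]
      | tmul x z =>
        induction x with
        | zero => simp only [zero_tmul, map_zero]
        | tmul x y =>
          change p0 K B N (x * y * z) = p0 K B N (x * (y * z))
          simp [mul_assoc]
        | add p q hp hq => simp only [add_tmul, map_add, hp, hq]
      | add p q hp hq => simp only [map_add, hp, hq]
    · induction c with
      | zero => simp only [map_zero]
      | tmul x z =>
        induction x with
        | zero => simp only [zero_tmul, map_zero]
        | tmul x y =>
          change p1 K B N (x * y * z) = p1 K B N (x * (y * z))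
          simp only [p1_mul, p0_mul, smul_add, mul_smul, MulOpposite.op_mul, smul_comm, add_assoc]
        | add p q hp hq => simp only [add_tmul, map_add, hp, hq]
      | add p q hp hq => simp only [map_add, hp, hq]
  exact DFunLike.congr_fun this ((a ⊗ₜ b) ⊗ₜ c)

instance : Ring (CotAmb K B N) where
  __ := (inferInstance : AddCommGroup (CotAmb K B N))
  mul_assoc := mul_assoc'
  one_mul := one_mul'
  mul_one := mul_one'
  left_distrib a b c := by simp only [mul_def, tmul_add, map_add]
  right_distrib a b c := by simp only [mul_def, add_tmul, map_add]
  zero_mul a := by simp only [mul_def, zero_tmul, map_zero]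
  mul_zero a := by simp only [mul_def, tmul_zero, map_zero]

instance : Algebra K (CotAmb K B N) := Algebra.ofModule
  (fun r x y => by rw [mul_def, ← smul_tmul', map_smul, mul_def])
  (fun r x y => by simp only [mul_def, tmul_smul, map_smul])

theorem comul_mul' (a b : CotAmb K B N) :
    comul (R := K) (a * b) = comul (R := K) a * comul (R := K) b := by
  have h : map (mulC K B N).toLinearMap (mulC K B N).toLinearMap (comul (a ⊗ₜ[K] b)) =
      comul (R := K) (a * b) := CoalgHomClass.map_comp_comul_apply (mulC K B N) (a ⊗ₜ b)
  rw [← h, comul_tmul]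
  generalize comul (R := K) a = x
  generalize comul (R := K) b = y
  induction x with
  | zero => rw [zero_tmul, LinearEquiv.map_zero, LinearMap.map_zero, zero_mul]
  | tmul x1 x2 =>
    induction y with
    | zero => rw [tmul_zero, LinearEquiv.map_zero, LinearMap.map_zero, mul_zero]
    | tmul y1 y2 => rw [Algebra.TensorProduct.tmul_mul_tmul]; rfl
    | add p q hp hq => rw [tmul_add, LinearEquiv.map_add, LinearMap.map_add, mul_add, hp, hq]
  | add p q hp hq => rw [add_tmul, LinearEquiv.map_add, LinearMap.map_add, add_mul, hp, hq]

instance : Bialgebra K (CotAmb K B N) := Bialgebra.mk' K (CotAmb K B N)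
  (by simp [counit_eq, one_def])
  (fun {a b} => by simp [counit_eq])
  (by simp [comul_eq, one_def, Algebra.TensorProduct.one_def])
  (fun {a b} => comul_mul' a b)

end Coalg
end CotAmb
end

/- ### The cotensor powers, and their sum as a subcoalgebra -/

section
theorem mem_range_map_subtype {K X Y V W : Type*} [Field K] [AddCommGroup X] [Module K X]
    [AddCommGroup Y] [Module K Y] [AddCommGroup V] [Module K V] [AddCommGroup W] [Module K W]
    (P : Submodule K X) (Q : Submodule K Y) (f : X →ₗ[K] V) (g : Y →ₗ[K] W)
    (hf : LinearMap.ker f = P) (hg : LinearMap.ker g = Q) (z : X ⊗[K] Y)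
    (h1 : f.rTensor Y z = 0) (h2 : g.lTensor X z = 0) :
    z ∈ LinearMap.range (map P.subtype Q.subtype) := by
  subst hf hg
  obtain ⟨w, rfl⟩ := (Module.Flat.rTensor_exact Y (f.exact_subtype_ker_map) z).mp h1
  have h3 : g.lTensor (LinearMap.ker f) w = 0 := by
    apply Module.Flat.rTensor_preserves_injective_linearMap (M := W) (LinearMap.ker f).subtype
      (Submodule.subtype_injective _)
    rw [map_zero, ← h2]
    simp only [LinearMap.rTensor, LinearMap.lTensor, map_map]; rfl
  obtain ⟨v, rfl⟩ := (Module.Flat.lTensor_exact _ (g.exact_subtype_ker_map) w).mp h3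
  exact ⟨v, by simp only [LinearMap.rTensor, LinearMap.lTensor, map_map]; rfl⟩

namespace CotAmb
section Coalg
variable (K B N : Type*) [Field K] [Ring B] [HopfAlgebra K B] [AddCommGroup N] [Module K N]
  [Module B N] [Module Bᵐᵒᵖ N] [SMulCommClass B Bᵐᵒᵖ N] [IsScalarTower K B N]
  [IsScalarTower K Bᵐᵒᵖ N] [HopfBimodule K B N]

/-- The cotensor product `N □_B A ⊆ N ⊗ A` for `A = T(N) ⊗ B`: the `z` with `(ρ_r ⊗ 1) z = (1 ⊗ λ) z`. -/
def cotensorAmb : Submodule K (N ⊗[K] CotAmb K B N) :=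
  LinearMap.eqLocus ((TensorProduct.assoc K N B (CotAmb K B N)).toLinearMap ∘ₗ
    (HopfBimodule.coactR (H := B)).rTensor (CotAmb K B N)) ((lam K B N).lTensor N)

/-- The cotensor powers inside `T(N) ⊗ B`: `N^{□ 0} = B` and `N^{□ (n + 1)} = N □_B N^{□ n}`. (For
`n ≥ 1` this is the usual `N^{□ n} ⊆ N ⊗ ⋯ ⊗ N`, embedded through the right coaction of the last
factor.) -/
def cotPow : ℕ → Submodule K (CotAmb K B N)
  | 0 => LinearMap.range (in0 K B N)
  | n + 1 => (cotensorAmb K B N ⊓ LinearMap.range ((cotPow n).subtype.lTensor N)).map (shL K B N)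

/-- The projection onto degree `k`. -/
def pr : ℕ → (CotAmb K B N →ₗ[K] CotAmb K B N)
  | 0 => in0 K B N ∘ₗ p0 K B N
  | k + 1 => shL K B N ∘ₗ (pr k).lTensor N ∘ₗ kap K B N

/-- The obstruction to lying in the cotensor product in the first place. -/
def xi : CotAmb K B N →ₗ[K] N ⊗[K] (B ⊗[K] CotAmb K B N) :=
  ((TensorProduct.assoc K N B (CotAmb K B N)).toLinearMap ∘ₗ
    (HopfBimodule.coactR (H := B)).rTensor (CotAmb K B N) - (lam K B N).lTensor N) ∘ₗ kap K B N

/-- The obstruction to lying in all the cotensor products. -/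
def omega : CotAmb K B N →ₗ[K] CotAmb K B N ⊗[K] (N ⊗[K] (B ⊗[K] CotAmb K B N)) :=
  (xi K B N).lTensor _ ∘ₗ comul

variable {K B N}

theorem xi_eq_zero_iff (a : CotAmb K B N) : xi K B N a = 0 ↔ kap K B N a ∈ cotensorAmb K B N := by
  rw [xi, LinearMap.comp_apply, LinearMap.sub_apply, sub_eq_zero]; rfl

theorem sum_pr (k : ℕ) (a : CotAmb K B N) :
    ∑ i ∈ Finset.range k, pr K B N i a = trunc K B N k a := by
  have : ∀ k, ∑ i ∈ Finset.range k, pr K B N i = trunc K B N k := by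
    intro k
    induction k with
    | zero => rfl
    | succ k ih =>
      rw [Finset.sum_range_succ', trunc, ← ih, add_comm]
      congr 1
      simp only [pr]
      ext a
      have : (∑ i ∈ Finset.range k, pr K B N i).lTensor N =
          ∑ i ∈ Finset.range k, (pr K B N i).lTensor N := map_sum (LinearMap.lTensorHom N) _ _
      simp [this]
  rw [← this, LinearMap.sum_apply]

theorem lam_pr (k : ℕ) (a : CotAmb K B N) :
    lam K B N (pr K B N k a) = (pr K B N k).lTensor B (lam K B N a) := by
  refine LinearMap.congr_fun (f := lam K B N ∘ₗ pr K B N k)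
    (g := (pr K B N k).lTensor B ∘ₗ lam K B N) ?_ a
  cases k with
  | zero =>
    have e1 : p0 K B N ∘ₗ in0 K B N = LinearMap.id := by ext; simp
    refine hom_ext (fun b => ?_) (fun n a ih => ?_)
    · simp only [LinearMap.comp_apply, pr, p0_in0, lam_in0, ← LinearMap.lTensor_comp_apply,
        LinearMap.comp_assoc, e1, LinearMap.comp_id]
    · have e2 : p0 K B N ∘ₗ (sh K B N).flip a = 0 := by ext; simp
      simp only [LinearMap.comp_apply, pr, p0_sh, lam_sh, ← LinearMap.lTensor_comp_apply,
        LinearMap.comp_assoc, e2]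
      simp
  | succ k =>
    have e1 : kap K B N ∘ₗ in0 K B N = 0 := by ext; simp
    refine hom_ext (fun b => ?_) (fun n a ih => ?_)
    · simp only [LinearMap.comp_apply, pr, kap_in0, lam_in0, ← LinearMap.lTensor_comp_apply,
        LinearMap.comp_assoc, e1]
      simp
    · have e2 : shL K B N ∘ₗ (pr K B N k).lTensor N ∘ₗ kap K B N ∘ₗ (sh K B N).flip a =
        (sh K B N).flip (pr K B N k a) := by ext; simp
      simp only [LinearMap.comp_apply, pr, kap_sh, lam_sh, ← LinearMap.lTensor_comp_apply,
        LinearMap.comp_assoc, e2, LinearMap.lTensor_tmul, shL_tmul]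

/-- The homogeneous components of an element without obstruction lie in the cotensor powers. -/
theorem pr_mem_of_omega (k : ℕ) : ∀ a : CotAmb K B N, omega K B N a = 0 →
    pr K B N k a ∈ cotPow K B N k := by
  induction k with
  | zero => exact fun a _ => ⟨p0 K B N a, rfl⟩
  | succ k ih =>
    intro a ha
    have h1 : kap K B N a ∈ LinearMap.range ((LinearMap.ker (omega K B N)).subtype.lTensor N) := by
      refine (Module.Flat.lTensor_exact N (omega K B N).exact_subtype_ker_map _).mp ?_
      rw [← p1_del]
      have e : ∀ z, (omega K B N).lTensor N ((p1 K B N).rTensor _ z) =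
          (p1 K B N).rTensor _ (((xi K B N).lTensor _).lTensor _ (comul.lTensor _ z)) := fun z => by
        simp only [LinearMap.rTensor, LinearMap.lTensor, map_map, omega]; rfl
      have e2 : ∀ z : (CotAmb K B N ⊗[K] CotAmb K B N) ⊗[K] CotAmb K B N,
          ((xi K B N).lTensor _).lTensor _ (TensorProduct.assoc K _ _ _ z) =
          TensorProduct.assoc K _ _ _ ((xi K B N).lTensor _ z) := fun z => by
        refine LinearMap.congr_fun (f := ((xi K B N).lTensor _).lTensor _ ∘ₗ
          (TensorProduct.assoc K _ _ _).toLinearMap) (g := (TensorProduct.assoc K _ _ _).toLinearMap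
          ∘ₗ (xi K B N).lTensor _) (TensorProduct.ext_threefold fun x y z => ?_) z
        simp
      have e3 : ∀ z : CotAmb K B N ⊗[K] CotAmb K B N, (xi K B N).lTensor _ (comul.rTensor _ z) =
          (comul (R := K) (A := CotAmb K B N)).rTensor _ ((xi K B N).lTensor _ z) := fun z => by
        simp only [LinearMap.rTensor, LinearMap.lTensor, map_map]; rfl
      have ha' : (xi K B N).lTensor _ (comul a) = 0 := ha
      rw [e, ← coassoc_apply, e2, e3, ha']
      simp
    have h2 : xi K B N a = 0 := by
      have e : ∀ z : CotAmb K B N ⊗[K] CotAmb K B N, (counit (R := K)).rTensor _ ((xi K B N).lTensor _ z) =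
          (xi K B N).lTensor K ((counit (R := K)).rTensor _ z) := fun z => by
        simp only [LinearMap.rTensor, LinearMap.lTensor, map_map]; rfl
      have ha' : (xi K B N).lTensor _ (comul a) = 0 := ha
      have h3 := e (comul a)
      rw [ha', rTensor_counit_comul, map_zero, LinearMap.lTensor_tmul] at h3
      simpa using congrArg (TensorProduct.lid K _) h3.symm
    refine ⟨(pr K B N k).lTensor N (kap K B N a), ⟨?_, ?_⟩, rfl⟩
    · rw [xi_eq_zero_iff] at h2
      have h3 : TensorProduct.assoc K N B _ ((HopfBimodule.coactR (H := B)).rTensor _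
        (kap K B N a)) = (lam K B N).lTensor N (kap K B N a) := h2
      have e1 : ∀ z, TensorProduct.assoc K N B _ ((HopfBimodule.coactR (K := K) (H := B)).rTensor _
          ((pr K B N k).lTensor N z)) = ((pr K B N k).lTensor B).lTensor N
          (TensorProduct.assoc K N B _ ((HopfBimodule.coactR (H := B)).rTensor _ z)) := by
        intro z
        induction z with
        | zero => simp only [zero_tmul, tmul_zero, LinearEquiv.map_zero, LinearMap.map_zero, add_zero]
        | tmul x y =>
          simp only [LinearMap.lTensor_tmul, LinearMap.rTensor_tmul]
          generalize HopfBimodule.coactR (K := K) (H := B) x = z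
          induction z with
          | zero => simp only [zero_tmul, tmul_zero, LinearEquiv.map_zero, LinearMap.map_zero, add_zero]
          | tmul => simp
          | add p q hp hq => simp only [add_tmul, LinearMap.map_add, LinearEquiv.map_add, hp, hq]
        | add p q hp hq => simp only [LinearMap.map_add, LinearEquiv.map_add, hp, hq]
      have e2 : lam K B N ∘ₗ pr K B N k = (pr K B N k).lTensor B ∘ₗ lam K B N :=
        LinearMap.ext (lam_pr k)
      change TensorProduct.assoc K N B _ ((HopfBimodule.coactR (H := B)).rTensor _
        ((pr K B N k).lTensor N (kap K B N a))) =
        (lam K B N).lTensor N ((pr K B N k).lTensor N (kap K B N a))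
      rw [e1, h3, ← LinearMap.lTensor_comp_apply, ← LinearMap.lTensor_comp_apply, e2]
    · obtain ⟨w, hw⟩ := h1
      rw [← hw, ← LinearMap.lTensor_comp_apply]
      exact range_lTensor_mono _ _ (fun y => ih y.1 y.2) w

theorem kap_lam (a : CotAmb K B N) : (kap K B N).lTensor B (lam K B N a) =
    TensorProduct.assoc K B N _ ((HopfBimodule.coactL (H := B)).rTensor _ (kap K B N a)) := by
  refine LinearMap.congr_fun (f := (kap K B N).lTensor B ∘ₗ lam K B N)
    (g := (TensorProduct.assoc K B N _).toLinearMap ∘ₗ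
      (HopfBimodule.coactL (H := B)).rTensor _ ∘ₗ kap K B N) ?_ a
  have e1 : kap K B N ∘ₗ in0 K B N = 0 := by ext; simp
  refine hom_ext (fun b => ?_) (fun n a ih => ?_)
  · simp only [LinearMap.comp_apply, kap_in0, lam_in0, ← LinearMap.lTensor_comp_apply, e1]
    simp
  · simp only [LinearMap.comp_apply, kap_sh, lam_sh, LinearMap.rTensor_tmul, LinearEquiv.coe_coe]
    generalize HopfBimodule.coactL (K := K) (H := B) n = z
    induction z with
    | zero => simp only [zero_tmul, tmul_zero, LinearEquiv.map_zero, LinearMap.map_zero, add_zero]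
    | tmul => simp
    | add p q hp hq => simp only [add_tmul, LinearMap.map_add, LinearEquiv.map_add, hp, hq]

theorem xi_lam (a : CotAmb K B N) (ha : xi K B N a = 0) : (xi K B N).lTensor B (lam K B N a) = 0 := by
  have e : ∀ z : N ⊗[K] CotAmb K B N, ((TensorProduct.assoc K N B (CotAmb K B N)).toLinearMap ∘ₗ
    (HopfBimodule.coactR (H := B)).rTensor (CotAmb K B N) - (lam K B N).lTensor N).lTensor B
    (TensorProduct.assoc K B N _ ((HopfBimodule.coactL (H := B)).rTensor _ z)) =
    TensorProduct.assoc K B N _ ((HopfBimodule.coactL (H := B)).rTensor _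
      (((TensorProduct.assoc K N B (CotAmb K B N)).toLinearMap ∘ₗ
    (HopfBimodule.coactR (H := B)).rTensor (CotAmb K B N) - (lam K B N).lTensor N) z)) := by
    intro z
    rw [LinearMap.lTensor_sub, LinearMap.sub_apply, LinearMap.sub_apply, map_sub, map_sub]
    congr 1
    · induction z with
      | zero => simp only [zero_tmul, tmul_zero, LinearEquiv.map_zero, LinearMap.map_zero, add_zero]
      | tmul n y =>
        have f1 : ∀ t : B ⊗[K] N, ((TensorProduct.assoc K N B (CotAmb K B N)).toLinearMap ∘ₗ
          (HopfBimodule.coactR (H := B)).rTensor (CotAmb K B N)).lTensor B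
          (TensorProduct.assoc K B N _ (t ⊗ₜ y)) = ((TensorProduct.assoc K N B _).toLinearMap).lTensor B
          (TensorProduct.assoc K B (N ⊗[K] B) _ ((HopfBimodule.coactR.lTensor B t) ⊗ₜ y)) := by
          intro t
          induction t with
          | zero => simp only [zero_tmul, tmul_zero, LinearEquiv.map_zero, LinearMap.map_zero, add_zero]
          | tmul => simp
          | add p q hp hq => simp only [add_tmul, LinearMap.map_add, LinearEquiv.map_add, hp, hq]
        have f2 : ∀ t : N ⊗[K] B, TensorProduct.assoc K B N _
           ((HopfBimodule.coactL (H := B)).rTensor _ (TensorProduct.assoc K N B _ (t ⊗ₜ[K] y))) =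
           ((TensorProduct.assoc K N B _).toLinearMap).lTensor B
          (TensorProduct.assoc K B (N ⊗[K] B) _ ((TensorProduct.assoc K B N B
            (HopfBimodule.coactL.rTensor B t)) ⊗ₜ y)) := by
          intro t
          induction t with
          | zero => simp only [zero_tmul, tmul_zero, LinearEquiv.map_zero, LinearMap.map_zero, add_zero]
          | tmul p q =>
            simp only [TensorProduct.assoc_tmul, LinearMap.rTensor_tmul]
            generalize HopfBimodule.coactL (K := K) (H := B) p = z
            induction z with
            | zero => simp only [zero_tmul, tmul_zero, LinearEquiv.map_zero, LinearMap.map_zero, add_zero]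
            | tmul => simp
            | add p q hp hq => simp only [add_tmul, LinearMap.map_add, LinearEquiv.map_add, hp, hq]
          | add p q hp hq => simp only [add_tmul, LinearMap.map_add, LinearEquiv.map_add, hp, hq]
        simp only [LinearMap.rTensor_tmul, LinearMap.comp_apply, LinearEquiv.coe_coe]
        rw [f1, f2, HopfBimodule.coact_comm]
      | add p q hp hq => simp only [LinearMap.map_add, LinearEquiv.map_add, hp, hq]
    · induction z with
      | zero => simp only [zero_tmul, tmul_zero, LinearEquiv.map_zero, LinearMap.map_zero, add_zero]
      | tmul n y =>
        simp only [LinearMap.lTensor_tmul, LinearMap.rTensor_tmul]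
        generalize HopfBimodule.coactL (K := K) (H := B) n = z
        induction z with
        | zero => simp only [zero_tmul, tmul_zero, LinearEquiv.map_zero, LinearMap.map_zero, add_zero]
        | tmul => simp
        | add p q hp hq => simp only [add_tmul, LinearMap.map_add, LinearEquiv.map_add, hp, hq]
      | add p q hp hq => simp only [LinearMap.map_add, LinearEquiv.map_add, hp, hq]
  rw [xi, LinearMap.lTensor_comp_apply, kap_lam, e]
  have ha' : ((TensorProduct.assoc K N B (CotAmb K B N)).toLinearMap ∘ₗ
    (HopfBimodule.coactR (H := B)).rTensor (CotAmb K B N) - (lam K B N).lTensor N) (kap K B N a) = 0 := ha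
  rw [ha']
  simp

theorem cotPow_le_ker_omega (k : ℕ) : cotPow K B N k ≤ LinearMap.ker (omega K B N) := by
  have e1 : ∀ t : B ⊗[K] CotAmb K B N, (xi K B N).lTensor _ ((in0 K B N).rTensor _ t) =
      (in0 K B N).rTensor _ ((xi K B N).lTensor _ t) := fun t => by
    simp only [LinearMap.rTensor, LinearMap.lTensor, map_map]; rfl
  induction k with
  | zero =>
    rintro _ ⟨b, rfl⟩
    have h : xi K B N (in0 K B N b) = 0 := by simp [xi]
    change (xi K B N).lTensor _ (del K B N (in0 K B N b)) = 0
    rw [del_eq, map_add, e1, xi_lam _ h]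
    simp
  | succ k ih =>
    rintro _ ⟨y, ⟨h1, w, rfl⟩, rfl⟩
    have h : xi K B N (shL K B N ((cotPow K B N k).subtype.lTensor N w)) = 0 := by
      rw [xi_eq_zero_iff, kap_shL]; exact h1
    change (xi K B N).lTensor _ (del K B N _) = 0
    rw [del_eq, map_add, e1, xi_lam _ h, kap_shL]
    have e2 : ∀ w : N ⊗[K] cotPow K B N k, (xi K B N).lTensor _ ((shL K B N).rTensor _
      ((TensorProduct.assoc K N _ _).symm ((del K B N).lTensor N
        ((cotPow K B N k).subtype.lTensor N w)))) = 0 := by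
      intro w
      induction w with
      | zero => simp only [zero_tmul, tmul_zero, LinearEquiv.map_zero, LinearMap.map_zero, add_zero]
      | tmul n x =>
        have hx : (xi K B N).lTensor _ (del K B N x) = 0 := ih x.2
        have f : ∀ z, (xi K B N).lTensor _ ((shL K B N).rTensor _
          ((TensorProduct.assoc K N _ _).symm (n ⊗ₜ[K] z))) =
            (sh K B N n).rTensor _ ((xi K B N).lTensor _ z) := by
          intro z
          induction z with
          | zero => simp only [zero_tmul, tmul_zero, LinearEquiv.map_zero, LinearMap.map_zero, add_zero]
          | tmul => simp
          | add p q hp hq => simp only [tmul_add, LinearMap.map_add, LinearEquiv.map_add, hp, hq]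
        simp only [LinearMap.lTensor_tmul, Submodule.subtype_apply]
        rw [f, hx, map_zero]
      | add p q hp hq => simp only [LinearMap.map_add, LinearEquiv.map_add, hp, hq, add_zero]
    rw [e2]
    simp

variable (K B N) in
/-- The sum `⨁ₙ N^{□ n}` of the cotensor powers. -/
def cotSub : Submodule K (CotAmb K B N) := ⨆ n, cotPow K B N n

theorem cotSub_eq_ker : cotSub K B N = LinearMap.ker (omega K B N) := by
  refine le_antisymm (iSup_le cotPow_le_ker_omega) fun a ha => ?_
  obtain ⟨k, hk⟩ := trunc_eventually a
  rw [← hk k le_rfl, ← sum_pr]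
  exact Submodule.sum_mem _ fun i _ =>
    Submodule.mem_iSup_of_mem i (pr_mem_of_omega i a ha)

theorem xi_of_mem {a : CotAmb K B N} (ha : a ∈ cotSub K B N) : xi K B N a = 0 := by
  rw [cotSub_eq_ker] at ha
  have e : ∀ z : CotAmb K B N ⊗[K] CotAmb K B N, (counit (R := K)).rTensor _ ((xi K B N).lTensor _ z) =
      (xi K B N).lTensor K ((counit (R := K)).rTensor _ z) := fun z => by
    simp only [LinearMap.rTensor, LinearMap.lTensor, map_map]; rfl
  have ha' : (xi K B N).lTensor _ (comul a) = 0 := ha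
  have h3 := e (comul a)
  rw [ha', rTensor_counit_comul, map_zero, LinearMap.lTensor_tmul] at h3
  simpa using congrArg (TensorProduct.lid K _) h3.symm

theorem xi_comul (a : CotAmb K B N) (ha : xi K B N a = 0) :
    (xi K B N).rTensor (CotAmb K B N) (comul a) = 0 := by
  -- `ξ` is right colinear
  have e : ∀ z : N ⊗[K] CotAmb K B N,
    TensorProduct.assoc K N _ _ (((TensorProduct.assoc K N B (CotAmb K B N)).toLinearMap ∘ₗ
    (HopfBimodule.coactR (H := B)).rTensor (CotAmb K B N) - (lam K B N).lTensor N).rTensor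
    (CotAmb K B N) ((TensorProduct.assoc K N _ _).symm (comul.lTensor N z))) =
    ((TensorProduct.assoc K B _ _).symm.toLinearMap.lTensor N) ((comul.lTensor B).lTensor N (((TensorProduct.assoc K N B (CotAmb K B N)).toLinearMap ∘ₗ
    (HopfBimodule.coactR (H := B)).rTensor (CotAmb K B N) - (lam K B N).lTensor N) z)) := by
    intro z
    rw [LinearMap.rTensor_sub, LinearMap.sub_apply, LinearMap.sub_apply, map_sub, map_sub, map_sub]
    congr 1
    · induction z with
      | zero => simp only [zero_tmul, tmul_zero, LinearEquiv.map_zero, LinearMap.map_zero, add_zero]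
      | tmul n y =>
        simp only [LinearMap.lTensor_tmul, LinearMap.rTensor_tmul, LinearMap.comp_apply,
          LinearEquiv.coe_coe]
        have f1 : ∀ t : CotAmb K B N ⊗[K] CotAmb K B N, ∀ s : N ⊗[K] B,
          TensorProduct.assoc K N _ _ ((TensorProduct.assoc K N B (CotAmb K B N)).toLinearMap.rTensor
            (CotAmb K B N) ((TensorProduct.assoc K (N ⊗[K] B) _ _).symm (s ⊗ₜ t))) =
          (TensorProduct.assoc K B _ _).symm.toLinearMap.lTensor N
            (TensorProduct.assoc K N B _ (s ⊗ₜ t)) := by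
          intro t s
          induction s with
          | zero => simp only [zero_tmul, tmul_zero, LinearEquiv.map_zero, LinearMap.map_zero, add_zero]
          | tmul =>
            induction t with
            | zero => simp only [zero_tmul, tmul_zero, LinearEquiv.map_zero, LinearMap.map_zero, add_zero]
            | tmul => simp
            | add p q hp hq => simp only [tmul_add, LinearMap.map_add, LinearEquiv.map_add, hp, hq]
          | add p q hp hq => simp only [add_tmul, LinearMap.map_add, LinearEquiv.map_add, hp, hq]
        have f2 : ∀ t : CotAmb K B N ⊗[K] CotAmb K B N,
          ((TensorProduct.assoc K N B (CotAmb K B N)).toLinearMap ∘ₗ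
            (HopfBimodule.coactR (H := B)).rTensor (CotAmb K B N)).rTensor (CotAmb K B N)
              ((TensorProduct.assoc K N _ _).symm (n ⊗ₜ t)) =
          (TensorProduct.assoc K N B (CotAmb K B N)).toLinearMap.rTensor
            (CotAmb K B N) ((TensorProduct.assoc K (N ⊗[K] B) _ _).symm
              (HopfBimodule.coactR n ⊗ₜ t)) := by
          intro t
          induction t with
          | zero => simp only [zero_tmul, tmul_zero, LinearEquiv.map_zero, LinearMap.map_zero, add_zero]
          | tmul => simp
          | add p q hp hq => simp only [tmul_add, LinearMap.map_add, LinearEquiv.map_add, hp, hq]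
        have f3 : ∀ s : N ⊗[K] B, (comul.lTensor B).lTensor N
            (TensorProduct.assoc K N B _ (s ⊗ₜ[K] y)) =
            TensorProduct.assoc K N B _ (s ⊗ₜ[K] comul y) := by
          intro s
          induction s with
          | zero => simp only [zero_tmul, tmul_zero, LinearEquiv.map_zero, LinearMap.map_zero, add_zero]
          | tmul => simp
          | add p q hp hq => simp only [add_tmul, LinearMap.map_add, LinearEquiv.map_add, hp, hq]
        rw [f2, f1, f3]
      | add p q hp hq => simp only [LinearMap.map_add, LinearEquiv.map_add, hp, hq]
    · induction z with
      | zero => simp only [zero_tmul, tmul_zero, LinearEquiv.map_zero, LinearMap.map_zero, add_zero]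
      | tmul n y =>
        simp only [LinearMap.lTensor_tmul, comul_eq]
        rw [← lam_del]
        generalize del K B N y = t
        induction t with
        | zero => simp only [tmul_zero, LinearEquiv.map_zero, LinearMap.map_zero]
        | tmul => simp
        | add p q hp hq => simp only [tmul_add, LinearMap.map_add, LinearEquiv.map_add, hp, hq]
      | add p q hp hq => simp only [LinearMap.map_add, LinearEquiv.map_add, hp, hq]
  have e3 : (kap K B N).rTensor (CotAmb K B N) (comul a) =
      (TensorProduct.assoc K N _ _).symm (comul.lTensor N (kap K B N a)) := by
    have : kap K B N = (p1 K B N).rTensor _ ∘ₗ comul := LinearMap.ext fun a => (p1_del a).symm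
    rw [this, LinearMap.rTensor_comp_apply, ← coassoc_symm_apply, LinearMap.comp_apply]
    have f : ∀ z : CotAmb K B N ⊗[K] CotAmb K B N, comul.lTensor N ((p1 K B N).rTensor _ z) =
      (p1 K B N).rTensor _ (comul.lTensor _ z) := fun z => by
      simp only [LinearMap.rTensor, LinearMap.lTensor, map_map]; rfl
    rw [f]
    generalize comul.lTensor _ (comul (R := K) a) = t
    refine LinearMap.congr_fun (f := ((p1 K B N).rTensor _).rTensor _ ∘ₗ
      (TensorProduct.assoc K _ _ _).symm.toLinearMap) (g := (TensorProduct.assoc K _ _ _).symm.toLinearMap ∘ₗ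
      (p1 K B N).rTensor (CotAmb K B N ⊗[K] CotAmb K B N)) (TensorProduct.ext_threefold' fun x y z => ?_) t
    simp
  have ha' : ((TensorProduct.assoc K N B (CotAmb K B N)).toLinearMap ∘ₗ
    (HopfBimodule.coactR (H := B)).rTensor (CotAmb K B N) - (lam K B N).lTensor N) (kap K B N a) = 0 := ha
  apply (TensorProduct.assoc K N _ _).injective
  rw [xi, LinearMap.rTensor_comp_apply, e3, e, ha']
  simp

theorem comul_mem {a : CotAmb K B N} (ha : a ∈ cotSub K B N) :
    comul a ∈ LinearMap.range (map (cotSub K B N).subtype (cotSub K B N).subtype) := by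
  have ha' : (xi K B N).lTensor _ (comul a) = 0 := by rw [cotSub_eq_ker] at ha; exact ha
  refine mem_range_map_subtype _ _ (omega K B N) (omega K B N) cotSub_eq_ker.symm
    cotSub_eq_ker.symm _ ?_ ?_
  · have e : ∀ z : CotAmb K B N ⊗[K] CotAmb K B N,
      TensorProduct.assoc K _ _ _ ((omega K B N).rTensor (CotAmb K B N) z) =
      ((xi K B N).rTensor (CotAmb K B N)).lTensor _
        (TensorProduct.assoc K _ _ _ (comul.rTensor (CotAmb K B N) z)) := by
      intro z
      induction z with
      | zero => simp only [zero_tmul, tmul_zero, LinearEquiv.map_zero, LinearMap.map_zero, add_zero]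
      | tmul x y =>
        simp only [LinearMap.rTensor_tmul, omega, LinearMap.comp_apply]
        generalize comul (R := K) x = t
        induction t with
        | zero => simp only [zero_tmul, tmul_zero, LinearEquiv.map_zero, LinearMap.map_zero, add_zero]
        | tmul => simp
        | add p q hp hq => simp only [add_tmul, LinearMap.map_add, LinearEquiv.map_add, hp, hq]
      | add p q hp hq => simp only [LinearMap.map_add, LinearEquiv.map_add, hp, hq]
    apply (TensorProduct.assoc K _ _ _).injective
    rw [e, coassoc_apply, map_zero]
    obtain ⟨w, hw⟩ := (Module.Flat.lTensor_exact _ (xi K B N).exact_subtype_ker_map _).mp ha'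
    rw [← hw]
    clear hw
    induction w with
    | zero => simp only [zero_tmul, tmul_zero, LinearEquiv.map_zero, LinearMap.map_zero, add_zero]
    | tmul x y => simp [xi_comul y.1 y.2]
    | add p q hp hq => simp only [LinearMap.map_add, LinearEquiv.map_add, hp, hq, add_zero]
  · have e : ∀ z : CotAmb K B N ⊗[K] CotAmb K B N,
      ((omega K B N).lTensor (CotAmb K B N) z) =
      ((xi K B N).lTensor (CotAmb K B N)).lTensor _ (comul.lTensor (CotAmb K B N) z) := fun z => by
        rw [← LinearMap.lTensor_comp_apply]; rfl
    have e2 : ∀ z : (CotAmb K B N ⊗[K] CotAmb K B N) ⊗[K] CotAmb K B N,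
        ((xi K B N).lTensor _).lTensor _ (TensorProduct.assoc K _ _ _ z) =
        TensorProduct.assoc K _ _ _ ((xi K B N).lTensor _ z) := fun z => by
      refine LinearMap.congr_fun (f := ((xi K B N).lTensor _).lTensor _ ∘ₗ
        (TensorProduct.assoc K _ _ _).toLinearMap) (g := (TensorProduct.assoc K _ _ _).toLinearMap
        ∘ₗ (xi K B N).lTensor _) (TensorProduct.ext_threefold fun x y z => ?_) z
      simp
    have e3 : ∀ z : CotAmb K B N ⊗[K] CotAmb K B N, (xi K B N).lTensor _ (comul.rTensor _ z) =
        (comul (R := K) (A := CotAmb K B N)).rTensor _ ((xi K B N).lTensor _ z) := fun z => by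
      simp only [LinearMap.rTensor, LinearMap.lTensor, map_map]; rfl
    rw [e, ← coassoc_apply, e2, e3, ha']
    simp

end Coalg
end CotAmb
end

/- ### The sum of the cotensor powers is a subalgebra -/

section
namespace CotAmb
section Coalg
variable {K B N : Type*} [Field K] [Ring B] [HopfAlgebra K B] [AddCommGroup N] [Module K N]
  [Module B N] [Module Bᵐᵒᵖ N] [SMulCommClass B Bᵐᵒᵖ N] [IsScalarTower K B N]
  [IsScalarTower K Bᵐᵒᵖ N] [HopfBimodule K B N]

theorem coactR_p1 {a : CotAmb K B N} (ha : xi K B N a = 0) :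
    HopfBimodule.coactR (H := B) (p1 K B N a) = map (p1 K B N) (p0 K B N) (comul a) := by
  have h1 : TensorProduct.assoc K N B _ ((HopfBimodule.coactR (H := B)).rTensor _ (kap K B N a)) =
      (lam K B N).lTensor N (kap K B N a) := (xi_eq_zero_iff a).mp ha
  have e1 : ∀ z : N ⊗[K] CotAmb K B N, ((counit (R := K)).lTensor B).lTensor N
      (TensorProduct.assoc K N B _ ((HopfBimodule.coactR (H := B)).rTensor _ z)) =
      TensorProduct.assoc K N B K ((HopfBimodule.coactR (H := B)).rTensor _
        ((counit (R := K)).lTensor N z)) := by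
    intro z
    induction z with
    | zero => simp only [zero_tmul, tmul_zero, LinearEquiv.map_zero, LinearMap.map_zero, add_zero]
    | tmul n y =>
      simp only [LinearMap.lTensor_tmul, LinearMap.rTensor_tmul]
      generalize HopfBimodule.coactR (K := K) (H := B) n = s
      induction s with
      | zero => simp only [zero_tmul, LinearEquiv.map_zero, LinearMap.map_zero]
      | tmul => simp only [TensorProduct.assoc_tmul, LinearMap.lTensor_tmul]
      | add p q hp hq => simp only [add_tmul, LinearMap.map_add, LinearEquiv.map_add, hp, hq]
    | add p q hp hq => simp only [LinearMap.map_add, LinearEquiv.map_add, hp, hq]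
  have e2 : (counit (R := K)).lTensor N (kap K B N a) = p1 K B N a ⊗ₜ 1 := by
    have f : ∀ z : CotAmb K B N ⊗[K] CotAmb K B N,
        (counit (R := K)).lTensor N ((p1 K B N).rTensor _ z) =
        (p1 K B N).rTensor K ((counit (R := K)).lTensor _ z) := fun z => by
      simp only [LinearMap.rTensor, LinearMap.lTensor, map_map]; rfl
    rw [← p1_del, f, lTensor_counit_comul, LinearMap.rTensor_tmul]
  have e3 : ∀ y : CotAmb K B N, (counit (R := K)).lTensor B (lam K B N y) = p0 K B N y ⊗ₜ 1 := by
    intro y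
    have f : ∀ z : CotAmb K B N ⊗[K] CotAmb K B N,
        (counit (R := K)).lTensor B ((p0 K B N).rTensor _ z) =
        (p0 K B N).rTensor K ((counit (R := K)).lTensor _ z) := fun z => by
      simp only [LinearMap.rTensor, LinearMap.lTensor, map_map]; rfl
    rw [← p0_del, f, ← comul_eq, lTensor_counit_comul, LinearMap.rTensor_tmul]
  have e4 : ∀ z : CotAmb K B N ⊗[K] CotAmb K B N, ((counit (R := K)).lTensor B).lTensor N
      ((lam K B N).lTensor N ((p1 K B N).rTensor _ z)) =
      TensorProduct.assoc K N B K (map (p1 K B N) (p0 K B N) z ⊗ₜ 1) := by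
    intro z
    induction z with
    | zero => simp only [map_zero, zero_tmul]
    | tmul x y =>
      simp only [LinearMap.lTensor_tmul, LinearMap.rTensor_tmul, e3, map_tmul,
        TensorProduct.assoc_tmul]
    | add p q hp hq => simp only [LinearMap.map_add, LinearEquiv.map_add, hp, hq, add_tmul]
  have h2 := congrArg (((counit (R := K)).lTensor B).lTensor N) h1
  rw [e1, e2, LinearMap.rTensor_tmul, ← p1_del, e4] at h2
  simpa using congrArg (TensorProduct.rid K _) ((TensorProduct.assoc K N B K).injective h2)

theorem mulF1_coactR (a c : CotAmb K B N)
    (ha : HopfBimodule.coactR (H := B) (p1 K B N a) = map (p1 K B N) (p0 K B N) (comul a))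
    (hc : HopfBimodule.coactR (H := B) (p1 K B N c) = map (p1 K B N) (p0 K B N) (comul c)) :
    map (mulF1 K B N) (mulF0 K B N) (comul (a ⊗ₜ[K] c)) =
      HopfBimodule.coactR (mulF1 K B N (a ⊗ₜ c)) := by
  have e : mulF1 K B N (a ⊗ₜ c) = p0 K B N a • p1 K B N c +
    MulOpposite.op (p0 K B N c) • p1 K B N a := by simp [mulF1]
  rw [e, map_add, HopfBimodule.coactR_smul, HopfBimodule.coactR_op_smul, ← p0_comul, ← p0_comul,
    ha, hc, comul_tmul]
  generalize comul (R := K) a = x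
  generalize comul (R := K) c = y
  induction x with
  | zero => simp only [zero_tmul, LinearEquiv.map_zero, LinearMap.map_zero, add_zero]
  | tmul x1 x2 =>
    induction y with
    | zero => simp only [tmul_zero, LinearEquiv.map_zero, LinearMap.map_zero, add_zero]
    | tmul y1 y2 => simp [mulF0, mulF1, add_tmul]
    | add p q hp hq => simp only [tmul_add, LinearMap.map_add, LinearEquiv.map_add, hp, hq]; abel
  | add p q hp hq => simp only [add_tmul, LinearMap.map_add, LinearEquiv.map_add, hp, hq]; abel

theorem xi_mul {a c : CotAmb K B N} (ha : a ∈ cotSub K B N) (hc : c ∈ cotSub K B N) :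
    xi K B N (a * c) = 0 := by
  rw [xi_eq_zero_iff]
  change TensorProduct.assoc K N B _ ((HopfBimodule.coactR (H := B)).rTensor _
    (kap K B N (mulL K B N (a ⊗ₜ c)))) = (lam K B N).lTensor N (kap K B N (mulL K B N (a ⊗ₜ c)))
  rw [univ_kap (mulF0 K B N) (mulF1 K B N) (mulL K B N) mulL_spec]
  have e1 : ∀ t, (lam K B N).lTensor N ((mulL K B N).lTensor N ((mulF1 K B N).rTensor _ t)) =
      map (mulF1 K B N) (map (mulF0 K B N) (mulL K B N)) (comul.lTensor _ t) := by
    intro t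
    have : lam K B N ∘ₗ mulL K B N = map (mulF0 K B N) (mulL K B N) ∘ₗ comul :=
      LinearMap.ext fun c => univ_lam (mulF0 K B N) (mulF1 K B N) (mulL K B N) mulF0_comul
        mulF1_coact mulL_spec c
    rw [← LinearMap.lTensor_comp_apply, this]
    simp only [LinearMap.rTensor, LinearMap.lTensor, map_map]; rfl
  have e2 : ∀ t : ((CotAmb K B N ⊗[K] CotAmb K B N) ⊗[K] (CotAmb K B N ⊗[K] CotAmb K B N)) ⊗[K]
      (CotAmb K B N ⊗[K] CotAmb K B N),
      map (mulF1 K B N) (map (mulF0 K B N) (mulL K B N)) (TensorProduct.assoc K _ _ _ t) =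
      TensorProduct.assoc K _ _ _ (map (map (mulF1 K B N) (mulF0 K B N)) (mulL K B N) t) := by
    intro t
    refine LinearMap.congr_fun (f := map (mulF1 K B N) (map (mulF0 K B N) (mulL K B N)) ∘ₗ
      (TensorProduct.assoc K _ _ _).toLinearMap) (g := (TensorProduct.assoc K _ _ _).toLinearMap ∘ₗ
      map (map (mulF1 K B N) (mulF0 K B N)) (mulL K B N))
      (TensorProduct.ext_threefold fun x y z => ?_) t
    rfl
  rw [e1, ← coassoc_apply, e2]
  congr 1
  obtain ⟨u, hu⟩ := comul_mem ha
  obtain ⟨v, hv⟩ := comul_mem hc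
  have e3 : ∀ u v, (HopfBimodule.coactR (H := B)).rTensor _ ((mulL K B N).lTensor N
      ((mulF1 K B N).rTensor _ (tensorTensorTensorComm K _ _ _ _
        (map (cotSub K B N).subtype (cotSub K B N).subtype u ⊗ₜ[K]
         map (cotSub K B N).subtype (cotSub K B N).subtype v)))) =
      map (map (mulF1 K B N) (mulF0 K B N)) (mulL K B N) (comul.rTensor _
       (tensorTensorTensorComm K _ _ _ _
        (map (cotSub K B N).subtype (cotSub K B N).subtype u ⊗ₜ[K]
         map (cotSub K B N).subtype (cotSub K B N).subtype v))) := by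
    intro u v
    induction u with
    | zero => simp only [map_zero, zero_tmul]
    | tmul u1 u2 =>
      induction v with
      | zero => simp only [map_zero, tmul_zero]
      | tmul v1 v2 =>
        simp only [map_tmul, tensorTensorTensorComm_tmul, LinearMap.rTensor_tmul,
          LinearMap.lTensor_tmul, Submodule.subtype_apply]
        rw [mulF1_coactR _ _ (coactR_p1 (xi_of_mem u1.2)) (coactR_p1 (xi_of_mem v1.2))]
      | add p q hp hq => simp only [tmul_add, LinearMap.map_add, LinearEquiv.map_add, hp, hq]
    | add p q hp hq => simp only [add_tmul, LinearMap.map_add, LinearEquiv.map_add, hp, hq]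
  rw [comul_tmul, ← hu, ← hv]
  exact e3 u v

theorem mul_mem_cotSub {a c : CotAmb K B N} (ha : a ∈ cotSub K B N) (hc : c ∈ cotSub K B N) :
    a * c ∈ cotSub K B N := by
  obtain ⟨u, hu⟩ := comul_mem ha
  obtain ⟨v, hv⟩ := comul_mem hc
  rw [cotSub_eq_ker]
  change (xi K B N).lTensor _ (comul (a * c)) = 0
  rw [comul_mul', ← hu, ← hv]
  clear hu hv
  induction u with
  | zero => simp only [map_zero, zero_mul]
  | tmul u1 u2 =>
    induction v with
    | zero => simp only [map_zero, mul_zero]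
    | tmul v1 v2 =>
      rw [map_tmul, map_tmul, Algebra.TensorProduct.tmul_mul_tmul, LinearMap.lTensor_tmul]
      simp only [Submodule.subtype_apply]
      rw [xi_mul u2.2 v2.2, tmul_zero]
    | add p q hp hq => rw [map_add, mul_add, map_add, hp, hq, add_zero]
  | add p q hp hq => rw [map_add, add_mul, map_add, hp, hq, add_zero]

theorem in0_mem (b : B) : in0 K B N b ∈ cotSub K B N :=
  Submodule.mem_iSup_of_mem 0 ⟨b, rfl⟩

variable (K B N) in
/-- The sum of the cotensor powers as a subalgebra. -/
def cotSubalgebra : Subalgebra K (CotAmb K B N) :=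
  (cotSub K B N).toSubalgebra (in0_mem 1) fun _ _ => mul_mem_cotSub

end Coalg
end CotAmb
end

/- ### The cotensor bialgebra -/

section
variable (K B N : Type*) [Field K] [Ring B] [HopfAlgebra K B] [AddCommGroup N] [Module K N]
  [Module B N] [Module Bᵐᵒᵖ N] [SMulCommClass B Bᵐᵒᵖ N] [IsScalarTower K B N]
  [IsScalarTower K Bᵐᵒᵖ N] [HopfBimodule K B N]

/-- The cotensor Hopf algebra `Cot_B(N) = B ⊕ N ⊕ (N □_B N) ⊕ ⋯` of a couple `(B, N)`. The
comultiplication is deconcatenation together with the coactions (see `CotAmb.del`), and the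
multiplication is the graded coalgebra map which is the multiplication of `B` in degree zero and
`b ⊗ n + n' ⊗ b' ↦ b.n + n'.b'` in degree one (see `Cot.inB_mul_inN`, `Cot.inN_mul_inB`). -/
def Cot : Type _ := CotAmb.cotSubalgebra K B N

namespace Cot

instance : Ring (Cot K B N) := inferInstanceAs (Ring (CotAmb.cotSubalgebra K B N))
instance : Algebra K (Cot K B N) := inferInstanceAs (Algebra K (CotAmb.cotSubalgebra K B N))

/-- The inclusion of the cotensor Hopf algebra in the ambient bialgebra. -/
def incl : Cot K B N →ₐ[K] CotAmb K B N := (CotAmb.cotSubalgebra K B N).val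

variable {K B N}
theorem incl_injective : Function.Injective (incl K B N) := Subtype.val_injective
theorem incl_mem (x : Cot K B N) : incl K B N x ∈ CotAmb.cotSub K B N := x.2

theorem map_inj {X Y V W : Type*} [AddCommGroup X] [Module K X]
    [AddCommGroup Y] [Module K Y] [AddCommGroup V] [Module K V] [AddCommGroup W] [Module K W]
    {f : X →ₗ[K] V} {g : Y →ₗ[K] W} (hf : Function.Injective f) (hg : Function.Injective g) :
    Function.Injective (map f g) := TensorProduct.map_injective_of_flat_flat f g hf hg

theorem map_incl_injective : Function.Injective (map (incl K B N).toLinearMap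
    (incl K B N).toLinearMap) := map_inj incl_injective incl_injective

theorem exists_comul (x : Cot K B N) :
    ∃ z, map (incl K B N).toLinearMap (incl K B N).toLinearMap z = comul (incl K B N x) :=
  CotAmb.comul_mem (incl_mem x)

variable (K B N) in
/-- The comultiplication, restricted from the ambient coalgebra. -/
def comulL : Cot K B N →ₗ[K] Cot K B N ⊗[K] Cot K B N :=
  (LinearEquiv.ofInjective _ map_incl_injective).symm.toLinearMap ∘ₗ
    (comul ∘ₗ (incl K B N).toLinearMap).codRestrict _ exists_comul

theorem map_comulL (x : Cot K B N) :
    map (incl K B N).toLinearMap (incl K B N).toLinearMap (comulL K B N x) =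
      comul (incl K B N x) := by
  have h := LinearEquiv.apply_symm_apply (LinearEquiv.ofInjective
    (map (incl K B N).toLinearMap (incl K B N).toLinearMap) map_incl_injective)
    ((comul ∘ₗ (incl K B N).toLinearMap).codRestrict _ exists_comul x)
  exact congrArg Subtype.val h

instance : Coalgebra K (Cot K B N) where
  comul := comulL K B N
  counit := counit ∘ₗ (incl K B N).toLinearMap
  coassoc := by
    ext x
    refine map_inj (f := (incl K B N).toLinearMap)
      (g := map (incl K B N).toLinearMap (incl K B N).toLinearMap) incl_injective
      map_incl_injective ?_
    set j := (incl K B N).toLinearMap with hj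
    have e1 : ∀ z, map j (map j j) (TensorProduct.assoc K _ _ _ ((comulL K B N).rTensor _ z)) =
        TensorProduct.assoc K _ _ _ (comul.rTensor _ (map j j z)) := by
      intro z
      induction z with
      | zero => simp only [zero_tmul, tmul_zero, LinearEquiv.map_zero, LinearMap.map_zero, add_zero]
      | tmul x y =>
        rw [map_tmul, LinearMap.rTensor_tmul, LinearMap.rTensor_tmul]
        rw [show j x = incl K B N x from rfl, ← map_comulL]
        generalize comulL K B N x = t
        induction t with
        | zero => simp only [zero_tmul, LinearMap.map_zero, LinearEquiv.map_zero]
        | tmul => rfl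
        | add p q hp hq => simp only [add_tmul, LinearMap.map_add, LinearEquiv.map_add, hp, hq]
      | add p q hp hq => simp only [LinearMap.map_add, LinearEquiv.map_add, hp, hq]
    have e2 : ∀ z, map j (map j j) ((comulL K B N).lTensor _ z) = comul.lTensor _ (map j j z) := by
      intro z
      induction z with
      | zero => simp only [zero_tmul, tmul_zero, LinearEquiv.map_zero, LinearMap.map_zero, add_zero]
      | tmul x y =>
        rw [map_tmul, LinearMap.lTensor_tmul, LinearMap.lTensor_tmul, map_tmul]
        rw [map_comulL]; rfl
      | add p q hp hq => simp only [LinearMap.map_add, LinearEquiv.map_add, hp, hq]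
    change map j (map j j) (TensorProduct.assoc K _ _ _ ((comulL K B N).rTensor _ (comulL K B N x)))
      = map j (map j j) ((comulL K B N).lTensor _ (comulL K B N x))
    rw [e1, e2, map_comulL, coassoc_apply]
  rTensor_counit_comp_comul := by
    ext x
    apply map_inj (f := LinearMap.id) (g := (incl K B N).toLinearMap) Function.injective_id
      incl_injective
    have e : ∀ z, map LinearMap.id (incl K B N).toLinearMap
      (LinearMap.rTensor _ (counit ∘ₗ (incl K B N).toLinearMap) z) =
      (counit (R := K)).rTensor _ (map (incl K B N).toLinearMap (incl K B N).toLinearMap z) := by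
      intro z
      simp only [LinearMap.rTensor, map_map]; rfl
    rw [LinearMap.comp_apply, e, map_comulL, rTensor_counit_comul]
    rfl
  lTensor_counit_comp_comul := by
    ext x
    apply map_inj (f := (incl K B N).toLinearMap) (g := LinearMap.id) incl_injective
      Function.injective_id
    have e : ∀ z, map (incl K B N).toLinearMap LinearMap.id
      (LinearMap.lTensor _ (counit ∘ₗ (incl K B N).toLinearMap) z) =
      (counit (R := K)).lTensor _ (map (incl K B N).toLinearMap (incl K B N).toLinearMap z) := by
      intro z
      simp only [LinearMap.lTensor, map_map]; rfl
    rw [LinearMap.comp_apply, e, map_comulL, lTensor_counit_comul]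
    rfl

theorem map_comul (x : Cot K B N) :
    map (incl K B N).toLinearMap (incl K B N).toLinearMap (comul x) =
      comul (incl K B N x) := map_comulL x
theorem counit_incl (x : Cot K B N) :
    counit (R := K) (incl K B N x) = counit (R := K) x := rfl

instance : Bialgebra K (Cot K B N) := Bialgebra.mk' K (Cot K B N)
  (by rw [← counit_incl, map_one, Bialgebra.counit_one])
  (fun {a b} => by rw [← counit_incl, map_mul, Bialgebra.counit_mul]; rfl)
  (by
    apply map_incl_injective
    rw [map_comul, map_one, Bialgebra.comul_one, Algebra.TensorProduct.one_def,
      Algebra.TensorProduct.one_def, map_tmul]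
    simp)
  (fun {a b} => by
    apply map_incl_injective
    have e : ∀ z w, map (incl K B N).toLinearMap (incl K B N).toLinearMap (z * w) =
       map (incl K B N).toLinearMap (incl K B N).toLinearMap z *
       map (incl K B N).toLinearMap (incl K B N).toLinearMap w :=
      map_mul (Algebra.TensorProduct.map (incl K B N) (incl K B N))
    rw [e, map_comul, map_comul, map_comul, map_mul, Bialgebra.comul_mul])

end Cot
end

/- ### A criterion for the existence of an antipode -/

section
theorem conv_aux {K C A X Y : Type*} [Field K] [AddCommGroup C] [Module K C]
    [AddCommGroup A] [Module K A] [AddCommGroup X] [Module K X] [AddCommGroup Y] [Module K Y]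
    (φ : C →ₗ[K] X) (n : C →ₗ[K] A) (hn : ∀ c, φ c = 0 → n c = 0) (z : C ⊗[K] Y)
    (hz : φ.rTensor Y z = 0) : n.rTensor Y z = 0 := by
  obtain ⟨w, rfl⟩ := (Module.Flat.rTensor_exact Y (φ.exact_subtype_ker_map) z).mp hz
  rw [← LinearMap.rTensor_comp_apply]
  have : n ∘ₗ (LinearMap.ker φ).subtype = 0 := LinearMap.ext fun x => hn _ x.2
  rw [this]
  simp

theorem isUnit_one_sub_conv {K C A : Type*} [Field K] [AddCommGroup C] [Module K C]
    [Coalgebra K C] [Ring A] [Algebra K A] {X : ℕ → Type*} [∀ k, AddCommGroup (X k)]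
    [∀ k, Module K (X k)] (φ : ∀ k, C →ₗ[K] X k)
    (mono : ∀ k c, φ k c = 0 → φ (k + 1) c = 0) (exh : ∀ c, ∃ k, φ k c = 0)
    (h0 : ∀ c, φ 0 c = 0 → (φ 0).rTensor C (comul c) = 0)
    (hS : ∀ k c, φ (k + 1) c = 0 → map (φ 0) (φ k) (comul c) = 0)
    (n : WithConv (C →ₗ[K] A)) (hn : ∀ c, φ 0 c = 0 → n c = 0) : IsUnit (1 - n) := by
  have key := fun g => exists_fixpoint (n.ofConv.rTensor C ∘ₗ comul)
    (fun k => LinearMap.ker (φ k)) (monotone_nat_of_le_succ fun k c hc => mono k c hc) exh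
    (fun c hc => conv_aux (φ 0) n.ofConv hn _ (h0 c hc))
    (fun k c hc => by
      refine (Module.Flat.lTensor_exact A (φ k).exact_subtype_ker_map _).mp ?_
      have e : ∀ z : C ⊗[K] C, (φ k).lTensor A (n.ofConv.rTensor C z) =
          n.ofConv.rTensor (X k) ((φ k).lTensor C z) := fun z => by
        simp only [LinearMap.rTensor, LinearMap.lTensor, map_map]; rfl
      rw [LinearMap.comp_apply, e]
      refine conv_aux (φ 0) n.ofConv hn _ ?_
      rw [← hS k c hc]
      simp only [LinearMap.rTensor, LinearMap.lTensor, map_map]; rfl)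
    (LinearMap.mul' K A) g
  have conv : ∀ F : WithConv (C →ₗ[K] A), ∀ c, (n * F) c =
      LinearMap.mul' K A (F.ofConv.lTensor A ((n.ofConv.rTensor C ∘ₗ comul) c)) := by
    intro F c
    rw [LinearMap.convMul_apply, LinearMap.comp_apply]
    congr 1
    simp only [LinearMap.rTensor, LinearMap.lTensor, map_map]; rfl
  have key' : ∀ g : WithConv (C →ₗ[K] A), ∃! F : WithConv (C →ₗ[K] A), F = g + n * F := by
    intro g
    obtain ⟨F, hF, hu⟩ := key g.ofConv
    refine ⟨WithConv.toConv F, ?_, fun F' hF' => ?_⟩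
    · ext c
      change F c = g c + (n * WithConv.toConv F) c
      rw [conv]
      exact hF c
    · have := hu F'.ofConv (fun c => by
        have h := congrArg (fun f : WithConv (C →ₗ[K] A) => f.ofConv c) hF'
        change F' c = g c + (n * F') c at h
        rw [conv] at h
        exact h)
      rw [← this]
  obtain ⟨z, hz, -⟩ := key' 1
  have hr : (1 - n) * z = 1 := by
    rw [sub_mul, one_mul]; nth_rewrite 1 [hz]; abel
  refine isUnit_iff_exists.mpr ⟨z, hr, ?_⟩
  obtain ⟨y, -, hy⟩ := key' (1 - n)
  have h1 := hy 1 (by simp)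
  have h2 := hy (z * (1 - n)) (by
    have : n * z = z - 1 := by nth_rewrite 2 [hz]; abel
    dsimp only
    rw [← mul_assoc, this, sub_mul, one_mul]; abel)
  exact h2.trans h1.symm

theorem exists_antipode {K A : Type*} [Field K] [Ring A] [Bialgebra K A]
    {X : ℕ → Type*} [∀ k, AddCommGroup (X k)]
    [∀ k, Module K (X k)] (φ : ∀ k, A →ₗ[K] X k)
    (mono : ∀ k c, φ k c = 0 → φ (k + 1) c = 0) (exh : ∀ c, ∃ k, φ k c = 0)
    (h0 : ∀ c, φ 0 c = 0 → (φ 0).rTensor A (comul c) = 0)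
    (hS : ∀ k c, φ (k + 1) c = 0 → map (φ 0) (φ k) (comul c) = 0)
    (g : A →ₗ[K] A)
    (hg1 : ∀ c, φ 0 c = 0 → LinearMap.mul' K A (g.lTensor A (comul c)) =
      algebraMap K A (counit c))
    (hg2 : ∀ c, φ 0 c = 0 → LinearMap.mul' K A (g.rTensor A (comul c)) =
      algebraMap K A (counit c)) :
    ∃ S : A →ₗ[K] A, WithConv.toConv S * WithConv.toConv LinearMap.id = 1 ∧
      WithConv.toConv LinearMap.id * WithConv.toConv S = 1 := by
  let i : WithConv (A →ₗ[K] A) := WithConv.toConv LinearMap.id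
  let g' : WithConv (A →ₗ[K] A) := WithConv.toConv g
  have u1 : IsUnit (i * g') := by
    have := isUnit_one_sub_conv φ mono exh h0 hS (1 - i * g') (fun c hc => by
      change algebraMap K A (counit c) - (i * g') c = 0
      rw [sub_eq_zero]
      exact (hg1 c hc).symm)
    rwa [sub_sub_cancel] at this
  have u2 : IsUnit (g' * i) := by
    have := isUnit_one_sub_conv φ mono exh h0 hS (1 - g' * i) (fun c hc => by
      change algebraMap K A (counit c) - (g' * i) c = 0
      rw [sub_eq_zero]
      exact (hg2 c hc).symm)
    rwa [sub_sub_cancel] at this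
  obtain ⟨a, ha, -⟩ := isUnit_iff_exists.mp u1
  obtain ⟨b, -, hb⟩ := isUnit_iff_exists.mp u2
  have h : b * g' = g' * a := left_inv_eq_right_inv (a := i) (by rw [mul_assoc, hb])
    (by rw [← mul_assoc, ha])
  refine ⟨(b * g').ofConv, ?_, ?_⟩
  · change (b * g') * i = 1
    rw [mul_assoc, hb]
  · change i * (b * g') = 1
    rw [h, ← mul_assoc, ha]
end

/- ### The cotensor Hopf algebra -/

section
section
variable {K B N : Type*} [Field K] [Ring B] [HopfAlgebra K B] [AddCommGroup N] [Module K N]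
  [Module B N] [Module Bᵐᵒᵖ N] [SMulCommClass B Bᵐᵒᵖ N] [IsScalarTower K B N]
  [IsScalarTower K Bᵐᵒᵖ N] [HopfBimodule K B N]

namespace CotAmb

theorem in0_mul (b c : B) : in0 K B N (b * c) = in0 K B N b * in0 K B N c := by
  have h := mulL_spec (in0 K B N b ⊗ₜ[K] in0 K B N c)
  rw [mulF1_comul, kap_in0, kap_in0] at h
  have h2 : mulF0 K B N (in0 K B N b ⊗ₜ[K] in0 K B N c) = b * c := by simp [mulF0]
  rw [h2] at h
  change _ = mulL K B N _
  rw [h]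
  simp only [tmul_zero, zero_tmul, LinearEquiv.map_zero, LinearMap.map_zero, add_zero]

theorem comul_lfil (k : ℕ) : ∀ a ∈ lfil K B N k,
    comul a ∈ LinearMap.range ((lfil K B N k).subtype.lTensor (CotAmb K B N)) := by
  have h1 : ∀ k, ∀ t : B ⊗[K] lfil K B N k, (in0 K B N).rTensor _
      ((lfil K B N k).subtype.lTensor B t) ∈
      LinearMap.range ((lfil K B N k).subtype.lTensor (CotAmb K B N)) := by
    intro k t
    refine ⟨(in0 K B N).rTensor _ t, ?_⟩
    simp only [LinearMap.rTensor, LinearMap.lTensor, map_map]; rfl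
  induction k with
  | zero =>
    intro a ha
    obtain ⟨t, ht⟩ := lam_lfil 0 a ha
    rw [comul_eq, del_eq, LinearMap.mem_ker.mp ha, ← ht]
    simp only [LinearEquiv.map_zero, LinearMap.map_zero, add_zero]
    exact h1 0 t
  | succ k ih =>
    intro a ha
    obtain ⟨t, ht⟩ := lam_lfil (k + 1) a ha
    obtain ⟨w, hw⟩ := ha
    rw [comul_eq, del_eq, ← ht, ← hw]
    refine add_mem (h1 _ t) ?_
    clear hw
    induction w with
    | zero => simp only [LinearEquiv.map_zero, LinearMap.map_zero, zero_mem]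
    | tmul n y =>
      obtain ⟨v, hv⟩ := ih y.1 y.2
      rw [LinearMap.lTensor_tmul, LinearMap.lTensor_tmul, ← comul_eq, Submodule.subtype_apply, ← hv]
      clear hv
      induction v with
      | zero => simp only [LinearEquiv.map_zero, LinearMap.map_zero, zero_mem, tmul_zero]
      | tmul p q =>
        exact ⟨sh K B N n p ⊗ₜ ⟨q.1, lfil_mono (Nat.le_succ k) q.2⟩, rfl⟩
      | add p q hp hq =>
        simp only [map_add, tmul_add] at hp hq ⊢
        exact add_mem hp hq
    | add p q hp hq => simp only [LinearMap.map_add, LinearEquiv.map_add]; exact add_mem hp hq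

theorem mkQ_in0 (b : B) (k : ℕ) : (lfil K B N k).mkQ (in0 K B N b) = 0 :=
  (Submodule.Quotient.mk_eq_zero _).mpr (in0_mem_lfil b k)

theorem comul_mkQ (k : ℕ) (a : CotAmb K B N) (ha : a ∈ lfil K B N (k + 1)) :
    map (lfil K B N 0).mkQ (lfil K B N k).mkQ (comul a) = 0 := by
  obtain ⟨w, hw⟩ := ha
  rw [comul_eq, del_eq, map_add, ← hw]
  have e1 : ∀ t, map (lfil K B N 0).mkQ (lfil K B N k).mkQ ((in0 K B N).rTensor _ t) = 0 := by
    intro t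
    induction t with
    | zero => simp only [zero_tmul, tmul_zero, LinearEquiv.map_zero, LinearMap.map_zero, add_zero]
    | tmul x y => rw [LinearMap.rTensor_tmul, map_tmul, mkQ_in0, zero_tmul]
    | add p q hp hq => rw [map_add, map_add, hp, hq, add_zero]
  rw [e1, zero_add]
  clear hw
  induction w with
  | zero => simp only [LinearEquiv.map_zero, LinearMap.map_zero]
  | tmul n y =>
    obtain ⟨v, hv⟩ := comul_lfil k y.1 y.2
    rw [LinearMap.lTensor_tmul, LinearMap.lTensor_tmul, ← comul_eq, Submodule.subtype_apply, ← hv]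
    clear hv
    induction v with
    | zero => simp only [LinearEquiv.map_zero, LinearMap.map_zero, tmul_zero]
    | tmul p q =>
      have hq : (lfil K B N k).mkQ q.1 = 0 := (Submodule.Quotient.mk_eq_zero _).mpr q.2
      rw [LinearMap.lTensor_tmul, TensorProduct.assoc_symm_tmul, LinearMap.rTensor_tmul, map_tmul,
        Submodule.subtype_apply, hq, tmul_zero]
    | add p q hp hq => simp only [LinearMap.map_add, LinearEquiv.map_add, tmul_add] at hp hq ⊢; rw [hp, hq, add_zero]
  | add p q hp hq => simp only [LinearMap.map_add, LinearEquiv.map_add, hp, hq, add_zero]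

end CotAmb

namespace Cot

theorem map_incl_eq {X Y : Type*} [AddCommGroup X] [Module K X]
    [AddCommGroup Y] [Module K Y] (f : CotAmb K B N →ₗ[K] X) (g : CotAmb K B N →ₗ[K] Y)
    (x : Cot K B N) : map (f ∘ₗ (incl K B N).toLinearMap) (g ∘ₗ (incl K B N).toLinearMap)
      (comul x) = map f g (comul (incl K B N x)) := by
  rw [← map_comul, map_map]

variable (K B N) in
/-- The inclusion of `B`, the component of degree zero (see `range_inB`). -/
def inB : B →ₐ[K] Cot K B N :=
  AlgHom.ofLinearMap ((CotAmb.in0 K B N).codRestrict (CotAmb.cotSub K B N) CotAmb.in0_mem)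
    (Subtype.ext rfl) (fun b c => Subtype.ext (CotAmb.in0_mul b c))

@[simp] theorem incl_inB (b : B) : incl K B N (inB K B N b) = CotAmb.in0 K B N b := rfl

theorem comul_inB (b : B) : comul (R := K) (inB K B N b) =
    map (inB K B N).toLinearMap (inB K B N).toLinearMap (comul b) := by
  apply map_incl_injective
  rw [map_comul, incl_inB, CotAmb.comul_eq, CotAmb.del_in0, map_map]
  rfl

theorem counit_inB (b : B) : counit (R := K) (inB K B N b) = counit (R := K) b := by
  rw [← counit_incl, incl_inB, CotAmb.counit_eq]; simp

variable (K B N) in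
theorem exists_antipode_cot : ∃ S : Cot K B N →ₗ[K] Cot K B N,
    WithConv.toConv S * WithConv.toConv LinearMap.id = 1 ∧
      WithConv.toConv LinearMap.id * WithConv.toConv S = 1 := by
  have hz : ∀ k (c : Cot K B N), ((CotAmb.lfil K B N k).mkQ ∘ₗ (incl K B N).toLinearMap) c = 0 ↔
      incl K B N c ∈ CotAmb.lfil K B N k := fun k c => Submodule.Quotient.mk_eq_zero _
  have h00 : ∀ c : Cot K B N, ((CotAmb.lfil K B N 0).mkQ ∘ₗ (incl K B N).toLinearMap) c = 0 →
      ∃ b, c = inB K B N b := by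
    intro c hc
    rw [hz] at hc
    refine ⟨CotAmb.p0 K B N (incl K B N c), incl_injective ?_⟩
    have h := CotAmb.decomp (incl K B N c)
    rw [LinearMap.mem_ker.mp hc, map_zero, add_zero] at h
    exact h.symm
  let p : Cot K B N →ₗ[K] B := CotAmb.p0 K B N ∘ₗ (incl K B N).toLinearMap
  have hp : ∀ b, p (inB K B N b) = b := fun b => CotAmb.p0_in0 b
  have hm : ∀ z : B ⊗[K] B, LinearMap.mul' K _ (map (inB K B N).toLinearMap
      (inB K B N).toLinearMap z) = inB K B N (LinearMap.mul' K B z) := by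
    intro z
    induction z with
    | zero => simp only [map_zero]
    | tmul x y => simp only [map_tmul, LinearMap.mul'_apply, map_mul]; rfl
    | add p q hp hq => simp only [map_add, hp, hq]
  refine exists_antipode
    (fun k => (CotAmb.lfil K B N k).mkQ ∘ₗ (incl K B N).toLinearMap) ?_ ?_ ?_ ?_
    ((inB K B N).toLinearMap ∘ₗ HopfAlgebra.antipode K ∘ₗ p) ?_ ?_
  · intro k c hc
    rw [hz] at hc ⊢
    exact CotAmb.lfil_mono (Nat.le_succ k) hc
  · intro c
    obtain ⟨k, hk⟩ := CotAmb.lfil_exh (incl K B N c)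
    exact ⟨k, (hz k c).mpr hk⟩
  · intro c hc
    obtain ⟨b, rfl⟩ := h00 c hc
    rw [comul_inB]
    generalize comul (R := K) b = t
    induction t with
    | zero => simp only [zero_tmul, tmul_zero, LinearEquiv.map_zero, LinearMap.map_zero, add_zero]
    | tmul x y =>
      rw [map_tmul, LinearMap.rTensor_tmul]
      have : ((CotAmb.lfil K B N 0).mkQ ∘ₗ (incl K B N).toLinearMap) ((inB K B N).toLinearMap x)
        = 0 := CotAmb.mkQ_in0 x 0
      rw [this, zero_tmul]
    | add p q hp hq => rw [map_add, map_add, hp, hq, add_zero]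
  · intro k c hc
    rw [hz] at hc
    rw [map_incl_eq]
    exact CotAmb.comul_mkQ k _ hc
  · intro c hc
    obtain ⟨b, rfl⟩ := h00 c hc
    have e : ∀ z : B ⊗[K] B, ((inB K B N).toLinearMap ∘ₗ HopfAlgebra.antipode K ∘ₗ p).lTensor _
        (map (inB K B N).toLinearMap (inB K B N).toLinearMap z) =
        map (inB K B N).toLinearMap (inB K B N).toLinearMap
          ((HopfAlgebra.antipode K).lTensor B z) := by
      intro z
      induction z with
      | zero => simp only [zero_tmul, tmul_zero, LinearEquiv.map_zero, LinearMap.map_zero, add_zero]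
      | tmul x y =>
        simp only [map_tmul, LinearMap.lTensor_tmul, LinearMap.comp_apply, AlgHom.toLinearMap_apply,
          hp]
      | add p q hp hq => simp only [LinearMap.map_add, LinearEquiv.map_add, hp, hq]
    rw [comul_inB, e, hm, HopfAlgebra.mul_antipode_lTensor_comul_apply, counit_inB,
      AlgHom.commutes]
  · intro c hc
    obtain ⟨b, rfl⟩ := h00 c hc
    have e : ∀ z : B ⊗[K] B, ((inB K B N).toLinearMap ∘ₗ HopfAlgebra.antipode K ∘ₗ p).rTensor _
        (map (inB K B N).toLinearMap (inB K B N).toLinearMap z) =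
        map (inB K B N).toLinearMap (inB K B N).toLinearMap
          ((HopfAlgebra.antipode K).rTensor B z) := by
      intro z
      induction z with
      | zero => simp only [zero_tmul, tmul_zero, LinearEquiv.map_zero, LinearMap.map_zero, add_zero]
      | tmul x y =>
        simp only [map_tmul, LinearMap.rTensor_tmul, LinearMap.comp_apply, AlgHom.toLinearMap_apply,
          hp]
      | add p q hp hq => simp only [LinearMap.map_add, LinearEquiv.map_add, hp, hq]
    rw [comul_inB, e, hm, HopfAlgebra.mul_antipode_rTensor_comul_apply, counit_inB,
      AlgHom.commutes]

/-- The antipode of a Hopf algebra is unique, being a convolution inverse; only its existence is needed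
here. -/
instance : HopfAlgebra K (Cot K B N) := HopfAlgebra.ofConvInverse (exists_antipode_cot K B N).choose
  (exists_antipode_cot K B N).choose_spec.1 (exists_antipode_cot K B N).choose_spec.2

end Cot
end
end

/- ### The tensor algebra of a bimodule -/

section
section
variable (K H M : Type*) [Field K] [Ring H] [HopfAlgebra K H] [AddCommGroup M] [Module K M]
  [Module H M] [Module Hᵐᵒᵖ M]

/-- The relations that define the tensor algebra of the `H`-bimodule `M` as a quotient of the tensor
algebra of the vector space `H × M`: the product and the unit of `H`, and the two actions on `M`. -/
inductive TensorHopfRel : TensorAlgebra K (H × M) → TensorAlgebra K (H × M) → Prop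
  | one : TensorHopfRel (TensorAlgebra.ι K (1, 0)) 1
  | mul (h h' : H) : TensorHopfRel (TensorAlgebra.ι K (h * h', 0))
      (TensorAlgebra.ι K (h, 0) * TensorAlgebra.ι K (h', 0))
  | smul (h : H) (m : M) : TensorHopfRel (TensorAlgebra.ι K (0, h • m))
      (TensorAlgebra.ι K (h, 0) * TensorAlgebra.ι K (0, m))
  | op_smul (m : M) (h : H) : TensorHopfRel (TensorAlgebra.ι K (0, MulOpposite.op h • m))
      (TensorAlgebra.ι K (0, m) * TensorAlgebra.ι K (h, 0))

/-- The tensor Hopf algebra `T_H(M) = H ⊕ M ⊕ (M ⊗_H M) ⊕ ⋯` of a couple `(H, M)`. The underlying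
algebra is the tensor algebra of the `H`-bimodule `M`, by generators and relations; see
`TensorHopf.lift` and `TensorHopf.hom_ext` for its universal property. -/
def TensorHopf : Type _ := RingQuot (TensorHopfRel K H M)

namespace TensorHopf

instance : Ring (TensorHopf K H M) := inferInstanceAs (Ring (RingQuot (TensorHopfRel K H M)))
instance : Algebra K (TensorHopf K H M) :=
  inferInstanceAs (Algebra K (RingQuot (TensorHopfRel K H M)))

/-- The quotient map. -/
def mk : TensorAlgebra K (H × M) →ₐ[K] TensorHopf K H M :=
  RingQuot.mkAlgHom K (TensorHopfRel K H M)

variable {K H M} in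
theorem mk_rel {x y : TensorAlgebra K (H × M)} (h : TensorHopfRel K H M x y) :
    mk K H M x = mk K H M y := RingQuot.mkAlgHom_rel K h

/-- The inclusion of `H`, the component of degree zero. -/
def inH : H →ₐ[K] TensorHopf K H M :=
  AlgHom.ofLinearMap ((mk K H M).toLinearMap ∘ₗ TensorAlgebra.ι K ∘ₗ LinearMap.inl K H M)
    ((mk_rel .one).trans (map_one _)) (fun h h' => (mk_rel (.mul h h')).trans (map_mul _ _ _))

/-- The inclusion of `M`, the component of degree one. -/
def inM : M →ₗ[K] TensorHopf K H M :=
  (mk K H M).toLinearMap ∘ₗ TensorAlgebra.ι K ∘ₗ LinearMap.inr K H M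

variable {K H M}

theorem inM_smul (h : H) (m : M) : inM K H M (h • m) = inH K H M h * inM K H M m :=
  (mk_rel (.smul h m)).trans (map_mul _ _ _)

theorem inM_op_smul (m : M) (h : H) :
    inM K H M (MulOpposite.op h • m) = inM K H M m * inH K H M h :=
  (mk_rel (.op_smul m h)).trans (map_mul _ _ _)

section lift
variable {A : Type*} [Ring A] [Algebra K A] (f : H →ₐ[K] A) (g : M →ₗ[K] A)
  (hl : ∀ h m, g (h • m) = f h * g m) (hr : ∀ m h, g (MulOpposite.op h • m) = g m * f h)

/-- The universal property: an algebra map on `H` and a linear map on `M` that respects both actions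
extend to an algebra map on `T_H(M)`, which is unique by `hom_ext`. -/
def lift : TensorHopf K H M →ₐ[K] A :=
  RingQuot.liftAlgHom K ⟨TensorAlgebra.lift K (LinearMap.coprod f.toLinearMap g), by
    intro x y hxy
    cases hxy with
    | one => simp
    | mul h h' => simp
    | smul h m => simp [hl]
    | op_smul m h => simp [hr]⟩

@[simp] theorem lift_inH (h : H) : lift f g hl hr (inH K H M h) = f h := by
  refine (RingQuot.liftAlgHom_mkAlgHom_apply K _ _ _).trans ?_
  simp

@[simp] theorem lift_inM (m : M) : lift f g hl hr (inM K H M m) = g m := by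
  refine (RingQuot.liftAlgHom_mkAlgHom_apply K _ _ _).trans ?_
  simp

end lift

theorem hom_ext {A : Type*} [Ring A] [Algebra K A] {F G : TensorHopf K H M →ₐ[K] A}
    (h0 : ∀ h, F (inH K H M h) = G (inH K H M h)) (h1 : ∀ m, F (inM K H M m) = G (inM K H M m)) :
    F = G := by
  refine RingQuot.ringQuot_ext' K F G (TensorAlgebra.hom_ext (LinearMap.ext fun ⟨h, m⟩ => ?_))
  have e : ((h, m) : H × M) = (h, 0) + (0, m) := by simp
  have h0' : F (mk K H M (TensorAlgebra.ι K (h, 0))) = G (mk K H M (TensorAlgebra.ι K (h, 0))) :=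
    h0 h
  have h1' : F (mk K H M (TensorAlgebra.ι K (0, m))) = G (mk K H M (TensorAlgebra.ι K (0, m))) :=
    h1 m
  change F (mk K H M (TensorAlgebra.ι K (h, m))) = G (mk K H M (TensorAlgebra.ι K (h, m)))
  rw [e]
  simp only [map_add, h0', h1']

theorem subalgebra_eq_top (S : Subalgebra K (TensorHopf K H M)) (h0 : ∀ h, inH K H M h ∈ S)
    (h1 : ∀ m, inM K H M m ∈ S) (t : TensorHopf K H M) : t ∈ S := by
  let F : TensorHopf K H M →ₐ[K] S := lift ((inH K H M).codRestrict S h0)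
    ((inM K H M).codRestrict S.toSubmodule h1)
    (fun h m => Subtype.ext (inM_smul h m)) (fun m h => Subtype.ext (inM_op_smul m h))
  have : S.val.comp F = AlgHom.id K _ := hom_ext (fun h => by simp [F]) (fun m => by
    rw [AlgHom.comp_apply, lift_inM]; rfl)
  have h : (F t : TensorHopf K H M) = t := DFunLike.congr_fun this t
  exact h ▸ (F t).2

end TensorHopf
end
end

/- ### The tensor algebra of a Hopf bimodule is a bialgebra -/

section
namespace TensorHopf
variable (K H M : Type*) [Field K] [Ring H] [HopfAlgebra K H] [AddCommGroup M] [Module K M]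
  [Module H M] [Module Hᵐᵒᵖ M] [SMulCommClass H Hᵐᵒᵖ M] [IsScalarTower K H M]
  [IsScalarTower K Hᵐᵒᵖ M] [HopfBimodule K H M]

/-- The comultiplication on `H`. -/
def comulH : H →ₐ[K] TensorHopf K H M ⊗[K] TensorHopf K H M :=
  (Algebra.TensorProduct.map (inH K H M) (inH K H M)).comp (Bialgebra.comulAlgHom K H)

/-- The comultiplication on `M`, i.e. `ρ_l ⊕ ρ_r`. -/
def comulM : M →ₗ[K] TensorHopf K H M ⊗[K] TensorHopf K H M :=
  map (inH K H M).toLinearMap (inM K H M) ∘ₗ HopfBimodule.coactL +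
    map (inM K H M) (inH K H M).toLinearMap ∘ₗ HopfBimodule.coactR

variable {K H M}

theorem comulH_apply (h : H) : comulH K H M h =
    map (inH K H M).toLinearMap (inH K H M).toLinearMap (comul h) := rfl

theorem mulL_aux (x : H ⊗[K] H) (y : H ⊗[K] M) :
    map (inH K H M).toLinearMap (inM K H M)
      (map (LinearMap.mul' K H) (bimodActL K H M) (tensorTensorTensorComm K H H H M (x ⊗ₜ y))) =
    map (inH K H M).toLinearMap (inH K H M).toLinearMap x *
      map (inH K H M).toLinearMap (inM K H M) y := by
  induction x with
  | zero => simp only [zero_tmul, map_zero, zero_mul]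
  | tmul x1 x2 =>
    induction y with
    | zero => simp only [tmul_zero, map_zero, mul_zero]
    | tmul y1 y2 => simp [inM_smul]
    | add p q hp hq => simp only [tmul_add, LinearMap.map_add, LinearEquiv.map_add, hp, hq, mul_add]
  | add p q hp hq => simp only [add_tmul, LinearMap.map_add, LinearEquiv.map_add, hp, hq, add_mul]

theorem mulL_aux' (x : H ⊗[K] H) (y : M ⊗[K] H) :
    map (inM K H M) (inH K H M).toLinearMap
      (map (bimodActL K H M) (LinearMap.mul' K H) (tensorTensorTensorComm K H H M H (x ⊗ₜ y))) =
    map (inH K H M).toLinearMap (inH K H M).toLinearMap x *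
      map (inM K H M) (inH K H M).toLinearMap y := by
  induction x with
  | zero => simp only [zero_tmul, map_zero, zero_mul]
  | tmul x1 x2 =>
    induction y with
    | zero => simp only [tmul_zero, map_zero, mul_zero]
    | tmul y1 y2 => simp [inM_smul]
    | add p q hp hq => simp only [tmul_add, LinearMap.map_add, LinearEquiv.map_add, hp, hq, mul_add]
  | add p q hp hq => simp only [add_tmul, LinearMap.map_add, LinearEquiv.map_add, hp, hq, add_mul]

theorem mulR_aux (y : H ⊗[K] M) (x : H ⊗[K] H) :
    map (inH K H M).toLinearMap (inM K H M)
      (map (LinearMap.mul' K H) (bimodActR K H M) (tensorTensorTensorComm K H M H H (y ⊗ₜ x))) =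
      map (inH K H M).toLinearMap (inM K H M) y *
    map (inH K H M).toLinearMap (inH K H M).toLinearMap x := by
  induction x with
  | zero => simp only [tmul_zero, map_zero, mul_zero]
  | tmul x1 x2 =>
    induction y with
    | zero => simp only [zero_tmul, map_zero, zero_mul]
    | tmul y1 y2 => simp [inM_op_smul]
    | add p q hp hq => simp only [add_tmul, LinearMap.map_add, LinearEquiv.map_add, hp, hq, add_mul]
  | add p q hp hq => simp only [tmul_add, LinearMap.map_add, LinearEquiv.map_add, hp, hq, mul_add]

theorem mulR_aux' (y : M ⊗[K] H) (x : H ⊗[K] H) :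
    map (inM K H M) (inH K H M).toLinearMap
      (map (bimodActR K H M) (LinearMap.mul' K H) (tensorTensorTensorComm K M H H H (y ⊗ₜ x))) =
      map (inM K H M) (inH K H M).toLinearMap y *
    map (inH K H M).toLinearMap (inH K H M).toLinearMap x := by
  induction x with
  | zero => simp only [tmul_zero, map_zero, mul_zero]
  | tmul x1 x2 =>
    induction y with
    | zero => simp only [zero_tmul, map_zero, zero_mul]
    | tmul y1 y2 => simp [inM_op_smul]
    | add p q hp hq => simp only [add_tmul, LinearMap.map_add, LinearEquiv.map_add, hp, hq, add_mul]
  | add p q hp hq => simp only [tmul_add, LinearMap.map_add, LinearEquiv.map_add, hp, hq, mul_add]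

theorem comulM_smul (h : H) (m : M) : comulM K H M (h • m) = comulH K H M h * comulM K H M m := by
  simp only [comulM, LinearMap.add_apply, LinearMap.comp_apply, HopfBimodule.coactL_smul,
    HopfBimodule.coactR_smul, mulL_aux, mulL_aux', mul_add, comulH_apply]

theorem comulM_op_smul (m : M) (h : H) :
    comulM K H M (MulOpposite.op h • m) = comulM K H M m * comulH K H M h := by
  simp only [comulM, LinearMap.add_apply, LinearMap.comp_apply, HopfBimodule.coactL_op_smul,
    HopfBimodule.coactR_op_smul, mulR_aux, mulR_aux', add_mul, comulH_apply]

variable (K H M) in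
/-- The comultiplication, the algebra map that is `Δ` on `H` and `ρ_l ⊕ ρ_r` on `M`. -/
def comulHom : TensorHopf K H M →ₐ[K] TensorHopf K H M ⊗[K] TensorHopf K H M :=
  lift (comulH K H M) (comulM K H M) comulM_smul comulM_op_smul

variable (K H M) in
/-- The counit, the algebra map that is `ε` on `H` and zero on `M`. -/
def counitHom : TensorHopf K H M →ₐ[K] K :=
  lift (Bialgebra.counitAlgHom K H) 0 (by simp) (by simp)

theorem comulHom_inH (h : H) : comulHom K H M (inH K H M h) =
    map (inH K H M).toLinearMap (inH K H M).toLinearMap (comul h) := lift_inH _ _ _ _ h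

theorem comulHom_inM (m : M) : comulHom K H M (inM K H M m) =
    map (inH K H M).toLinearMap (inM K H M) (HopfBimodule.coactL m) +
    map (inM K H M) (inH K H M).toLinearMap (HopfBimodule.coactR m) := lift_inM _ _ _ _ m

@[simp] theorem counitHom_inH (h : H) : counitHom K H M (inH K H M h) = counit (R := K) h :=
  lift_inH _ _ _ _ h
@[simp] theorem counitHom_inM (m : M) : counitHom K H M (inM K H M m) = 0 :=
  lift_inM _ _ _ _ m

theorem coassoc_aux1 {X Y Z W : Type*} [AddCommGroup X] [Module K X] [AddCommGroup Y] [Module K Y]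
    [AddCommGroup Z] [Module K Z] [AddCommGroup W] [Module K W]
    (G : W →ₗ[K] TensorHopf K H M)
    (F1 : Y →ₗ[K] TensorHopf K H M) (F2 : Z →ₗ[K] TensorHopf K H M) (d : X →ₗ[K] Y ⊗[K] Z)
    (z : X ⊗[K] W) :
    TensorProduct.assoc K _ _ _ (map (map F1 F2 ∘ₗ d) G z) =
      map F1 (map F2 G) (TensorProduct.assoc K _ _ _ (d.rTensor W z)) := by
  induction z with
  | zero => simp only [zero_tmul, tmul_zero, LinearEquiv.map_zero, LinearMap.map_zero, add_zero]
  | tmul x w =>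
    rw [map_tmul, LinearMap.rTensor_tmul, LinearMap.comp_apply]
    generalize d x = t
    induction t with
    | zero => simp only [map_zero, zero_tmul]
    | tmul => rfl
    | add p q hp hq => simp only [add_tmul, LinearMap.map_add, LinearEquiv.map_add, hp, hq]
  | add p q hp hq => simp only [LinearMap.map_add, LinearEquiv.map_add, hp, hq]

theorem coassoc_aux2 {X Y Z W : Type*} [AddCommGroup X] [Module K X] [AddCommGroup Y] [Module K Y]
    [AddCommGroup Z] [Module K Z] [AddCommGroup W] [Module K W]
    (G : W →ₗ[K] TensorHopf K H M)
    (F1 : Y →ₗ[K] TensorHopf K H M) (F2 : Z →ₗ[K] TensorHopf K H M) (d : X →ₗ[K] Y ⊗[K] Z)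
    (z : W ⊗[K] X) :
    map G (map F1 F2 ∘ₗ d) z = map G (map F1 F2) (d.lTensor W z) := by
  simp only [LinearMap.lTensor, map_map]; rfl

theorem comulHom_comp_inH : (comulHom K H M).toLinearMap ∘ₗ (inH K H M).toLinearMap =
    map (inH K H M).toLinearMap (inH K H M).toLinearMap ∘ₗ comul :=
  LinearMap.ext comulHom_inH

theorem comulHom_comp_inM : (comulHom K H M).toLinearMap ∘ₗ inM K H M =
    map (inH K H M).toLinearMap (inM K H M) ∘ₗ HopfBimodule.coactL +
    map (inM K H M) (inH K H M).toLinearMap ∘ₗ HopfBimodule.coactR :=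
  LinearMap.ext comulHom_inM

instance : Bialgebra K (TensorHopf K H M) := Bialgebra.ofAlgHom (comulHom K H M) (counitHom K H M)
  (by
    refine hom_ext (fun h => ?_) (fun m => ?_)
    · change TensorProduct.assoc K _ _ _ (map (comulHom K H M).toLinearMap LinearMap.id
        (comulHom K H M (inH K H M h))) =
        map LinearMap.id (comulHom K H M).toLinearMap (comulHom K H M (inH K H M h))
      rw [comulHom_inH, map_map, map_map, comulHom_comp_inH, LinearMap.id_comp, coassoc_aux1,
        coassoc_aux2, coassoc_apply]
    · change TensorProduct.assoc K _ _ _ (map (comulHom K H M).toLinearMap LinearMap.id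
        (comulHom K H M (inM K H M m))) =
        map LinearMap.id (comulHom K H M).toLinearMap (comulHom K H M (inM K H M m))
      rw [comulHom_inM]
      simp only [map_add, map_map, comulHom_comp_inH, comulHom_comp_inM, LinearMap.id_comp,
        map_add_left, map_add_right, LinearMap.add_apply]
      simp only [coassoc_aux1, coassoc_aux2, HopfBimodule.coactL_coassoc, HopfBimodule.coact_comm,
        HopfBimodule.coactR_coassoc]
      abel)
  (by
    have e1 : (counitHom K H M).toLinearMap ∘ₗ (inH K H M).toLinearMap = counit :=
      LinearMap.ext counitHom_inH
    have e2 : (counitHom K H M).toLinearMap ∘ₗ inM K H M = 0 :=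
      LinearMap.ext counitHom_inM
    have e3 : ∀ {Y : Type _} [AddCommGroup Y] [Module K Y] (f : Y →ₗ[K] TensorHopf K H M) z,
      map (counit (R := K) (A := H)) f z = f.lTensor K (counit.rTensor _ z) := fun f z => by
        simp only [LinearMap.rTensor, LinearMap.lTensor, map_map]; rfl
    have e3' : ∀ (f : H →ₗ[K] TensorHopf K H M) z,
      map (counit (R := K) (A := H)) f z = f.lTensor K (counit.rTensor _ z) := fun f z => by
        simp only [LinearMap.rTensor, LinearMap.lTensor, map_map]; rfl
    refine hom_ext (fun h => ?_) (fun m => ?_)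
    · change map (counitHom K H M).toLinearMap LinearMap.id (comulHom K H M (inH K H M h)) =
        1 ⊗ₜ inH K H M h
      rw [comulHom_inH, map_map, e1, LinearMap.id_comp, e3', rTensor_counit_comul]
      rfl
    · change map (counitHom K H M).toLinearMap LinearMap.id (comulHom K H M (inM K H M m)) =
        1 ⊗ₜ inM K H M m
      rw [comulHom_inM, map_add, map_map, map_map, e1, e2, LinearMap.id_comp, e3,
        HopfBimodule.coactL_counit]
      simp)
  (by
    have e1 : (counitHom K H M).toLinearMap ∘ₗ (inH K H M).toLinearMap = counit :=
      LinearMap.ext counitHom_inH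
    have e2 : (counitHom K H M).toLinearMap ∘ₗ inM K H M = 0 :=
      LinearMap.ext counitHom_inM
    have e3 : ∀ {Y : Type _} [AddCommGroup Y] [Module K Y] (f : Y →ₗ[K] TensorHopf K H M) z,
      map f (counit (R := K) (A := H)) z = f.rTensor K (counit.lTensor _ z) := fun f z => by
        simp only [LinearMap.rTensor, LinearMap.lTensor, map_map]; rfl
    have e3' : ∀ (f : H →ₗ[K] TensorHopf K H M) z,
      map f (counit (R := K) (A := H)) z = f.rTensor K (counit.lTensor _ z) := fun f z => by
        simp only [LinearMap.rTensor, LinearMap.lTensor, map_map]; rfl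
    refine hom_ext (fun h => ?_) (fun m => ?_)
    · change map LinearMap.id (counitHom K H M).toLinearMap (comulHom K H M (inH K H M h)) =
        inH K H M h ⊗ₜ 1
      rw [comulHom_inH, map_map, e1, LinearMap.id_comp, e3', lTensor_counit_comul]
      rfl
    · change map LinearMap.id (counitHom K H M).toLinearMap (comulHom K H M (inM K H M m)) =
        inM K H M m ⊗ₜ 1
      rw [comulHom_inM, map_add, map_map, map_map, e1, e2, LinearMap.id_comp, LinearMap.id_comp, e3,
        HopfBimodule.coactR_counit]
      simp)

theorem comul_eq (t : TensorHopf K H M) : comul (R := K) t = comulHom K H M t := rfl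
theorem counit_eq (t : TensorHopf K H M) : counit (R := K) t = counitHom K H M t := rfl

end TensorHopf
end

/- ### The tensor Hopf algebra -/

section
namespace TensorHopf
variable (K H M : Type*) [Field K] [Ring H] [HopfAlgebra K H] [AddCommGroup M] [Module K M]
  [Module H M] [Module Hᵐᵒᵖ M] [SMulCommClass H Hᵐᵒᵖ M] [IsScalarTower K H M]
  [IsScalarTower K Hᵐᵒᵖ M] [HopfBimodule K H M]

/-- The part of degree at most `k`. -/
def fil : ℕ → Submodule K (TensorHopf K H M)
  | 0 => LinearMap.range (inH K H M).toLinearMap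
  | k + 1 => (LinearMap.range (inH K H M).toLinearMap ⊔ LinearMap.range (inM K H M)) * fil k

variable {K H M}

theorem inH_mem_fil0 (h : H) : inH K H M h ∈ fil K H M 0 := ⟨h, rfl⟩

theorem inH_mul_mem_succ (h : H) {k : ℕ} {x} (hx : x ∈ fil K H M k) :
    inH K H M h * x ∈ fil K H M (k + 1) :=
  Submodule.mul_mem_mul (Submodule.mem_sup_left ⟨h, rfl⟩) hx

theorem inM_mul_mem_succ (m : M) {k : ℕ} {x} (hx : x ∈ fil K H M k) :
    inM K H M m * x ∈ fil K H M (k + 1) :=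
  Submodule.mul_mem_mul (Submodule.mem_sup_right ⟨m, rfl⟩) hx

theorem fil_succ_ind {k : ℕ} {P : Submodule K (TensorHopf K H M)}
    (h0 : ∀ h, ∀ x ∈ fil K H M k, inH K H M h * x ∈ P)
    (h1 : ∀ m, ∀ x ∈ fil K H M k, inM K H M m * x ∈ P) : fil K H M (k + 1) ≤ P := by
  refine Submodule.mul_le.mpr fun v hv x hx => ?_
  obtain ⟨_, ⟨h, rfl⟩, _, ⟨m, rfl⟩, rfl⟩ := Submodule.mem_sup.mp hv
  rw [add_mul]
  exact add_mem (h0 h x hx) (h1 m x hx)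

theorem fil_mono_succ (k : ℕ) {x} (hx : x ∈ fil K H M k) : x ∈ fil K H M (k + 1) := by
  have := inH_mul_mem_succ (1 : H) hx
  rwa [map_one, one_mul] at this

theorem fil_mono : Monotone (fil K H M) := monotone_nat_of_le_succ fun k _ hx => fil_mono_succ k hx

theorem inH_mul_mem (h : H) {k : ℕ} {x} (hx : x ∈ fil K H M k) :
    inH K H M h * x ∈ fil K H M k := by
  cases k with
  | zero =>
    obtain ⟨h', rfl⟩ := hx
    exact ⟨h * h', map_mul (inH K H M) _ _⟩
  | succ k =>
    refine fil_succ_ind (P := (fil K H M (k + 1)).comap (LinearMap.mulLeft K (inH K H M h)))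
      (fun h' x hx => ?_) (fun m x hx => ?_) hx
    · change inH K H M h * (inH K H M h' * x) ∈ fil K H M (k + 1)
      rw [← mul_assoc, ← map_mul]
      exact inH_mul_mem_succ _ hx
    · change inH K H M h * (inM K H M m * x) ∈ fil K H M (k + 1)
      rw [← mul_assoc, ← inM_smul]
      exact inM_mul_mem_succ _ hx

theorem fil_exh (t : TensorHopf K H M) : ∃ k, t ∈ fil K H M k := by
  let S : Subalgebra K (TensorHopf K H M) :=
    { carrier := {t | ∀ k, ∀ x ∈ fil K H M k, ∃ l, t * x ∈ fil K H M l}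
      mul_mem' := by
        intro a b ha hb k x hx
        obtain ⟨l, hl⟩ := hb k x hx
        obtain ⟨l', hl'⟩ := ha l _ hl
        exact ⟨l', by rwa [mul_assoc]⟩
      add_mem' := by
        intro a b ha hb k x hx
        obtain ⟨l, hl⟩ := ha k x hx
        obtain ⟨l', hl'⟩ := hb k x hx
        refine ⟨max l l', ?_⟩
        rw [add_mul]
        exact add_mem (fil_mono (le_max_left l l') hl) (fil_mono (le_max_right l l') hl')
      algebraMap_mem' := by
        intro r k x hx
        refine ⟨k, ?_⟩
        rw [← Algebra.smul_def]
        exact Submodule.smul_mem _ r hx }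
  have := subalgebra_eq_top S (fun h k x hx => ⟨k, inH_mul_mem h hx⟩)
    (fun m k x hx => ⟨k + 1, inM_mul_mem_succ m hx⟩) t 0 1 ⟨1, map_one (inH K H M)⟩
  rwa [mul_one] at this

/-- The subspace `P ⊗ T + T ⊗ Q`. -/
def tsup (P Q : Submodule K (TensorHopf K H M)) :
    Submodule K (TensorHopf K H M ⊗[K] TensorHopf K H M) :=
  Submodule.span K {z | ∃ a b, (a ∈ P ∨ b ∈ Q) ∧ z = a ⊗ₜ b}

theorem map_mul_mem {X Y : Type*} [AddCommGroup X] [Module K X] [AddCommGroup Y] [Module K Y]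
    (F : X →ₗ[K] TensorHopf K H M) (G : Y →ₗ[K] TensorHopf K H M)
    {P Q P' Q' : Submodule K (TensorHopf K H M)} (hP : ∀ x, ∀ p ∈ P, F x * p ∈ P')
    (hQ : ∀ y, ∀ q ∈ Q, G y * q ∈ Q') (z : X ⊗[K] Y) {w} (hw : w ∈ tsup P Q) :
    map F G z * w ∈ tsup P' Q' := by
  induction z with
  | zero => rw [map_zero, zero_mul]; exact zero_mem _
  | tmul x y =>
    induction hw using Submodule.span_induction with
    | mem w hw =>
      obtain ⟨a, b, hab, rfl⟩ := hw
      rw [map_tmul, Algebra.TensorProduct.tmul_mul_tmul]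
      exact Submodule.subset_span ⟨_, _, hab.imp (hP x a) (hQ y b), rfl⟩
    | zero => rw [mul_zero]; exact zero_mem _
    | add p q _ _ hp hq => rw [mul_add]; exact add_mem hp hq
    | smul r p _ hp => rw [mul_smul_comm]; exact Submodule.smul_mem _ r hp
  | add p q hp hq => rw [map_add, add_mul]; exact add_mem hp hq

theorem map_mem_left {X Y : Type*} [AddCommGroup X] [Module K X] [AddCommGroup Y] [Module K Y]
    (F : X →ₗ[K] TensorHopf K H M) (G : Y →ₗ[K] TensorHopf K H M)
    {P Q : Submodule K (TensorHopf K H M)} (hP : ∀ x y, F x ∈ P ∨ G y ∈ Q) (z : X ⊗[K] Y) :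
    map F G z ∈ tsup P Q := by
  induction z with
  | zero => rw [map_zero]; exact zero_mem _
  | tmul x y => exact Submodule.subset_span ⟨_, _, hP x y, rfl⟩
  | add p q hp hq => rw [map_add]; exact add_mem hp hq

theorem tsup_mono {P Q P' Q' : Submodule K (TensorHopf K H M)} (hP : P ≤ P') (hQ : Q ≤ Q') :
    tsup P Q ≤ tsup P' Q' :=
  Submodule.span_mono fun _ ⟨a, b, h, e⟩ => ⟨a, b, h.imp (@hP a) (@hQ b), e⟩

theorem comulHom_fil (k : ℕ) : fil K H M k ≤ (tsup ⊥ (fil K H M k)).comap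
    (comulHom K H M).toLinearMap := by
  induction k with
  | zero =>
    rintro _ ⟨h, rfl⟩
    change comulHom K H M (inH K H M h) ∈ tsup ⊥ (fil K H M 0)
    rw [comulHom_inH]
    exact map_mem_left _ _ (fun _ y => Or.inr (inH_mem_fil0 y)) _
  | succ k ih =>
    have hb : ∀ (t : TensorHopf K H M), ∀ p ∈ (⊥ : Submodule K (TensorHopf K H M)),
        t * p ∈ (⊥ : Submodule K (TensorHopf K H M)) := by
      intro t p hp; rw [Submodule.mem_bot] at hp ⊢; rw [hp, mul_zero]
    refine fil_succ_ind (fun h x hx => ?_) (fun m x hx => ?_)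
    · change comulHom K H M (inH K H M h * x) ∈ tsup ⊥ (fil K H M (k + 1))
      rw [map_mul, comulHom_inH]
      exact map_mul_mem _ _ (fun _ => hb _) (fun y _ hq => inH_mul_mem_succ y hq) _ (ih hx)
    · change comulHom K H M (inM K H M m * x) ∈ tsup ⊥ (fil K H M (k + 1))
      rw [map_mul, comulHom_inM, add_mul]
      exact add_mem
        (map_mul_mem _ _ (fun _ => hb _) (fun y _ hq => inM_mul_mem_succ y hq) _ (ih hx))
        (map_mul_mem _ _ (fun _ => hb _) (fun y _ hq => inH_mul_mem_succ y hq) _ (ih hx))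

theorem comulHom_fil_succ (k : ℕ) : fil K H M (k + 1) ≤
    (tsup (fil K H M 0) (fil K H M k)).comap (comulHom K H M).toLinearMap := by
  have hb : ∀ (t : TensorHopf K H M), ∀ p ∈ (⊥ : Submodule K (TensorHopf K H M)),
      t * p ∈ (⊥ : Submodule K (TensorHopf K H M)) := by
    intro t p hp; rw [Submodule.mem_bot] at hp ⊢; rw [hp, mul_zero]
  induction k with
  | zero =>
    refine fil_succ_ind (fun h x hx => ?_) (fun m x hx => ?_)
    · obtain ⟨h', rfl⟩ := hx
      change comulHom K H M (inH K H M h * inH K H M h') ∈ tsup (fil K H M 0) (fil K H M 0)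
      rw [← map_mul, comulHom_inH]
      exact map_mem_left _ _ (fun _ y => Or.inr (inH_mem_fil0 y)) _
    · obtain ⟨h', rfl⟩ := hx
      change comulHom K H M (inM K H M m * inH K H M h') ∈ tsup (fil K H M 0) (fil K H M 0)
      rw [← inM_op_smul, comulHom_inM]
      exact add_mem (map_mem_left _ _ (fun x _ => Or.inl (inH_mem_fil0 x)) _)
        (map_mem_left _ _ (fun _ y => Or.inr (inH_mem_fil0 y)) _)
  | succ k ih =>
    refine fil_succ_ind (fun h x hx => ?_) (fun m x hx => ?_)
    · change comulHom K H M (inH K H M h * x) ∈ tsup (fil K H M 0) (fil K H M (k + 1))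
      rw [map_mul, comulHom_inH]
      exact map_mul_mem _ _ (fun x _ hp => inH_mul_mem x hp) (fun y _ hq => inH_mul_mem_succ y hq)
        _ (ih hx)
    · change comulHom K H M (inM K H M m * x) ∈ tsup (fil K H M 0) (fil K H M (k + 1))
      rw [map_mul, comulHom_inM, add_mul]
      exact add_mem
        (map_mul_mem _ _ (fun x _ hp => inH_mul_mem x hp) (fun y _ hq => inM_mul_mem_succ y hq)
          _ (ih hx))
        (tsup_mono bot_le le_rfl
          (map_mul_mem _ _ (fun _ => hb _) (fun y _ hq => inH_mul_mem y hq) _ (comulHom_fil _ hx)))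

theorem tsup_le_ker (P Q : Submodule K (TensorHopf K H M)) {z} (hz : z ∈ tsup P Q) :
    map P.mkQ Q.mkQ z = 0 := by
  induction hz using Submodule.span_induction with
  | mem w hw =>
    obtain ⟨a, b, hab, rfl⟩ := hw
    rw [map_tmul]
    rcases hab with h | h
    · rw [show P.mkQ a = 0 from (Submodule.Quotient.mk_eq_zero _).mpr h, zero_tmul]
    · rw [show Q.mkQ b = 0 from (Submodule.Quotient.mk_eq_zero _).mpr h, tmul_zero]
  | zero => rw [map_zero]
  | add p q _ _ hp hq => rw [map_add, hp, hq, add_zero]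
  | smul r p _ hp => rw [map_smul, hp, smul_zero]

variable (K H M) in
theorem exists_antipode_tensorHopf : ∃ S : TensorHopf K H M →ₗ[K] TensorHopf K H M,
    WithConv.toConv S * WithConv.toConv LinearMap.id = 1 ∧
      WithConv.toConv LinearMap.id * WithConv.toConv S = 1 := by
  have hz : ∀ k c, (fil K H M k).mkQ c = 0 ↔ c ∈ fil K H M k :=
    fun k c => Submodule.Quotient.mk_eq_zero _
  have h00 : ∀ c, (fil K H M 0).mkQ c = 0 → ∃ h, c = inH K H M h := by
    intro c hc
    obtain ⟨h, hh⟩ := (hz 0 c).mp hc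
    exact ⟨h, hh.symm⟩
  let p : TensorHopf K H M →ₗ[K] H := (lift (AlgHom.id K H) (0 : M →ₗ[K] H) (by simp)
    (by simp)).toLinearMap
  have hp : ∀ h, p (inH K H M h) = h := fun h => lift_inH _ _ _ _ h
  have hm : ∀ z : H ⊗[K] H, LinearMap.mul' K _ (map (inH K H M).toLinearMap
      (inH K H M).toLinearMap z) = inH K H M (LinearMap.mul' K H z) := by
    intro z
    induction z with
    | zero => simp only [map_zero]
    | tmul x y => simp only [map_tmul, LinearMap.mul'_apply, map_mul]; rfl
    | add p q hp hq => simp only [map_add, hp, hq]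
  refine exists_antipode (fun k => (fil K H M k).mkQ) ?_ ?_ ?_ ?_
    ((inH K H M).toLinearMap ∘ₗ HopfAlgebra.antipode K ∘ₗ p) ?_ ?_
  · intro k c hc
    rw [hz] at hc ⊢
    exact fil_mono_succ k hc
  · intro c
    obtain ⟨k, hk⟩ := fil_exh c
    exact ⟨k, (hz k c).mpr hk⟩
  · intro c hc
    obtain ⟨h, rfl⟩ := h00 c hc
    rw [comul_eq, comulHom_inH]
    generalize comul (R := K) h = t
    induction t with
    | zero => simp only [zero_tmul, tmul_zero, LinearEquiv.map_zero, LinearMap.map_zero, add_zero]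
    | tmul x y =>
      rw [map_tmul, LinearMap.rTensor_tmul]
      have : (fil K H M 0).mkQ ((inH K H M).toLinearMap x) = 0 := (hz 0 _).mpr ⟨x, rfl⟩
      rw [this, zero_tmul]
    | add p q hp hq => rw [map_add, map_add, hp, hq, add_zero]
  · intro k c hc
    rw [hz] at hc
    exact tsup_le_ker _ _ (comulHom_fil_succ k hc)
  · intro c hc
    obtain ⟨h, rfl⟩ := h00 c hc
    have e : ∀ z : H ⊗[K] H, ((inH K H M).toLinearMap ∘ₗ HopfAlgebra.antipode K ∘ₗ p).lTensor _
        (map (inH K H M).toLinearMap (inH K H M).toLinearMap z) =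
        map (inH K H M).toLinearMap (inH K H M).toLinearMap
          ((HopfAlgebra.antipode K).lTensor H z) := by
      intro z
      induction z with
      | zero => simp only [zero_tmul, tmul_zero, LinearEquiv.map_zero, LinearMap.map_zero, add_zero]
      | tmul x y =>
        simp only [map_tmul, LinearMap.lTensor_tmul, LinearMap.comp_apply, AlgHom.toLinearMap_apply,
          hp]
      | add p q hp hq => simp only [LinearMap.map_add, LinearEquiv.map_add, hp, hq]
    rw [comul_eq, comulHom_inH, e, hm, HopfAlgebra.mul_antipode_lTensor_comul_apply, counit_eq,
      counitHom_inH, AlgHom.commutes]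
  · intro c hc
    obtain ⟨h, rfl⟩ := h00 c hc
    have e : ∀ z : H ⊗[K] H, ((inH K H M).toLinearMap ∘ₗ HopfAlgebra.antipode K ∘ₗ p).rTensor _
        (map (inH K H M).toLinearMap (inH K H M).toLinearMap z) =
        map (inH K H M).toLinearMap (inH K H M).toLinearMap
          ((HopfAlgebra.antipode K).rTensor H z) := by
      intro z
      induction z with
      | zero => simp only [zero_tmul, tmul_zero, LinearEquiv.map_zero, LinearMap.map_zero, add_zero]
      | tmul x y =>
        simp only [map_tmul, LinearMap.rTensor_tmul, LinearMap.comp_apply, AlgHom.toLinearMap_apply,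
          hp]
      | add p q hp hq => simp only [LinearMap.map_add, LinearEquiv.map_add, hp, hq]
    rw [comul_eq, comulHom_inH, e, hm, HopfAlgebra.mul_antipode_rTensor_comul_apply, counit_eq,
      counitHom_inH, AlgHom.commutes]

/-- The antipode of a Hopf algebra is unique, being a convolution inverse; only its existence is needed
here. -/
instance : HopfAlgebra K (TensorHopf K H M) :=
  HopfAlgebra.ofConvInverse (exists_antipode_tensorHopf K H M).choose
    (exists_antipode_tensorHopf K H M).choose_spec.1 (exists_antipode_tensorHopf K H M).choose_spec.2

end TensorHopf
end

/- ### The components of degree zero and one of the cotensor Hopf algebra -/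

section
section
variable (K B N : Type*) [Field K] [Ring B] [HopfAlgebra K B] [AddCommGroup N] [Module K N]
  [Module B N] [Module Bᵐᵒᵖ N] [SMulCommClass B Bᵐᵒᵖ N] [IsScalarTower K B N]
  [IsScalarTower K Bᵐᵒᵖ N] [HopfBimodule K B N]

namespace CotAmb

/-- The copy of `N` in degree one: `n ↦ ∑ n₀ ⊗ n₁ ∈ N ⊗ B`. -/
def in1 : N →ₗ[K] CotAmb K B N :=
  shL K B N ∘ₗ (in0 K B N).lTensor N ∘ₗ HopfBimodule.coactR

variable {K B N}

theorem kap_in1 (n : N) : kap K B N (in1 K B N n) =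
    (in0 K B N).lTensor N (HopfBimodule.coactR n) := kap_shL _

theorem p0_in1 (n : N) : p0 K B N (in1 K B N n) = 0 := by
  have e : p0 K B N ∘ₗ shL K B N = 0 := TensorProduct.ext' fun n a => by simp
  exact LinearMap.congr_fun e _

theorem p1_in1 (n : N) : p1 K B N (in1 K B N n) = n := by
  have e : ∀ z : N ⊗[K] B, p1 K B N (shL K B N ((in0 K B N).lTensor N z)) =
      TensorProduct.rid K N ((counit (R := K)).lTensor N z) := by
    intro z
    induction z with
    | zero => simp only [zero_tmul, tmul_zero, LinearEquiv.map_zero, LinearMap.map_zero, add_zero]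
    | tmul n b => simp [counit_eq]
    | add p q hp hq => simp only [LinearMap.map_add, LinearEquiv.map_add, hp, hq]
  have h := e (HopfBimodule.coactR n)
  rw [HopfBimodule.coactR_counit] at h
  rw [TensorProduct.rid_tmul, one_smul] at h
  exact h

theorem lTensor_in0_mem_cotensorAmb (z : N ⊗[K] B) :
    (in0 K B N).lTensor N z ∈ cotensorAmb K B N ↔
      TensorProduct.assoc K N B B ((HopfBimodule.coactR (H := B)).rTensor B z) =
        comul.lTensor N z := by
  have e1 : ∀ z : N ⊗[K] B, TensorProduct.assoc K N B _ ((HopfBimodule.coactR (H := B)).rTensor _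
      ((in0 K B N).lTensor N z)) = ((in0 K B N).lTensor B).lTensor N
        (TensorProduct.assoc K N B B ((HopfBimodule.coactR (H := B)).rTensor B z)) := by
    intro z
    induction z with
    | zero => simp only [zero_tmul, tmul_zero, LinearEquiv.map_zero, LinearMap.map_zero, add_zero]
    | tmul n b =>
      rw [LinearMap.lTensor_tmul, LinearMap.rTensor_tmul, LinearMap.rTensor_tmul]
      generalize HopfBimodule.coactR (K := K) (H := B) n = t
      induction t with
      | zero => simp only [zero_tmul, LinearEquiv.map_zero, LinearMap.map_zero]
      | tmul => rfl
      | add p q hp hq => simp only [add_tmul, LinearMap.map_add, LinearEquiv.map_add, hp, hq]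
    | add p q hp hq => simp only [LinearMap.map_add, LinearEquiv.map_add, hp, hq]
  have e2 : lam K B N ∘ₗ in0 K B N = (in0 K B N).lTensor B ∘ₗ comul := LinearMap.ext lam_in0
  have inj : Function.Injective (((in0 K B N).lTensor B).lTensor N) := by
    have h : Function.LeftInverse (p0 K B N) (in0 K B N) := p0_in0
    have e : p0 K B N ∘ₗ in0 K B N = LinearMap.id := LinearMap.ext h
    refine Function.LeftInverse.injective (g := ((p0 K B N).lTensor B).lTensor N) fun x => ?_
    rw [← LinearMap.lTensor_comp_apply, ← LinearMap.lTensor_comp, e, LinearMap.lTensor_id,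
      LinearMap.lTensor_id, LinearMap.id_apply]
  change TensorProduct.assoc K N B _ ((HopfBimodule.coactR (H := B)).rTensor _
      ((in0 K B N).lTensor N z)) = (lam K B N).lTensor N ((in0 K B N).lTensor N z) ↔ _
  rw [e1, ← LinearMap.lTensor_comp_apply, e2, LinearMap.lTensor_comp_apply]
  exact inj.eq_iff

theorem range_in1 : LinearMap.range (in1 K B N) = cotPow K B N 1 := by
  have e0 : ∀ z : N ⊗[K] B, (in0 K B N).lTensor N z ∈
      LinearMap.range ((cotPow K B N 0).subtype.lTensor N) := fun z =>
    range_lTensor_mono _ _ (fun b => LinearMap.mem_range_self _ b) z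
  apply le_antisymm
  · rintro _ ⟨n, rfl⟩
    exact ⟨_, ⟨(lTensor_in0_mem_cotensorAmb _).mpr (HopfBimodule.coactR_coassoc n), e0 _⟩, rfl⟩
  · rintro _ ⟨y, ⟨hy, w, rfl⟩, rfl⟩
    obtain ⟨z, hz⟩ : ∃ z : N ⊗[K] B, (in0 K B N).lTensor N z =
        (cotPow K B N 0).subtype.lTensor N w := by
      clear hy
      induction w with
      | zero => exact ⟨0, by simp only [map_zero]⟩
      | tmul n y =>
        obtain ⟨b, hb⟩ := y.2
        exact ⟨n ⊗ₜ b, by rw [LinearMap.lTensor_tmul, hb]; rfl⟩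
      | add p q hp hq =>
        obtain ⟨z, hz⟩ := hp
        obtain ⟨z', hz'⟩ := hq
        exact ⟨z + z', by rw [map_add, map_add, hz, hz']⟩
    rw [← hz] at hy ⊢
    have h := (lTensor_in0_mem_cotensorAmb z).mp hy
    refine ⟨TensorProduct.rid K N (counit.lTensor N z), ?_⟩
    change shL K B N ((in0 K B N).lTensor N _) = _
    congr 2
    have e1 : ∀ z : N ⊗[K] B, HopfBimodule.coactR (TensorProduct.rid K N
        ((counit (R := K) (A := B)).lTensor N z)) = (TensorProduct.rid K B).toLinearMap.lTensor N
          ((counit.lTensor B).lTensor N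
          (TensorProduct.assoc K N B B ((HopfBimodule.coactR (H := B)).rTensor B z))) := by
      intro z
      induction z with
      | zero => simp only [zero_tmul, tmul_zero, LinearEquiv.map_zero, LinearMap.map_zero, add_zero]
      | tmul n b =>
        rw [LinearMap.lTensor_tmul, LinearMap.rTensor_tmul, TensorProduct.rid_tmul, map_smul]
        generalize HopfBimodule.coactR (K := K) (H := B) n = t
        induction t with
        | zero => simp only [zero_tmul, LinearEquiv.map_zero, LinearMap.map_zero, smul_zero]
        | tmul => simp
        | add p q hp hq => simp only [add_tmul, LinearMap.map_add, LinearEquiv.map_add, hp, hq, smul_add]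
      | add p q hp hq => simp only [LinearMap.map_add, LinearEquiv.map_add, hp, hq]
    rw [e1, h]
    have e2 : (counit (R := K)).lTensor B ∘ₗ comul = (TensorProduct.mk K B K).flip 1 :=
      lTensor_counit_comp_comul
    rw [← LinearMap.lTensor_comp_apply N _ (comul (R := K) (A := B)), e2,
      ← LinearMap.lTensor_comp_apply]
    have e3 : (TensorProduct.rid K B).toLinearMap ∘ₗ (TensorProduct.mk K B K).flip 1 =
      LinearMap.id := by ext; simp
    rw [e3, LinearMap.lTensor_id, LinearMap.id_apply]

theorem lam_in1 (n : N) : lam K B N (in1 K B N n) =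
    (in1 K B N).lTensor B (HopfBimodule.coactL n) := by
  have e1 : ∀ z : N ⊗[K] B, lam K B N (shL K B N ((in0 K B N).lTensor N z)) =
      (shL K B N ∘ₗ (in0 K B N).lTensor N).lTensor B
        (TensorProduct.assoc K B N B (HopfBimodule.coactL.rTensor B z)) := by
    intro z
    induction z with
    | zero => simp only [zero_tmul, tmul_zero, LinearEquiv.map_zero, LinearMap.map_zero, add_zero]
    | tmul n b =>
      rw [LinearMap.lTensor_tmul, LinearMap.rTensor_tmul, shL_tmul, lam_sh]
      generalize HopfBimodule.coactL (K := K) (H := B) n = t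
      induction t with
      | zero => simp only [zero_tmul, LinearEquiv.map_zero, LinearMap.map_zero]
      | tmul => rfl
      | add p q hp hq => simp only [add_tmul, LinearMap.map_add, LinearEquiv.map_add, hp, hq]
    | add p q hp hq => simp only [LinearMap.map_add, LinearEquiv.map_add, hp, hq]
  change lam K B N (shL K B N ((in0 K B N).lTensor N _)) = _
  rw [e1, HopfBimodule.coact_comm, ← LinearMap.lTensor_comp_apply]
  rfl

theorem comul_in1 (n : N) : comul (R := K) (in1 K B N n) =
    map (in0 K B N) (in1 K B N) (HopfBimodule.coactL n) +
      map (in1 K B N) (in0 K B N) (HopfBimodule.coactR n) := by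
  rw [comul_eq, del_eq, lam_in1, kap_in1]
  congr 1
  · simp only [LinearMap.rTensor, LinearMap.lTensor, map_map]; rfl
  · have e2 : del K B N ∘ₗ in0 K B N = map (in0 K B N) (in0 K B N) ∘ₗ comul :=
      LinearMap.ext del_in0
    rw [← LinearMap.lTensor_comp_apply, e2, LinearMap.lTensor_comp_apply,
      ← HopfBimodule.coactR_coassoc]
    generalize HopfBimodule.coactR (K := K) (H := B) n = t
    induction t with
    | zero => simp only [LinearEquiv.map_zero, LinearMap.map_zero]
    | tmul m b =>
      rw [LinearMap.rTensor_tmul, map_tmul]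
      change _ = shL K B N ((in0 K B N).lTensor N _) ⊗ₜ _
      generalize HopfBimodule.coactR (K := K) (H := B) m = s
      induction s with
      | zero => simp only [LinearEquiv.map_zero, LinearMap.map_zero, zero_tmul]
      | tmul => rfl
      | add p q hp hq => simp only [add_tmul, LinearMap.map_add, LinearEquiv.map_add, hp, hq]
    | add p q hp hq => simp only [LinearMap.map_add, LinearEquiv.map_add, hp, hq]

theorem in0_mul_in1 (b : B) (n : N) : in0 K B N b * in1 K B N n = in1 K B N (b • n) := by
  rw [← decomp (in0 K B N b * in1 K B N n), p0_mul, p0_in1, mul_zero, map_zero, zero_add]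
  change shL K B N (kap K B N (mulL K B N _)) = shL K B N ((in0 K B N).lTensor N _)
  congr 1
  rw [univ_kap (mulF0 K B N) (mulF1 K B N) (mulL K B N) mulL_spec, mulF1_comul, kap_in0, kap_in1,
    zero_tmul, LinearEquiv.map_zero, LinearMap.map_zero, add_zero, lam_in0,
    HopfBimodule.coactR_smul]
  generalize HopfBimodule.coactR (K := K) (H := B) n = t
  generalize comul (R := K) b = s
  induction s with
  | zero => simp only [zero_tmul, LinearEquiv.map_zero, LinearMap.map_zero]
  | tmul x y =>
    induction t with
    | zero => simp only [tmul_zero, LinearEquiv.map_zero, LinearMap.map_zero]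
    | tmul m c =>
      simp only [LinearMap.lTensor_tmul, tensorTensorTensorComm_tmul, LinearMap.rTensor_tmul,
        map_tmul, bimodActL_tmul, LinearMap.mul'_apply, in0_mul]
      rfl
    | add p q hp hq => simp only [tmul_add, LinearMap.map_add, LinearEquiv.map_add, hp, hq]
  | add p q hp hq => simp only [add_tmul, LinearMap.map_add, LinearEquiv.map_add, hp, hq]

theorem in1_mul_in0 (n : N) (b : B) :
    in1 K B N n * in0 K B N b = in1 K B N (MulOpposite.op b • n) := by
  rw [← decomp (in1 K B N n * in0 K B N b), p0_mul, p0_in1, zero_mul, map_zero, zero_add]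
  change shL K B N (kap K B N (mulL K B N _)) = shL K B N ((in0 K B N).lTensor N _)
  congr 1
  rw [univ_kap (mulF0 K B N) (mulF1 K B N) (mulL K B N) mulL_spec, mulF1_comul, kap_in0, kap_in1,
    tmul_zero, LinearEquiv.map_zero, LinearMap.map_zero, zero_add, lam_in0,
    HopfBimodule.coactR_op_smul]
  generalize HopfBimodule.coactR (K := K) (H := B) n = t
  generalize comul (R := K) b = s
  induction s with
  | zero => simp only [tmul_zero, LinearEquiv.map_zero, LinearMap.map_zero]
  | tmul x y =>
    induction t with
    | zero => simp only [zero_tmul, LinearEquiv.map_zero, LinearMap.map_zero]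
    | tmul m c =>
      simp only [LinearMap.lTensor_tmul, tensorTensorTensorComm_tmul, LinearMap.rTensor_tmul,
        map_tmul, bimodActR_tmul, LinearMap.mul'_apply, in0_mul]
      rfl
    | add p q hp hq => simp only [add_tmul, LinearMap.map_add, LinearEquiv.map_add, hp, hq]
  | add p q hp hq => simp only [tmul_add, LinearMap.map_add, LinearEquiv.map_add, hp, hq]

theorem in1_mem (n : N) : in1 K B N n ∈ cotSub K B N :=
  Submodule.mem_iSup_of_mem 1 (by rw [← range_in1]; exact ⟨n, rfl⟩)

end CotAmb

namespace Cot

/-- The inclusion of `N`, the component of degree one (see `range_inN`). -/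
def inN : N →ₗ[K] Cot K B N := (CotAmb.in1 K B N).codRestrict (CotAmb.cotSub K B N) CotAmb.in1_mem

/-- The homogeneous component `N^{□ n}` of degree `n`. -/
def grade (n : ℕ) : Submodule K (Cot K B N) :=
  (CotAmb.cotPow K B N n).comap (incl K B N).toLinearMap

variable {K B N}
theorem incl_inN (n : N) : incl K B N (inN K B N n) = CotAmb.in1 K B N n := rfl

theorem inN_injective : Function.Injective (inN K B N) := fun n n' h => by
  have := congrArg (fun x => CotAmb.p1 K B N (incl K B N x)) h
  simpa only [incl_inN, CotAmb.p1_in1] using this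

theorem range_inB : LinearMap.range (inB K B N).toLinearMap = grade K B N 0 := by
  ext x
  refine ⟨?_, ?_⟩
  · rintro ⟨b, rfl⟩
    exact ⟨b, rfl⟩
  · rintro ⟨b, hb⟩
    exact ⟨b, incl_injective hb⟩

theorem range_inN : LinearMap.range (inN K B N) = grade K B N 1 := by
  ext x
  change _ ↔ incl K B N x ∈ CotAmb.cotPow K B N 1
  rw [← CotAmb.range_in1]
  refine ⟨?_, ?_⟩
  · rintro ⟨b, rfl⟩
    exact ⟨b, rfl⟩
  · rintro ⟨b, hb⟩
    exact ⟨b, incl_injective hb⟩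

theorem inB_mul_inN (b : B) (n : N) : inB K B N b * inN K B N n = inN K B N (b • n) :=
  incl_injective (by rw [map_mul, incl_inB, incl_inN, incl_inN, CotAmb.in0_mul_in1])

theorem inN_mul_inB (n : N) (b : B) :
    inN K B N n * inB K B N b = inN K B N (MulOpposite.op b • n) :=
  incl_injective (by rw [map_mul, incl_inB, incl_inN, incl_inN, CotAmb.in1_mul_in0])

theorem comul_inN (n : N) : comul (R := K) (inN K B N n) =
    map (inB K B N).toLinearMap (inN K B N) (HopfBimodule.coactL n) +
      map (inN K B N) (inB K B N).toLinearMap (HopfBimodule.coactR n) := by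
  apply map_incl_injective
  rw [map_comul, incl_inN, CotAmb.comul_in1, map_add, map_map, map_map]
  rfl

end Cot
end
end

/- ### Gradings and pairings -/

section
section
namespace TensorHopf
variable (K H M : Type*) [Field K] [Ring H] [HopfAlgebra K H] [AddCommGroup M] [Module K M]
  [Module H M] [Module Hᵐᵒᵖ M]

/-- The homogeneous component of degree `n` of the tensor Hopf algebra `T_H(M)`, i.e. the image
`H · M ⋯ M` (`n` factors `M`) of `M ⊗_H ⋯ ⊗_H M`; for `n = 0` this is the copy of `H`. -/
def grade (n : ℕ) : Submodule K (TensorHopf K H M) :=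
  LinearMap.range (inH K H M).toLinearMap * LinearMap.range (inM K H M) ^ n
end TensorHopf

section Pairings
variable {K H B : Type*} [Field K] [Ring H] [HopfAlgebra K H] [Ring B] [HopfAlgebra K B]

/-- A Hopf pairing `φ : H × B → K` between Hopf algebras. In Sweedler notation the third and the
fourth condition read `φ(h, bc) = ∑ φ(h₁, b) φ(h₂, c)` and `φ(hg, b) = ∑ φ(h, b₁) φ(g, b₂)`. -/
structure IsHopfPairing (φ : H →ₗ[K] B →ₗ[K] K) : Prop where
  one_left (b : B) : φ 1 b = counit (R := K) b
  one_right (h : H) : φ h 1 = counit (R := K) h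
  apply_mul (h : H) (b c : B) :
    φ h (b * c) = LinearMap.mul' K K (map (φ.flip b) (φ.flip c) (comul h))
  mul_apply (h g : H) (b : B) :
    φ (h * g) b = LinearMap.mul' K K (map (φ h) (φ g) (comul b))
  antipode (h : H) (b : B) :
    φ (HopfAlgebra.antipode K h) b = φ h (HopfAlgebra.antipode K b)

/-- A bilinear form between two graded spaces is graded if components of different degrees are
orthogonal. -/
def IsGradedPairing {X Y : Type*} [AddCommGroup X] [Module K X] [AddCommGroup Y] [Module K Y]
    (𝒳 : ℕ → Submodule K X) (𝒴 : ℕ → Submodule K Y) (φ : X →ₗ[K] Y →ₗ[K] K) : Prop :=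
  ∀ i j, i ≠ j → ∀ x ∈ 𝒳 i, ∀ y ∈ 𝒴 j, φ x y = 0

/-- A bilinear form `φ : X × Y → K` is left non-degenerate if every non-zero `y` in the second
factor pairs non-trivially with some `x` in the first. -/
def IsLeftNondegenerate {X Y : Type*} [AddCommGroup X] [Module K X] [AddCommGroup Y] [Module K Y]
    (φ : X →ₗ[K] Y →ₗ[K] K) : Prop :=
  ∀ y, y ≠ 0 → ∃ x, φ x y ≠ 0

variable (K H) in
/-- The two-sided coaction `m ↦ ∑ m₋₁ ⊗ m₀ ⊗ m₁`, i.e. `(Id ⊗ ρ_r) ρ_l`. -/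
def HopfBimodule.coact (M : Type*) [AddCommGroup M] [Module K M] [Module H M] [Module Hᵐᵒᵖ M]
    [SMulCommClass H Hᵐᵒᵖ M] [IsScalarTower K H M] [IsScalarTower K Hᵐᵒᵖ M] [HopfBimodule K H M] :
    M →ₗ[K] H ⊗[K] (M ⊗[K] H) :=
  (HopfBimodule.coactR (K := K) (H := H)).lTensor H ∘ₗ HopfBimodule.coactL

variable (K) in
/-- The multiplication `x ⊗ y ⊗ z ↦ x y z` of scalars. -/
def mulThree : K ⊗[K] (K ⊗[K] K) →ₗ[K] K :=
  LinearMap.mul' K K ∘ₗ (LinearMap.mul' K K).lTensor K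

variable {M N : Type*} [AddCommGroup M] [Module K M]
  [Module H M] [Module Hᵐᵒᵖ M] [SMulCommClass H Hᵐᵒᵖ M] [IsScalarTower K H M]
  [IsScalarTower K Hᵐᵒᵖ M] [HopfBimodule K H M] [AddCommGroup N] [Module K N]
  [Module B N] [Module Bᵐᵒᵖ N] [SMulCommClass B Bᵐᵒᵖ N] [IsScalarTower K B N]
  [IsScalarTower K Bᵐᵒᵖ N] [HopfBimodule K B N]

/-- A pairing `(φ₀, φ₁) : (H, M) × (B, N) → K` of couples: `φ₀` is a Hopf pairing and
`φ₁(h.m.g, n) = ∑ φ₀(h, n₋₁) φ₁(m, n₀) φ₀(g, n₁)`,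
`φ₁(m, b.n.c) = ∑ φ₀(m₋₁, b) φ₁(m₀, n) φ₀(m₁, c)`. -/
structure IsCouplePairing (φ₀ : H →ₗ[K] B →ₗ[K] K) (φ₁ : M →ₗ[K] N →ₗ[K] K) : Prop where
  hopf : IsHopfPairing φ₀
  smul_left (h : H) (m : M) (g : H) (n : N) : φ₁ (MulOpposite.op g • h • m) n =
    mulThree K (map (φ₀ h) (map (φ₁ m) (φ₀ g)) (HopfBimodule.coact K B N n))
  smul_right (m : M) (b : B) (n : N) (c : B) : φ₁ m (MulOpposite.op c • b • n) =
    mulThree K (map (φ₀.flip b) (map (φ₁.flip n) (φ₀.flip c)) (HopfBimodule.coact K H M m))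

/-- A bilinear form on `T_H(M) × Cot_B(N)` extends `φ₀` and `φ₁` if it restricts to them in
degree zero, `H × B`, and in degree one, `M × N`. -/
structure ExtendsCouplePairing (φ₀ : H →ₗ[K] B →ₗ[K] K) (φ₁ : M →ₗ[K] N →ₗ[K] K)
    (φ : TensorHopf K H M →ₗ[K] Cot K B N →ₗ[K] K) : Prop where
  degree_zero (h : H) (b : B) : φ (TensorHopf.inH K H M h) (Cot.inB K B N b) = φ₀ h b
  degree_one (m : M) (n : N) : φ (TensorHopf.inM K H M m) (Cot.inN K B N n) = φ₁ m n

end Pairings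
end
end

end

/-!
A bilinear form on `T_H(M) × Cot_B(N)` that turns products in `T_H(M)` into the comultiplication of
`Cot_B(N)` is the same thing as an algebra map from `T_H(M)` to the convolution algebra `Cot_B(N)*`.
By the universal property of `T_H(M)`, such a map is determined by its restrictions to `H` and `M`.
A graded form extending `φ₀` and `φ₁` must send `h` to `φ₀(h, ·)` on the degree zero component and
`m` to `φ₁(m, ·)` on the degree one component, which gives uniqueness
(`IsCouplePairing.pairing_unique`). Conversely these two assignments respect the actions of `H` on
`M`: this is the first axiom of a pairing of couples, combined with the fact that the projection
`Cot_B(N) → N` intertwines the comultiplication with the two coactions (`Cot.coactL_proj1`,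
`Cot.coactR_proj1`). So they extend to an algebra map, `IsCouplePairing.hom`.

The multiplicativity in the second argument is the equality of two algebra maps
`T_H(M) → (Cot_B(N) ⊗ Cot_B(N))*`, and therefore needs to be checked only on `H` and `M`
(`pairingOf_apply_mul`), where it is the second axiom of a pairing of couples. Compatibility with the
antipodes is then automatic (`pairingOf_antipode`): `φ(S(·), ·)` and `φ(·, S(·))` are both
convolution inverses of `φ`.

Gradedness and non-degeneracy come from the formula
`φ(m t, n ⊗ a) = φ₁(m, n) φ(t, a)` (`IsCouplePairing.hom_inM_mul`), by induction on the degree.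
Here `n ⊗ a` stands for a sum of tensors. For non-degeneracy, if this sum, as an element of
`N ⊗ Cot_B(N)`, pairs to zero with all `m ⊗ t`, then it is zero, since `φ₁` is left non-degenerate
and, by induction, so is `φ` in lower degrees (`IsCouplePairing.trunc_eq_zero`).
-/

noncomputable section

open TensorProduct Coalgebra

/-! ### Convolution duals -/

section Convolution
open WithConv

variable {K C D : Type*} [Field K] [AddCommGroup C] [Module K C] [Coalgebra K C]
  [AddCommGroup D] [Module K D] [Coalgebra K D]

/-- The algebra map `f ↦ f ∘ F` between the convolution algebras `D* → C*` dual to a coalgebra map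
`F : C → D`. -/
def convPullback (F : C →ₗc[K] D) : WithConv (D →ₗ[K] K) →ₐ[K] WithConv (C →ₗ[K] K) :=
  AlgHom.ofLinearMap
    { toFun := fun f => toConv (f.ofConv ∘ₗ F.toLinearMap)
      map_add' := fun _ _ => rfl
      map_smul' := fun _ _ => rfl }
    (WithConv.ext (LinearMap.ext fun c => CoalgHomClass.counit_comp_apply F c))
    (fun f g => WithConv.ext (LinearMap.convMul_comp_coalgHom_distrib f g F))

variable (K C D) in
/-- The canonical algebra map `C* ⊗ D* → (C ⊗ D)*`, `f ⊗ g ↦ (c ⊗ d ↦ f(c) g(d))`, for the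
convolution products. -/
def convTensor : WithConv (C →ₗ[K] K) ⊗[K] WithConv (D →ₗ[K] K) →ₐ[K]
    WithConv (C ⊗[K] D →ₗ[K] K) :=
  Algebra.TensorProduct.algHomOfLinearMapTensorProduct
    (TensorProduct.lift (LinearMap.mk₂ K
      (fun f g => toConv (LinearMap.mul' K K ∘ₗ map f.ofConv g.ofConv))
      (fun f f' g => WithConv.ext (by simp [map_add_left, LinearMap.comp_add]))
      (fun r f g => WithConv.ext (by simp [map_smul_left, LinearMap.comp_smul]))
      (fun f g g' => WithConv.ext (by simp [map_add_right, LinearMap.comp_add]))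
      (fun r f g => WithConv.ext (by simp [map_smul_right, LinearMap.comp_smul]))))
    (fun f f' g g' => by
      refine WithConv.ext ?_
      change LinearMap.mul' K K ∘ₗ map (f * f').ofConv (g * g').ofConv = _
      have h := congrArg ofConv (map_convMul_map (f := f) (h := f') (g := g) (k := g'))
      exact (congrArg ((Algebra.TensorProduct.lmul' K (S := K)).toLinearMap ∘ₗ ·) h.symm).trans
        (LinearMap.algHom_comp_convMul_distrib (Algebra.TensorProduct.lmul' K (S := K)) _ _))
    (WithConv.ext (TensorProduct.ext' fun c d => by simp [LinearMap.convOne_def, mul_comm]))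

end Convolution

/-! ### Pairings as algebra maps into the convolution dual -/

section PairingOf
open WithConv
variable {K H B : Type*} [Field K] [Ring H] [HopfAlgebra K H] [Ring B] [HopfAlgebra K B]

/-- The bilinear form `(h, b) ↦ Φ(h)(b)` of an algebra map `Φ` into the convolution algebra `B*`. -/
def pairingOf (Φ : H →ₐ[K] WithConv (B →ₗ[K] K)) : H →ₗ[K] B →ₗ[K] K where
  toFun h := (Φ h).ofConv
  map_add' h g := by rw [map_add]; rfl
  map_smul' r h := by rw [map_smul]; rfl

theorem pairingOf_apply (Φ : H →ₐ[K] WithConv (B →ₗ[K] K)) (h : H) (b : B) :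
    pairingOf Φ h b = Φ h b := rfl

/-- The algebra map `h ↦ φ(h, ·)` into the convolution algebra `B*` of a Hopf pairing `φ`. -/
def IsHopfPairing.convHom {φ : H →ₗ[K] B →ₗ[K] K} (hφ : IsHopfPairing φ) :
    H →ₐ[K] WithConv (B →ₗ[K] K) :=
  AlgHom.ofLinearMap
    { toFun := fun h => toConv (φ h)
      map_add' := fun h g => by rw [map_add]; rfl
      map_smul' := fun r h => by rw [map_smul]; rfl }
    (WithConv.ext (LinearMap.ext hφ.one_left))
    (fun h g => WithConv.ext (LinearMap.ext (hφ.mul_apply h g)))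

theorem convTensor_map_tmul (Φ : H →ₐ[K] WithConv (B →ₗ[K] K)) (z : H ⊗[K] H) (b c : B) :
    convTensor K B B (Algebra.TensorProduct.map Φ Φ z) (b ⊗ₜ[K] c) =
      LinearMap.mul' K K (map ((pairingOf Φ).flip b) ((pairingOf Φ).flip c) z) := by
  induction z with
  | zero => simp only [map_zero]; rfl
  | tmul x y => rfl
  | add p q hp hq => rw [map_add, map_add, map_add, map_add, ← hp, ← hq]; rfl

/-- The multiplicativity of a pairing in its second argument, as an equality of two algebra maps
`H → (B ⊗ B)*`; it can therefore be checked on algebra generators of `H`. -/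
theorem pairingOf_apply_mul {Φ : H →ₐ[K] WithConv (B →ₗ[K] K)}
    (hΦ : (convPullback (Bialgebra.mulCoalgHom K B)).comp Φ =
      (convTensor K B B).comp ((Algebra.TensorProduct.map Φ Φ).comp (Bialgebra.comulAlgHom K H)))
    (h : H) (b c : B) : pairingOf Φ h (b * c) =
      LinearMap.mul' K K (map ((pairingOf Φ).flip b) ((pairingOf Φ).flip c) (comul h)) := by
  exact (congrArg (fun F : WithConv (B ⊗[K] B →ₗ[K] K) => F (b ⊗ₜ[K] c))
    (AlgHom.congr_fun hΦ h)).trans (convTensor_map_tmul Φ (comul h) b c)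

/-- Compatibility with the antipodes is automatic: both `φ(S(·), ·)` and `φ(·, S(·))` are inverse to
`φ` under convolution in `Hom(H, B*)`. -/
theorem pairingOf_antipode (Φ : H →ₐ[K] WithConv (B →ₗ[K] K))
    (one_right : ∀ h, pairingOf Φ h 1 = counit (R := K) h)
    (apply_mul : ∀ h b c, pairingOf Φ h (b * c) =
      LinearMap.mul' K K (map ((pairingOf Φ).flip b) ((pairingOf Φ).flip c) (comul h)))
    (h : H) (b : B) :
    pairingOf Φ (HopfAlgebra.antipode K h) b = pairingOf Φ h (HopfAlgebra.antipode K b) := by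
  let P : WithConv (H →ₗ[K] WithConv (B →ₗ[K] K)) := toConv Φ.toLinearMap
  let L : WithConv (H →ₗ[K] WithConv (B →ₗ[K] K)) :=
    toConv (Φ.toLinearMap ∘ₗ HopfAlgebra.antipode K)
  let R : WithConv (H →ₗ[K] WithConv (B →ₗ[K] K)) := toConv
    { toFun := fun h => toConv (pairingOf Φ h ∘ₗ HopfAlgebra.antipode K)
      map_add' := fun h g => by rw [map_add]; rfl
      map_smul' := fun r h => by rw [map_smul]; rfl }
  have hL : L * P = 1 := by
    have := LinearMap.algHom_comp_convMul_distrib Φ (toConv (HopfAlgebra.antipode K (A := H)))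
      (toConv LinearMap.id)
    rw [LinearMap.antipode_mul_id] at this
    refine WithConv.ext (this.symm.trans (LinearMap.ext fun h => ?_))
    exact AlgHom.commutes Φ _
  have hR : P * R = 1 := by
    refine WithConv.ext (LinearMap.ext fun h => WithConv.ext (LinearMap.ext fun b => ?_))
    have e1 : ∀ w : H ⊗[K] H, (LinearMap.mul' K _ (map P.ofConv R.ofConv w)) b =
        convTensor K B B (Algebra.TensorProduct.map Φ Φ w)
          ((HopfAlgebra.antipode K).lTensor B (comul b)) := by
      intro w
      induction w with
      | zero => simp only [map_zero]; rfl
      | tmul x y =>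
        change LinearMap.mul' K K (map (pairingOf Φ x) (pairingOf Φ y ∘ₗ HopfAlgebra.antipode K)
          (comul b)) = LinearMap.mul' K K (map (pairingOf Φ x) (pairingOf Φ y) _)
        rw [LinearMap.lTensor, map_map, LinearMap.comp_id]
      | add p q hp hq =>
        simp only [map_add]
        exact congrArg₂ (· + ·) hp hq
    have e2 : ∀ z : B ⊗[K] B, convTensor K B B (Algebra.TensorProduct.map Φ Φ (comul h)) z =
        pairingOf Φ h (LinearMap.mul' K B z) := by
      intro z
      induction z with
      | zero => simp only [map_zero]
      | tmul b c => rw [convTensor_map_tmul, LinearMap.mul'_apply, apply_mul]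
      | add p q hp hq => simp only [map_add, hp, hq]
    refine (e1 (comul h)).trans ((e2 _).trans ?_)
    rw [HopfAlgebra.mul_antipode_lTensor_comul_apply, Algebra.algebraMap_eq_smul_one, map_smul,
      one_right]
    exact mul_comm _ _
  have : L = R := left_inv_eq_right_inv hL hR
  exact congrArg (fun F : WithConv (H →ₗ[K] WithConv (B →ₗ[K] K)) => F h b) this

end PairingOf

/-! ### One-sided forms of the axioms of a pairing of couples -/

section Couples

variable {K H M B N : Type*} [Field K]
  [Ring H] [HopfAlgebra K H] [Ring B] [HopfAlgebra K B]
  [AddCommGroup M] [Module K M] [Module H M] [Module Hᵐᵒᵖ M] [SMulCommClass H Hᵐᵒᵖ M]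
  [IsScalarTower K H M] [IsScalarTower K Hᵐᵒᵖ M] [HopfBimodule K H M]
  [AddCommGroup N] [Module K N] [Module B N] [Module Bᵐᵒᵖ N] [SMulCommClass B Bᵐᵒᵖ N]
  [IsScalarTower K B N] [IsScalarTower K Bᵐᵒᵖ N] [HopfBimodule K B N]

/-- A counit on the right leg of `∑ m₋₁ ⊗ m₀ ⊗ m₁` leaves the left coaction. -/
theorem mulThree_coact_counit_right (a : H →ₗ[K] K) (f : M →ₗ[K] K) (m : M) :
    mulThree K (map a (map f counit) (HopfBimodule.coact K H M m)) =
      LinearMap.mul' K K (map a f (HopfBimodule.coactL m)) := by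
  have e0 : ∀ w : M ⊗[K] H, map f (counit (R := K) (A := H)) w =
      f.rTensor K (counit.lTensor M w) := fun w => by
    simp only [LinearMap.rTensor, LinearMap.lTensor, map_map]; rfl
  change mulThree K (map a (map f counit) (HopfBimodule.coactR.lTensor H _)) = _
  generalize HopfBimodule.coactL (K := K) (H := H) m = z
  induction z with
  | zero => simp only [map_zero]
  | tmul h m =>
    rw [LinearMap.lTensor_tmul, map_tmul, e0, HopfBimodule.coactR_counit]
    simp [mulThree]
  | add p q hp hq => simp only [map_add, hp, hq]

/-- A counit on the left leg of `∑ m₋₁ ⊗ m₀ ⊗ m₁` leaves the right coaction; this uses that the two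
coactions commute. -/
theorem mulThree_coact_counit_left (f : M →ₗ[K] K) (a : H →ₗ[K] K) (m : M) :
    mulThree K (map counit (map f a) (HopfBimodule.coact K H M m)) =
      LinearMap.mul' K K (map f a (HopfBimodule.coactR m)) := by
  have e0 : ∀ w : H ⊗[K] M, LinearMap.mul' K K (map (counit (R := K) (A := H)) f w) =
      TensorProduct.lid K K (f.lTensor K (counit.rTensor M w)) := fun w => by
    induction w with
    | zero => simp only [map_zero]
    | tmul => rfl
    | add p q hp hq => simp only [map_add, hp, hq]
  change mulThree K (map counit (map f a) (HopfBimodule.coactR.lTensor H _)) = _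
  rw [← HopfBimodule.coact_comm]
  generalize HopfBimodule.coactR (K := K) (H := H) m = z
  induction z with
  | zero => simp only [map_zero]
  | tmul m h =>
    have e1 : ∀ w : H ⊗[K] M, mulThree K (map counit (map f a) (TensorProduct.assoc K H M H
        (w ⊗ₜ h))) = LinearMap.mul' K K (map (counit (R := K) (A := H)) f w) * a h := by
      intro w
      induction w with
      | zero => simp only [zero_tmul, map_zero, zero_mul]
      | tmul => simp [mulThree, mul_assoc]
      | add p q hp hq => simp only [add_tmul, map_add, hp, hq, add_mul]
    rw [LinearMap.rTensor_tmul, e1, e0, HopfBimodule.coactL_counit]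
    simp
  | add p q hp hq => simp only [map_add, hp, hq]

variable {φ₀ : H →ₗ[K] B →ₗ[K] K} {φ₁ : M →ₗ[K] N →ₗ[K] K}

namespace IsCouplePairing

theorem apply_smul_left (hφ : IsCouplePairing φ₀ φ₁) (h : H) (m : M) (n : N) :
    φ₁ (h • m) n = LinearMap.mul' K K (map (φ₀ h) (φ₁ m) (HopfBimodule.coactL n)) := by
  have e : φ₀ 1 = counit := LinearMap.ext hφ.hopf.one_left
  simpa [e, mulThree_coact_counit_right] using hφ.smul_left h m 1 n

theorem apply_op_smul_left (hφ : IsCouplePairing φ₀ φ₁) (m : M) (h : H) (n : N) : φ₁ (MulOpposite.op h • m) n =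
    LinearMap.mul' K K (map (φ₁ m) (φ₀ h) (HopfBimodule.coactR n)) := by
  have e : φ₀ 1 = counit := LinearMap.ext hφ.hopf.one_left
  simpa [e, mulThree_coact_counit_left] using hφ.smul_left 1 m h n

theorem apply_smul_right (hφ : IsCouplePairing φ₀ φ₁) (m : M) (b : B) (n : N) : φ₁ m (b • n) =
    LinearMap.mul' K K (map (φ₀.flip b) (φ₁.flip n) (HopfBimodule.coactL m)) := by
  have e : φ₀.flip 1 = counit := LinearMap.ext hφ.hopf.one_right
  simpa [e, mulThree_coact_counit_right] using hφ.smul_right m b n 1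

theorem apply_op_smul_right (hφ : IsCouplePairing φ₀ φ₁) (m : M) (n : N) (b : B) : φ₁ m (MulOpposite.op b • n) =
    LinearMap.mul' K K (map (φ₁.flip n) (φ₀.flip b) (HopfBimodule.coactR m)) := by
  have e : φ₀.flip 1 = counit := LinearMap.ext hφ.hopf.one_right
  simpa [e, mulThree_coact_counit_left] using hφ.smul_right m 1 n b

end IsCouplePairing
end Couples

/-! ### The projections of the cotensor Hopf algebra onto degrees zero and one -/

section Projections

variable (K B N : Type*) [Field K] [Ring B] [HopfAlgebra K B] [AddCommGroup N] [Module K N]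
  [Module B N] [Module Bᵐᵒᵖ N] [SMulCommClass B Bᵐᵒᵖ N] [IsScalarTower K B N]
  [IsScalarTower K Bᵐᵒᵖ N] [HopfBimodule K B N]

namespace Cot

/-- The projection of `Cot_B(N)` onto its degree zero component `B`. -/
def proj0 : Cot K B N →ₗ[K] B := CotAmb.p0 K B N ∘ₗ (incl K B N).toLinearMap

/-- The projection of `Cot_B(N)` onto its degree one component `N`. -/
def proj1 : Cot K B N →ₗ[K] N := CotAmb.p1 K B N ∘ₗ (incl K B N).toLinearMap

variable {K B N}

theorem proj0_inB (b : B) : proj0 K B N (inB K B N b) = b := CotAmb.p0_in0 b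

theorem proj1_inN (n : N) : proj1 K B N (inN K B N n) = n := CotAmb.p1_in1 n

theorem proj0_one : proj0 K B N 1 = 1 := by rw [← map_one (inB K B N), proj0_inB]

theorem proj1_one : proj1 K B N 1 = 0 := by
  rw [← map_one (inB K B N)]; exact CotAmb.p1_in0 _

theorem proj0_mul (x y : Cot K B N) : proj0 K B N (x * y) = proj0 K B N x * proj0 K B N y :=
  CotAmb.p0_mul _ _

theorem proj1_mul (x y : Cot K B N) : proj1 K B N (x * y) =
    proj0 K B N x • proj1 K B N y + MulOpposite.op (proj0 K B N y) • proj1 K B N x :=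
  CotAmb.p1_mul _ _

theorem comul_proj0 (x : Cot K B N) :
    comul (proj0 K B N x) = map (proj0 K B N) (proj0 K B N) (comul x) :=
  (CotAmb.p0_comul _).symm.trans (map_incl_eq _ _ x).symm

theorem coactL_proj1 (x : Cot K B N) :
    HopfBimodule.coactL (proj1 K B N x) = map (proj0 K B N) (proj1 K B N) (comul x) :=
  (CotAmb.p1_comul _).symm.trans (map_incl_eq _ _ x).symm

/-- The right coaction on the degree one component. Unlike its left counterpart, this fails on the
ambient space `T(N) ⊗ B`, and is where the cotensor condition enters. -/
theorem coactR_proj1 (x : Cot K B N) :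
    HopfBimodule.coactR (proj1 K B N x) = map (proj1 K B N) (proj0 K B N) (comul x) :=
  (CotAmb.coactR_p1 (CotAmb.xi_of_mem (incl_mem x))).trans (map_incl_eq _ _ x).symm

/-- The projection onto degree zero as a coalgebra map. -/
def proj0C : Cot K B N →ₗc[K] B where
  toLinearMap := proj0 K B N
  counit_comp := rfl
  map_comp_comul := LinearMap.ext fun x => (comul_proj0 x).symm

theorem iSup_grade : ⨆ n, grade K B N n = ⊤ := by
  refine eq_top_iff.mpr fun x _ => ?_
  have h : incl K B N x ∈ (⨆ n, grade K B N n).map (incl K B N).toLinearMap := by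
    have e : ∀ n, (grade K B N n).map (incl K B N).toLinearMap = CotAmb.cotPow K B N n := fun n =>
      Submodule.map_comap_eq_self fun a ha => ⟨⟨a, Submodule.mem_iSup_of_mem n ha⟩, rfl⟩
    rw [Submodule.map_iSup, iSup_congr e]
    exact incl_mem x
  obtain ⟨y, hy, hxy⟩ := h
  exact incl_injective hxy ▸ hy

end Cot

namespace CotAmb
variable {K B N}

theorem pr_of_mem_cotPow {i j : ℕ} (hij : i ≠ j) {a : CotAmb K B N} (ha : a ∈ cotPow K B N j) :
    pr K B N i a = 0 := by
  induction j generalizing i a with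
  | zero =>
    obtain ⟨b, rfl⟩ := ha
    obtain ⟨i, rfl⟩ := Nat.exists_eq_succ_of_ne_zero hij
    simp [pr]
  | succ j ih =>
    obtain ⟨_, ⟨-, w, rfl⟩, rfl⟩ := ha
    cases i with
    | zero =>
      have e : p0 K B N ∘ₗ shL K B N = 0 := TensorProduct.ext' fun n a => by simp
      exact (congrArg (in0 K B N) (LinearMap.congr_fun e _)).trans (map_zero _)
    | succ i =>
      have e : pr K B N i ∘ₗ (cotPow K B N j).subtype = 0 :=
        LinearMap.ext fun y => ih (fun h => hij (congrArg _ h)) y.2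
      simp only [pr, LinearMap.comp_apply, kap_shL]
      rw [← LinearMap.lTensor_comp_apply, e, LinearMap.lTensor_zero, LinearMap.zero_apply, map_zero]

end CotAmb
end Projections

/-! ### The pairing of the tensor and the cotensor Hopf algebra -/

section CouplePairing
open WithConv

variable {K H M B N : Type*} [Field K]
  [Ring H] [HopfAlgebra K H] [Ring B] [HopfAlgebra K B]
  [AddCommGroup M] [Module K M] [Module H M] [Module Hᵐᵒᵖ M] [SMulCommClass H Hᵐᵒᵖ M]
  [IsScalarTower K H M] [IsScalarTower K Hᵐᵒᵖ M] [HopfBimodule K H M]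
  [AddCommGroup N] [Module K N] [Module B N] [Module Bᵐᵒᵖ N] [SMulCommClass B Bᵐᵒᵖ N]
  [IsScalarTower K B N] [IsScalarTower K Bᵐᵒᵖ N] [HopfBimodule K B N]
  {φ₀ : H →ₗ[K] B →ₗ[K] K} {φ₁ : M →ₗ[K] N →ₗ[K] K}

namespace IsCouplePairing

/-- The linear map `M → Cot_B(N)*` that sends `m` to `φ₁(m, ·)` on the degree one component. -/
def degreeOne (φ₁ : M →ₗ[K] N →ₗ[K] K) : M →ₗ[K] WithConv (Cot K B N →ₗ[K] K) where
  toFun m := toConv (φ₁ m ∘ₗ Cot.proj1 K B N)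
  map_add' m m' := by rw [map_add]; rfl
  map_smul' r m := by rw [map_smul]; rfl

/-- The algebra map `T_H(M) → Cot_B(N)*` into the convolution algebra which is `φ₀(h, ·)` in degree
zero for `h ∈ H`, and `φ₁(m, ·)` in degree one for `m ∈ M`. -/
def hom (hφ : IsCouplePairing φ₀ φ₁) : TensorHopf K H M →ₐ[K] WithConv (Cot K B N →ₗ[K] K) :=
  TensorHopf.lift ((convPullback Cot.proj0C).comp hφ.hopf.convHom) (degreeOne φ₁)
    (fun h m => WithConv.ext (LinearMap.ext fun x => by
      refine (hφ.apply_smul_left h m _).trans ?_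
      rw [Cot.coactL_proj1, map_map]; rfl))
    (fun m h => WithConv.ext (LinearMap.ext fun x => by
      refine (hφ.apply_op_smul_left m h _).trans ?_
      rw [Cot.coactR_proj1, map_map]; rfl))

theorem hom_inH (hφ : IsCouplePairing φ₀ φ₁) (h : H) (x : Cot K B N) :
    hφ.hom (TensorHopf.inH K H M h) x = φ₀ h (Cot.proj0 K B N x) := by
  rw [hom, TensorHopf.lift_inH]; rfl

theorem hom_inM (hφ : IsCouplePairing φ₀ φ₁) (m : M) (x : Cot K B N) :
    hφ.hom (TensorHopf.inM K H M m) x = φ₁ m (Cot.proj1 K B N x) := by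
  rw [hom, TensorHopf.lift_inM]; rfl

theorem pairing_comp_inH (hφ : IsCouplePairing φ₀ φ₁) (x : Cot K B N) :
    (pairingOf hφ.hom).flip x ∘ₗ (TensorHopf.inH K H M).toLinearMap =
      φ₀.flip (Cot.proj0 K B N x) := LinearMap.ext fun h => hφ.hom_inH h x

theorem pairing_comp_inM (hφ : IsCouplePairing φ₀ φ₁) (x : Cot K B N) :
    (pairingOf hφ.hom).flip x ∘ₗ TensorHopf.inM K H M =
      φ₁.flip (Cot.proj1 K B N x) := LinearMap.ext fun m => hφ.hom_inM m x

theorem hom_one_right (hφ : IsCouplePairing φ₀ φ₁) (t : TensorHopf K H M) :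
    pairingOf hφ.hom t 1 = counit (R := K) t := by
  -- `1` is group-like, so that evaluation at `1` is multiplicative for the convolution product.
  let ev : WithConv (Cot K B N →ₗ[K] K) →ₐ[K] K :=
    AlgHom.ofLinearMap
      { toFun := fun f => f 1
        map_add' := fun _ _ => rfl
        map_smul' := fun _ _ => rfl }
      (Bialgebra.counit_one (R := K) (A := Cot K B N))
      (fun f g => by
        change LinearMap.mul' K K (map f.ofConv g.ofConv (comul 1)) = _
        rw [Bialgebra.comul_one]; rfl)
  have e : ev.comp hφ.hom = TensorHopf.counitHom K H M := by
    refine TensorHopf.hom_ext (fun h => ?_) (fun m => ?_)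
    · refine (hφ.hom_inH h 1).trans ?_
      rw [Cot.proj0_one, hφ.hopf.one_right, TensorHopf.counitHom_inH]
    · refine (hφ.hom_inM m 1).trans ?_
      rw [Cot.proj1_one, map_zero, TensorHopf.counitHom_inM]
  exact AlgHom.congr_fun e t

theorem hom_apply_mul (hφ : IsCouplePairing φ₀ φ₁) (t : TensorHopf K H M) (x y : Cot K B N) :
    pairingOf hφ.hom t (x * y) = LinearMap.mul' K K
      (map ((pairingOf hφ.hom).flip x) ((pairingOf hφ.hom).flip y) (comul t)) := by
  refine pairingOf_apply_mul ?_ t x y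
  refine TensorHopf.hom_ext (fun h => ?_) (fun m => ?_)
  · refine WithConv.ext (TensorProduct.ext' fun x y => ?_)
    refine (hφ.hom_inH h (x * y)).trans (Eq.trans ?_ (convTensor_map_tmul hφ.hom _ x y).symm)
    change _ = LinearMap.mul' K K (map _ _ (TensorHopf.comulHom K H M _))
    rw [TensorHopf.comulHom_inH, map_map, pairing_comp_inH, pairing_comp_inH, Cot.proj0_mul,
      hφ.hopf.apply_mul]
  · refine WithConv.ext (TensorProduct.ext' fun x y => ?_)
    refine (hφ.hom_inM m (x * y)).trans (Eq.trans ?_ (convTensor_map_tmul hφ.hom _ x y).symm)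
    change _ = LinearMap.mul' K K (map _ _ (TensorHopf.comulHom K H M _))
    rw [TensorHopf.comulHom_inM, map_add, map_map, map_map, pairing_comp_inH, pairing_comp_inM,
      pairing_comp_inH, pairing_comp_inM, Cot.proj1_mul, map_add, map_add, hφ.apply_smul_right,
      hφ.apply_op_smul_right]

theorem isHopfPairing (hφ : IsCouplePairing φ₀ φ₁) :
    IsHopfPairing (pairingOf hφ.hom) where
  one_left x := by rw [pairingOf_apply, map_one]; rfl
  one_right := hφ.hom_one_right
  apply_mul := hφ.hom_apply_mul
  mul_apply t u x := by rw [pairingOf_apply, map_mul]; rfl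
  antipode := pairingOf_antipode hφ.hom hφ.hom_one_right hφ.hom_apply_mul

theorem extends_pairing (hφ : IsCouplePairing φ₀ φ₁) :
    ExtendsCouplePairing φ₀ φ₁ (pairingOf hφ.hom) where
  degree_zero h b := (hφ.hom_inH h _).trans (by rw [Cot.proj0_inB])
  degree_one m n := (hφ.hom_inM m _).trans (by rw [Cot.proj1_inN])

/-! ### Gradedness -/

/-- Peeling off a factor `h ∈ H`: it pairs with the left coaction. Here `F` is any extension of the
functional of `t` to the ambient space `T(N) ⊗ B`. -/
theorem hom_inH_mul (hφ : IsCouplePairing φ₀ φ₁) (h : H) (t : TensorHopf K H M)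
    (F : CotAmb K B N →ₗ[K] K) (hF : (hφ.hom t).ofConv = F ∘ₗ (Cot.incl K B N).toLinearMap)
    (x : Cot K B N) : hφ.hom (TensorHopf.inH K H M h * t) x =
      LinearMap.mul' K K (map (φ₀ h) F (CotAmb.lam K B N (Cot.incl K B N x))) := by
  have e : (hφ.hom (TensorHopf.inH K H M h)).ofConv =
      (φ₀ h ∘ₗ CotAmb.p0 K B N) ∘ₗ (Cot.incl K B N).toLinearMap := LinearMap.ext (hφ.hom_inH h)
  rw [map_mul, LinearMap.convMul_apply, e, hF, Cot.map_incl_eq, ← CotAmb.p0_del,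
    LinearMap.rTensor, map_map, LinearMap.comp_id]
  rfl

/-- Peeling off a factor `m ∈ M`: it pairs with the first tensor factor, i.e.
`φ(m t, n ⊗ a) = φ₁(m, n) F(a)`, where `F` is any extension of the functional of `t` to the ambient
space `T(N) ⊗ B`. -/
theorem hom_inM_mul (hφ : IsCouplePairing φ₀ φ₁) (m : M) (t : TensorHopf K H M)
    (F : CotAmb K B N →ₗ[K] K) (hF : (hφ.hom t).ofConv = F ∘ₗ (Cot.incl K B N).toLinearMap)
    (x : Cot K B N) : hφ.hom (TensorHopf.inM K H M m * t) x =
      LinearMap.mul' K K (map (φ₁ m) F (CotAmb.kap K B N (Cot.incl K B N x))) := by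
  have e : (hφ.hom (TensorHopf.inM K H M m)).ofConv =
      (φ₁ m ∘ₗ CotAmb.p1 K B N) ∘ₗ (Cot.incl K B N).toLinearMap := LinearMap.ext (hφ.hom_inM m)
  rw [map_mul, LinearMap.convMul_apply, e, hF, Cot.map_incl_eq, ← CotAmb.p1_del,
    LinearMap.rTensor, map_map, LinearMap.comp_id]

/-- The elements of `T_H(M)` whose functional on `Cot_B(N)` factors through the projection of
`T(N) ⊗ B` onto degree `n`. -/
def factorsThrough (hφ : IsCouplePairing φ₀ φ₁) (n : ℕ) : Submodule K (TensorHopf K H M) where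
  carrier := {t | ∃ F : CotAmb K B N →ₗ[K] K, (hφ.hom t).ofConv =
    (F ∘ₗ CotAmb.pr K B N n) ∘ₗ (Cot.incl K B N).toLinearMap}
  zero_mem' := ⟨0, by rw [map_zero]; rfl⟩
  add_mem' := by
    rintro s t ⟨F, hF⟩ ⟨G, hG⟩
    exact ⟨F + G, by rw [map_add, WithConv.ofConv_add, hF, hG]; rfl⟩
  smul_mem' := by
    rintro r t ⟨F, hF⟩
    exact ⟨r • F, by rw [map_smul, WithConv.ofConv_smul, hF]; rfl⟩

/-- The maps that peel off a factor `m` raise the degree by one, and those that peel off a factor `h`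
preserve it, because splitting off the first tensor factor and the left coaction commute with the
projections onto the homogeneous components. -/
theorem grade_le_factorsThrough (hφ : IsCouplePairing φ₀ φ₁) (n : ℕ) :
    TensorHopf.grade K H M n ≤ hφ.factorsThrough n := by
  have hM : ∀ n, LinearMap.range (TensorHopf.inM K H M) ^ n ≤ hφ.factorsThrough n := by
    intro n
    induction n with
    | zero =>
      rw [pow_zero, Submodule.one_le]
      refine ⟨counit, ?_⟩
      rw [map_one]
      refine LinearMap.ext fun x => ?_
      change counit (R := K) (CotAmb.p0 K B N (Cot.incl K B N x)) =
        counit (R := K) (CotAmb.p0 K B N (CotAmb.in0 K B N _))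
      rw [CotAmb.p0_in0]
      rfl
    | succ n ih =>
      rw [pow_succ', Submodule.mul_le]
      rintro _ ⟨m, rfl⟩ t ht
      obtain ⟨F, hF⟩ := ih ht
      refine ⟨LinearMap.mul' K K ∘ₗ map (φ₁ m) F ∘ₗ CotAmb.kap K B N, LinearMap.ext fun x => ?_⟩
      rw [hφ.hom_inM_mul m t _ hF]
      simp only [LinearMap.comp_apply, CotAmb.pr, CotAmb.kap_shL, LinearMap.lTensor, map_map,
        LinearMap.comp_id]
      rfl
  refine Submodule.mul_le.mpr ?_
  rintro _ ⟨h, rfl⟩ t ht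
  obtain ⟨F, hF⟩ := hM n ht
  refine ⟨LinearMap.mul' K K ∘ₗ map (φ₀ h) F ∘ₗ CotAmb.lam K B N, LinearMap.ext fun x => ?_⟩
  refine (hφ.hom_inH_mul h t _ hF x).trans ?_
  simp only [LinearMap.comp_apply, CotAmb.lam_pr, LinearMap.lTensor, map_map,
    LinearMap.comp_id]
  rfl

theorem isGradedPairing (hφ : IsCouplePairing φ₀ φ₁) :
    IsGradedPairing (TensorHopf.grade K H M) (Cot.grade K B N) (pairingOf hφ.hom) := by
  intro i j hij t ht x hx
  obtain ⟨F, hF⟩ := hφ.grade_le_factorsThrough i ht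
  refine (LinearMap.congr_fun hF x).trans ?_
  exact (congrArg F (CotAmb.pr_of_mem_cotPow hij hx)).trans (map_zero F)

/-! ### Uniqueness -/

/-- A linear form that vanishes outside degree `i` is determined by its values in degree `i`. -/
theorem _root_.Cot.linearForm_ext {f g : Cot K B N →ₗ[K] K} (i : ℕ)
    (hf : ∀ j, i ≠ j → ∀ x ∈ Cot.grade K B N j, f x = 0)
    (hg : ∀ j, i ≠ j → ∀ x ∈ Cot.grade K B N j, g x = 0)
    (h : ∀ x ∈ Cot.grade K B N i, f x = g x) : f = g := by
  have : (⊤ : Submodule K (Cot K B N)) ≤ LinearMap.eqLocus f g := by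
    rw [← Cot.iSup_grade]
    refine iSup_le fun j x hx => ?_
    rcases eq_or_ne i j with rfl | hij
    · exact h x hx
    · exact (hf j hij x hx).trans (hg j hij x hx).symm
  exact LinearMap.ext fun x => this trivial

theorem _root_.TensorHopf.inH_mem_grade (h : H) :
    TensorHopf.inH K H M h ∈ TensorHopf.grade K H M 0 := by
  rw [TensorHopf.grade, pow_zero, mul_one]; exact ⟨h, rfl⟩

theorem _root_.TensorHopf.inM_mem_grade (m : M) :
    TensorHopf.inM K H M m ∈ TensorHopf.grade K H M 1 := by
  rw [TensorHopf.grade, pow_one, ← one_mul (TensorHopf.inM K H M m)]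
  exact Submodule.mul_mem_mul ⟨1, map_one (TensorHopf.inH K H M)⟩ ⟨m, rfl⟩

theorem pairing_unique {φ ψ : TensorHopf K H M →ₗ[K] Cot K B N →ₗ[K] K}
    (h : IsHopfPairing φ) (h' : IsHopfPairing ψ)
    (hg : IsGradedPairing (TensorHopf.grade K H M) (Cot.grade K B N) φ)
    (hg' : IsGradedPairing (TensorHopf.grade K H M) (Cot.grade K B N) ψ)
    (he : ExtendsCouplePairing φ₀ φ₁ φ) (he' : ExtendsCouplePairing φ₀ φ₁ ψ) : φ = ψ := by
  have e : h.convHom = h'.convHom := by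
    refine TensorHopf.hom_ext (fun a => WithConv.ext ?_) (fun m => WithConv.ext ?_)
    · refine Cot.linearForm_ext 0 (fun j hj x hx => hg 0 j hj _ (TensorHopf.inH_mem_grade a) x hx)
        (fun j hj x hx => hg' 0 j hj _ (TensorHopf.inH_mem_grade a) x hx) fun x hx => ?_
      rw [← Cot.range_inB] at hx
      obtain ⟨b, rfl⟩ := hx
      exact (he.degree_zero a b).trans (he'.degree_zero a b).symm
    · refine Cot.linearForm_ext 1 (fun j hj x hx => hg 1 j hj _ (TensorHopf.inM_mem_grade m) x hx)
        (fun j hj x hx => hg' 1 j hj _ (TensorHopf.inM_mem_grade m) x hx) fun x hx => ?_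
      rw [← Cot.range_inN] at hx
      obtain ⟨n, rfl⟩ := hx
      exact (he.degree_one m n).trans (he'.degree_one m n).symm
  refine LinearMap.ext fun t => ?_
  exact congrArg WithConv.ofConv (AlgHom.congr_fun e t)

/-! ### Non-degeneracy -/

/-- Linear forms separate the points of the first tensor factor. -/
theorem _root_.TensorProduct.eq_zero_of_forall_dual_rTensor {V X : Type*} [AddCommGroup V]
    [Module K V] [AddCommGroup X] [Module K X] {z : V ⊗[K] X}
    (h : ∀ ν : V →ₗ[K] K, ν.rTensor X z = 0) : z = 0 := by
  classical
  let b := Module.Basis.ofVectorSpace K V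
  refine (TensorProduct.equivFinsuppOfBasisLeft b).injective (Finsupp.ext fun i => ?_)
  rw [TensorProduct.equivFinsuppOfBasisLeft_apply, h, map_zero, map_zero]
  rfl

/-- If `y` pairs to zero with all of `T_H(M)`, then its degree zero component vanishes since `φ₀` is
left non-degenerate. Its part in positive degrees is an element of `N ⊗ Cot_B(N)` that pairs to zero
with all `m ⊗ t`; as `φ₁` is left non-degenerate, applying any linear form to the factor `N` leaves
an element of `Cot_B(N)` which pairs to zero with all of `T_H(M)` and has lower degree. -/
theorem trunc_eq_zero (hφ : IsCouplePairing φ₀ φ₁) (h₀ : IsLeftNondegenerate φ₀)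
    (h₁ : IsLeftNondegenerate φ₁) (k : ℕ) (y : Cot K B N) (hy : ∀ t, hφ.hom t y = 0) :
    CotAmb.trunc K B N k (Cot.incl K B N y) = 0 := by
  induction k generalizing y with
  | zero => rfl
  | succ k ih =>
    have hp : CotAmb.p0 K B N (Cot.incl K B N y) = 0 := by
      by_contra hne
      obtain ⟨h, hh⟩ := h₀ _ hne
      exact hh ((hφ.hom_inH h y).symm.trans (hy _))
    let z : N ⊗[K] Cot K B N := (Cot.proj1 K B N).rTensor _ (comul y)
    have hz : (Cot.incl K B N).toLinearMap.lTensor N z =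
        CotAmb.kap K B N (Cot.incl K B N y) := by
      rw [← CotAmb.p1_del, ← Cot.map_comul]
      simp only [z, LinearMap.lTensor, LinearMap.rTensor, map_map]
      rfl
    have hzt : ∀ t, (hφ.hom t).ofConv.lTensor N z = 0 := by
      intro t
      refine (TensorProduct.rid K N).injective ?_
      rw [map_zero]
      by_contra hne
      obtain ⟨m, hm⟩ := h₁ _ hne
      refine hm (Eq.trans ?_ (hy (TensorHopf.inM K H M m * t)))
      have e : (hφ.hom (TensorHopf.inM K H M m)).ofConv = φ₁ m ∘ₗ Cot.proj1 K B N :=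
        LinearMap.ext (hφ.hom_inM m)
      have e' : ∀ w : N ⊗[K] Cot K B N, φ₁ m (TensorProduct.rid K N
          ((hφ.hom t).ofConv.lTensor N w)) =
          LinearMap.mul' K K (map (φ₁ m) (hφ.hom t).ofConv w) := by
        intro w
        induction w with
        | zero => simp only [map_zero]
        | tmul n x => simp [mul_comm]
        | add p q hp hq => simp only [map_add, hp, hq]
      simp only [z]
      rw [map_mul, LinearMap.convMul_apply, e, e', LinearMap.rTensor, map_map, LinearMap.comp_id]
    have hk : (CotAmb.trunc K B N k).lTensor N (CotAmb.kap K B N (Cot.incl K B N y)) = 0 := by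
      refine TensorProduct.eq_zero_of_forall_dual_rTensor fun ν => ?_
      refine (TensorProduct.lid K _).injective ?_
      have e1 : ∀ w : N ⊗[K] Cot K B N, TensorProduct.lid K _ (ν.rTensor _
          ((CotAmb.trunc K B N k).lTensor N ((Cot.incl K B N).toLinearMap.lTensor N w))) =
          CotAmb.trunc K B N k (Cot.incl K B N (TensorProduct.lid K _ (ν.rTensor _ w))) := by
        intro w
        induction w with
        | zero => simp only [map_zero]
        | tmul n x => simp
        | add p q hp hq => simp only [map_add, hp, hq]
      have e2 : ∀ t (w : N ⊗[K] Cot K B N), hφ.hom t (TensorProduct.lid K _ (ν.rTensor _ w)) =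
          TensorProduct.lid K K (ν.rTensor _ ((hφ.hom t).ofConv.lTensor N w)) := by
        intro t w
        induction w with
        | zero => simp only [map_zero]
        | tmul n x => simp
        | add p q hp hq => simp only [map_add, hp, hq]
      rw [← hz, e1, map_zero]
      exact ih _ fun t => by rw [e2, hzt, map_zero, map_zero]
    simp only [CotAmb.trunc, LinearMap.add_apply, LinearMap.comp_apply, hp, hk, map_zero, add_zero]

theorem isLeftNondegenerate (hφ : IsCouplePairing φ₀ φ₁) (h₀ : IsLeftNondegenerate φ₀)
    (h₁ : IsLeftNondegenerate φ₁) : IsLeftNondegenerate (pairingOf hφ.hom) := by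
  intro y hy
  by_contra! hne
  obtain ⟨k, hk⟩ := CotAmb.trunc_eventually (Cot.incl K B N y)
  refine hy (Cot.incl_injective ?_)
  rw [← hk k le_rfl, hφ.trunc_eq_zero h₀ h₁ k y hne, map_zero]

end IsCouplePairing
end CouplePairing

end

theorem proposition3p4 {K H M B N : Type*} [Field K]
    [Ring H] [HopfAlgebra K H] [Ring B] [HopfAlgebra K B]
    [AddCommGroup M] [Module K M] [Module H M] [Module Hᵐᵒᵖ M] [SMulCommClass H Hᵐᵒᵖ M]
    [IsScalarTower K H M] [IsScalarTower K Hᵐᵒᵖ M] [HopfBimodule K H M]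
    [AddCommGroup N] [Module K N] [Module B N] [Module Bᵐᵒᵖ N] [SMulCommClass B Bᵐᵒᵖ N]
    [IsScalarTower K B N] [IsScalarTower K Bᵐᵒᵖ N] [HopfBimodule K B N]
    (φ₀ : H →ₗ[K] B →ₗ[K] K) (φ₁ : M →ₗ[K] N →ₗ[K] K) (hφ : IsCouplePairing φ₀ φ₁) :
    (∃! φ : TensorHopf K H M →ₗ[K] Cot K B N →ₗ[K] K,
      IsHopfPairing φ ∧ IsGradedPairing (TensorHopf.grade K H M) (Cot.grade K B N) φ ∧
        ExtendsCouplePairing φ₀ φ₁ φ) ∧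
    (IsLeftNondegenerate φ₀ → IsLeftNondegenerate φ₁ →
      ∀ φ : TensorHopf K H M →ₗ[K] Cot K B N →ₗ[K] K,
        IsHopfPairing φ → IsGradedPairing (TensorHopf.grade K H M) (Cot.grade K B N) φ →
        ExtendsCouplePairing φ₀ φ₁ φ → IsLeftNondegenerate φ) := by
  have unique : ∀ φ : TensorHopf K H M →ₗ[K] Cot K B N →ₗ[K] K, IsHopfPairing φ →
      IsGradedPairing (TensorHopf.grade K H M) (Cot.grade K B N) φ →
      ExtendsCouplePairing φ₀ φ₁ φ → φ = pairingOf hφ.hom := fun φ h hg he =>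
    IsCouplePairing.pairing_unique h hφ.isHopfPairing hg hφ.isGradedPairing he hφ.extends_pairing
  refine ⟨⟨pairingOf hφ.hom, ⟨hφ.isHopfPairing, hφ.isGradedPairing, hφ.extends_pairing⟩,
    fun φ h => unique φ h.1 h.2.1 h.2.2⟩, fun h₀ h₁ φ h hg he => ?_⟩
  rw [unique φ h hg he]
  exact hφ.isLeftNondegenerate h₀ h₁
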